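/- Let $K$ be a field. For a commutative $\mathbb N$-graded $K$-algebra $A=\bigoplus_{j\ge 0}A_j$ with $A_0=K$ put $A_+=\bigoplus_{j\ge1}A_j$ and $k=A/A_+$. For a $\mathbb Z$-graded $A$-module $M$ with $M_j=0$ for all $j\ll 0$ let $$t^A_i(M)=\sup\{\,j\in\mathbb Z \mid \operatorname{Tor}^A_i(k,M)_j\neq 0\,\}\in[-\infty,\infty],\qquad \operatorname{slope}_A M=\sup_{i\ge 1}\left\{\frac{t^A_i(M)-t^A_0(M)}{i}\right\}\in[-\infty,\infty],$$ where $\sup\emptyset=-\infty$, and with the conventions $\operatorname{slope}_A M=\infty$ if $t^A_0(M)=\infty$ and $\operatorname{slope}_A 0=-\infty$. **Proposition.** Let $Q$ be a commutative $\mathbb N$-graded $K$-algebra with $Q_0=K$, let $f\in Q_+$ be a homogeneous non-zero-divisor of degree $d$, and let $R=Q/(f)$ with the induced grading. Let $M$ be a $\mathbb Z$-graded $R$-module with $M_j=0$ for all $j\ll0$, considered also as a graded $Q$-module. Then 1. $\operatorname{slope}_Q M\le\max\{\operatorname{slope}_R M,\ d\}$, and equality holds if $M\neq0$ and $f\notin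 (Q_+)^2$; 2. $\operatorname{slope}_R M\le\max\{\operatorname{slope}_Q M,\ d/2\}$, and equality holds if $M\neq0$ and $f\in Q_+\cdot\operatorname{Ann}_Q M$. No finiteness condition is imposed on $Q$ or on $M$. -/

import Mathlib

open scoped TensorProduct DirectSum

noncomputable section

namespace SlopeOfModules

universe w u v

variable {K : Type w} [Field K] {A : Type u} [CommRing A] [Algebra K A]

/-- `ℳ` makes `M` a `ℤ`-graded module over the `ℕ`-graded algebra `(A, 𝒜)`. -/
structure IsGradedModule (𝒜 : ℕ → Submodule K A) {M : Type v} [AddCommGroup M] [Module A M]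
    (ℳ : ℤ → AddSubgroup M) : Prop where
  isInternal : DirectSum.IsInternal ℳ
  smul_mem : ∀ (n : ℕ) (j : ℤ) (a : A) (x : M), a ∈ 𝒜 n → x ∈ ℳ j → a • x ∈ ℳ ((n : ℤ) + j)

/-- The graded pieces of `A` indexed by `ℤ`; those in negative degrees are zero. -/
def intPiece (𝒜 : ℕ → Submodule K A) (j : ℤ) : Submodule K A :=
  if 0 ≤ j then 𝒜 j.toNat else ⊥

/-- The degree `j` piece of the graded free module `⨁ₑ A(-deg e)`: the coordinate of an element
at the basis vector `e` lies in `A_{j - deg e}`. -/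
def freePiece (𝒜 : ℕ → Submodule K A) {ι : Type v} (deg : ι → ℤ) (j : ℤ) :
    AddSubgroup (ι →₀ A) where
  carrier := {x | ∀ e, x e ∈ intPiece 𝒜 (j - deg e)}
  zero_mem' := fun e => (intPiece 𝒜 (j - deg e)).zero_mem
  add_mem' := fun hx hy e => (intPiece 𝒜 (j - deg e)).add_mem (hx e) (hy e)
  neg_mem' := fun hx e => (intPiece 𝒜 (j - deg e)).neg_mem (hx e)

/-- One stage of the construction of a graded free resolution: the graded free module
`ι →₀ A` with basis vectors of degrees `deg`, and the submodule `Z` of those of its elements that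
the next free module has to cover. -/
structure Stage (A : Type u) [CommRing A] : Type (max u v + 1) where
  ι : Type (max u v)
  deg : ι → ℤ
  Z : Submodule A (ι →₀ A)

/-- The basis of the next free module: one basis vector, of degree `j`, for every element of
degree `j` in `Z`. -/
abbrev Stage.nextIndex (𝒜 : ℕ → Submodule K A) (s : Stage.{u, v} A) : Type (max u v) :=
  Σ j : ℤ, {x : s.ι →₀ A // x ∈ freePiece 𝒜 s.deg j ∧ x ∈ s.Z}

/-- The differential from the next free module to the present one. -/
def Stage.nextMap (𝒜 : ℕ → Submodule K A) (s : Stage.{u, v} A) :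
    (s.nextIndex 𝒜 →₀ A) →ₗ[A] (s.ι →₀ A) :=
  Finsupp.linearCombination A (fun e : s.nextIndex 𝒜 => (e.2 : s.ι →₀ A))

/-- The next stage; what is to be covered is the kernel of the differential. -/
def Stage.next (𝒜 : ℕ → Submodule K A) (s : Stage.{u, v} A) : Stage.{u, v} A where
  ι := s.nextIndex 𝒜
  deg := Sigma.fst
  Z := LinearMap.ker (s.nextMap 𝒜)

section Resolution

variable (𝒜 : ℕ → Submodule K A) {M : Type v} [AddCommGroup M] [Module A M]
  (ℳ : ℤ → AddSubgroup M)

/-- The augmentation `F₀ → M`: the graded free module `F₀` has one basis vector of degree `j` for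
every element of `M_j`. -/
def augmentation : (ULift.{u} (Σ j : ℤ, ℳ j) →₀ A) →ₗ[A] M :=
  Finsupp.linearCombination A (fun e => (e.down.2 : M))

/-- The stages of the standard graded free resolution `⋯ → F₂ → F₁ → F₀ → M → 0`. -/
def stage : ℕ → Stage.{u, v} A
  | 0 => { ι := ULift.{u} (Σ j : ℤ, ℳ j)
           deg := fun e => e.down.1
           Z := LinearMap.ker (augmentation ℳ) }
  | n + 1 => (stage n).next 𝒜

/-- The graded free module `Fₙ`. -/
abbrev resModule (n : ℕ) : Type (max u v) := (stage 𝒜 ℳ n).ι →₀ A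

/-- The degree `j` piece of `Fₙ`. -/
def resPiece (n : ℕ) (j : ℤ) : AddSubgroup (resModule 𝒜 ℳ n) :=
  freePiece 𝒜 (stage 𝒜 ℳ n).deg j

/-- The differential `Fₙ₊₁ → Fₙ`. -/
def resD (n : ℕ) : resModule 𝒜 ℳ (n + 1) →ₗ[A] resModule 𝒜 ℳ n :=
  (stage 𝒜 ℳ n).nextMap 𝒜

end Resolution

section Slope

variable (𝒜 : ℕ → Submodule K A) [GradedAlgebra 𝒜]

/-- The ideal `A₊ = ⨁_{j ≥ 1} A_j`. -/
abbrev plusIdeal : Ideal A := (HomogeneousIdeal.irrelevant 𝒜).toIdeal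

/-- The `A`-module `k = A / A₊`. -/
abbrev residue : Type u := A ⧸ plusIdeal 𝒜

variable {M : Type v} [AddCommGroup M] [Module A M] (ℳ : ℤ → AddSubgroup M)

/-- The degree `j` piece of `k ⊗ Fₙ`, the image of the degree `j` piece of `Fₙ`. -/
def tensorPiece (n : ℕ) (j : ℤ) : AddSubgroup (residue 𝒜 ⊗[A] resModule 𝒜 ℳ n) :=
  (resPiece 𝒜 ℳ n j).map
    (TensorProduct.mk A (residue 𝒜) (resModule 𝒜 ℳ n) 1).toAddMonoidHom

/-- The differential `k ⊗ Fₙ₊₁ → k ⊗ Fₙ`. -/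
def tensorD (n : ℕ) :
    residue 𝒜 ⊗[A] resModule 𝒜 ℳ (n + 1) →ₗ[A] residue 𝒜 ⊗[A] resModule 𝒜 ℳ n :=
  (resD 𝒜 ℳ n).lTensor (residue 𝒜)

/-- The cycles of internal degree `j` and homological degree `i` in `k ⊗ F`. -/
def torCycles : (i : ℕ) → (j : ℤ) → AddSubgroup (residue 𝒜 ⊗[A] resModule 𝒜 ℳ i)
  | 0, j => tensorPiece 𝒜 ℳ 0 j
  | n + 1, j => (LinearMap.ker (tensorD 𝒜 ℳ n)).toAddSubgroup ⊓ tensorPiece 𝒜 ℳ (n + 1) j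

/-- The boundaries of internal degree `j` and homological degree `i` in `k ⊗ F`. -/
def torBoundaries (i : ℕ) (j : ℤ) : AddSubgroup (residue 𝒜 ⊗[A] resModule 𝒜 ℳ i) :=
  (tensorPiece 𝒜 ℳ (i + 1) j).map (tensorD 𝒜 ℳ i).toAddMonoidHom

/-- `Tor_i^A(k, M)_j`, the degree `j` piece of the `i`-th homology of `k ⊗ F`, where `F` is the
standard graded free resolution of `M`. -/
abbrev gradedTor (i : ℕ) (j : ℤ) : Type (max u v) :=
  torCycles 𝒜 ℳ i j ⧸ (torBoundaries 𝒜 ℳ i j).addSubgroupOf (torCycles 𝒜 ℳ i j)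

/-- `t_i^A(M) = sup {j ∈ ℤ | Tor_i^A(k, M)_j ≠ 0}`, an element of `[-∞, ∞]`. -/
def topDegree (i : ℕ) : EReal :=
  ⨆ (j : ℤ) (_ : Nontrivial (gradedTor 𝒜 ℳ i j)), ((j : ℝ) : EReal)

open Classical in
/-- `slope_A M = sup_{i ≥ 1} (t_i - t_0) / i`, an element of `[-∞, ∞]`. It is `∞` by convention
when `t_0 = ∞`. A term with `t_i = -∞` is `-∞` (`EReal` has `⊥ - ⊥ = ⊥`, which matters only for
the zero module). -/
def slope : EReal :=
  if topDegree 𝒜 ℳ 0 = ⊤ then ⊤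
  else ⨆ (i : ℕ) (_ : 1 ≤ i), (topDegree 𝒜 ℳ i - topDegree 𝒜 ℳ 0) / (i : EReal)

end Slope

end SlopeOfModules

end

/-! Let `B` be the bar resolution of `M` over `Q`, with tensor products over `K`. Inserting an
element `c ∈ Ann M` at every position of a bar word, with alternating signs, gives a `Q`-linear map
`E_c` (`barE`) with `D E_c + E_c D = c` (`barD_barE`). The `E_c` have square zero and anticommute.
Since `f` kills `M`, multiplication by `f` on `B` thus has a null-homotopy `E` of square exactly
zero, so no higher homotopies are needed. On `⨁ᵢ B y⁽ⁱ⁾`, with `y⁽ⁱ⁾` the divided powers of a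
variable of bidegree `(2, d)`, the operator `V = D + E · shift` satisfies `V² = f · shift`. As `f`
is a non-zero-divisor, `V` modulo `f` is a resolution of `M` over `R` (`coneAux_exact`,
`coneResolution`).

Tensoring with `k`, the copy `i = 0` is a subcomplex `k ⊗ B`, and the quotient is the cone itself
shifted by `(2, d)`. The resulting exact sequence `Tor^R_{n-1}(-d) → Tor^Q_n → Tor^R_n →
Tor^R_{n-2}(-d)` (`HomologyNonzero.to_cone`, `HomologyNonzero.of_cone`) gives `t^Q_n ≤ max (t^R_n)
(t^R_{n-1} + d)` and `t^R_n ≤ max (t^Q_n) (t^R_{n-2} + d)`. Also `Tor_0` is the same over both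
rings. The first bound yields the inequality in 1 directly, the second yields the one in 2 by
induction.

Equality in 1: if `f ∉ (Q₊)²`, there is a derivation `φ : Q → K` with `φ f = 1`. Contracting the
first bar slot against `φ` gives an operator `I` on `k ⊗ B` that anticommutes with `D` and satisfies
`I E + E I = 1`. Hence the shift of the cone is null-homotopic, `Tor^Q_n → Tor^R_n` is onto, and `E`
embeds `Tor^Q_0(-d)` in `Tor^Q_1`.

Equality in 2: if `f = ∑ aᵢ cᵢ` with `aᵢ ∈ Q₊` and `cᵢ ∈ Ann M`, then `∑ aᵢ E_{cᵢ}` is another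
square-zero homotopy for `f`, and it vanishes on `k ⊗ B`. The cone splits into shifted copies of `k
⊗ B`, so that `Tor^Q_n` and, for `n = 2`, also `Tor^Q_0(-d)` occur in `Tor^R_n`.

Boundedness below serves only to make `Tor_0` non-zero when `M ≠ 0`. -/

noncomputable section

namespace SlopeOfModules

/-! ### Base change of maps between free modules. -/

section BaseChange

variable {β γ δ A B C : Type*} [CommRing A] [CommRing B] [CommRing C]

/-- The ring homomorphism `g` applied to all coordinates. -/
def mapCoeff (g : A →+* B) : (β →₀ A) →+ (β →₀ B) :=
  Finsupp.mapRange.addMonoidHom g.toAddMonoidHom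

@[simp] lemma mapCoeff_apply (g : A →+* B) (x : β →₀ A) (b : β) : mapCoeff g x b = g (x b) := by
  simp [mapCoeff]

@[simp] lemma mapCoeff_single (g : A →+* B) (b : β) (a : A) :
    mapCoeff g (Finsupp.single b a) = Finsupp.single b (g a) := by
  simp [mapCoeff]

lemma mapCoeff_smul (g : A →+* B) (a : A) (x : β →₀ A) :
    mapCoeff g (a • x) = g a • mapCoeff g x := by
  ext b; simp

lemma mapCoeff_mapCoeff (g : A →+* B) (h : B →+* C) (x : β →₀ A) :
    mapCoeff h (mapCoeff g x) = mapCoeff (h.comp g) x := by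
  ext b; simp

lemma mapCoeff_surjective (g : A →+* B) (hg : Function.Surjective g) :
    Function.Surjective (mapCoeff (β := β) g) := by
  intro y
  exact Finsupp.mapRange_surjective _ (map_zero _) hg y

/-- Two linear maps on a free module agree if they agree on the basis. -/
lemma free_ext {N : Type*} [AddCommGroup N] [Module A N] {L L' : (β →₀ A) →ₗ[A] N}
    (h : ∀ b, L (Finsupp.single b 1) = L' (Finsupp.single b 1)) : L = L' :=
  Finsupp.lhom_ext' fun b => LinearMap.ext_ring (h b)

/-- Base change of a linear map between free modules along `g`. -/
def baseChangeMap (g : A →+* B) (L : (β →₀ A) →ₗ[A] (γ →₀ A)) : (β →₀ B) →ₗ[B] (γ →₀ B) :=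
  Finsupp.linearCombination B fun b => mapCoeff g (L (Finsupp.single b 1))

@[simp] lemma baseChangeMap_single_one (g : A →+* B) (L : (β →₀ A) →ₗ[A] (γ →₀ A)) (b : β) :
    baseChangeMap g L (Finsupp.single b 1) = mapCoeff g (L (Finsupp.single b 1)) := by
  simp [baseChangeMap]

lemma baseChangeMap_mapCoeff (g : A →+* B) (L : (β →₀ A) →ₗ[A] (γ →₀ A)) (x : β →₀ A) :
    baseChangeMap g L (mapCoeff g x) = mapCoeff g (L x) := by
  induction x using Finsupp.induction_linear with
  | zero => simp
  | add x y hx hy => simp [hx, hy]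
  | single b a =>
    have h1 : Finsupp.single b a = a • Finsupp.single b (1 : A) := by simp
    rw [h1, mapCoeff_smul, map_smul, map_smul, mapCoeff_smul, mapCoeff_single, map_one,
      baseChangeMap_single_one]

lemma baseChangeMap_comp (g : A →+* B) (L : (γ →₀ A) →ₗ[A] (δ →₀ A))
    (L' : (β →₀ A) →ₗ[A] (γ →₀ A)) (x : β →₀ B) :
    baseChangeMap g L (baseChangeMap g L' x) = baseChangeMap g (L ∘ₗ L') x := by
  have : baseChangeMap g L ∘ₗ baseChangeMap g L' = baseChangeMap g (L ∘ₗ L') :=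
    free_ext fun b => by simp [baseChangeMap_mapCoeff]
  exact LinearMap.congr_fun this x

lemma baseChangeMap_baseChangeMap (g : A →+* B) (h : B →+* C) (L : (β →₀ A) →ₗ[A] (γ →₀ A)) :
    baseChangeMap h (baseChangeMap g L) = baseChangeMap (h.comp g) L :=
  free_ext fun b => by simp [mapCoeff_mapCoeff]

@[simp] lemma baseChangeMap_add (g : A →+* B) (L L' : (β →₀ A) →ₗ[A] (γ →₀ A)) :
    baseChangeMap g (L + L') = baseChangeMap g L + baseChangeMap g L' :=
  free_ext fun b => by simp

@[simp] lemma baseChangeMap_sub (g : A →+* B) (L L' : (β →₀ A) →ₗ[A] (γ →₀ A)) :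
    baseChangeMap g (L - L') = baseChangeMap g L - baseChangeMap g L' :=
  free_ext fun b => by simp

@[simp] lemma baseChangeMap_zero (g : A →+* B) :
    baseChangeMap g (0 : (β →₀ A) →ₗ[A] (γ →₀ A)) = 0 :=
  free_ext fun b => by simp

@[simp] lemma baseChangeMap_id (g : A →+* B) :
    baseChangeMap g (LinearMap.id : (β →₀ A) →ₗ[A] (β →₀ A)) = LinearMap.id :=
  free_ext fun b => by simp

@[simp] lemma baseChangeMap_smul (g : A →+* B) (a : A) (L : (β →₀ A) →ₗ[A] (γ →₀ A)) :
    baseChangeMap g (a • L) = g a • baseChangeMap g L :=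
  free_ext fun b => by simp [mapCoeff_smul]

end BaseChange

/-! ### Bigraded free modules. -/

section Pieces

universe w u

variable {K : Type w} [Field K] {A : Type u} [CommRing A] [Algebra K A]
  (𝒜 : ℕ → Submodule K A)

lemma intPiece_natCast (n : ℕ) : intPiece 𝒜 (n : ℤ) = 𝒜 n := by simp [intPiece]

lemma mem_intPiece {a : A} {j : ℤ} :
    a ∈ intPiece 𝒜 j ↔ a = 0 ∨ ∃ n : ℕ, j = n ∧ a ∈ 𝒜 n := by
  unfold intPiece
  split_ifs with h
  · constructor
    · intro ha; exact Or.inr ⟨j.toNat, by omega, ha⟩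
    · rintro (rfl | ⟨n, rfl, ha⟩)
      · exact zero_mem _
      · simpa using ha
  · constructor
    · intro ha; exact Or.inl (by simpa using ha)
    · rintro (rfl | ⟨n, rfl, ha⟩)
      · exact zero_mem _
      · omega

/-- `𝒩` is a family of subgroups of `N` on which `𝒜` acts as on a graded module. -/
def SMulGraded {N : Type*} [AddCommGroup N] [Module A N] (𝒩 : ℤ → AddSubgroup N) : Prop :=
  ∀ (n : ℕ) (j : ℤ) (a : A) (x : N), a ∈ 𝒜 n → x ∈ 𝒩 j → a • x ∈ 𝒩 ((n : ℤ) + j)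

lemma SMulGraded.intPiece_smul_mem {N : Type*} [AddCommGroup N] [Module A N]
    {𝒩 : ℤ → AddSubgroup N} (h : SMulGraded 𝒜 𝒩) {i j l : ℤ} {a : A} {x : N}
    (ha : a ∈ intPiece 𝒜 i) (hx : x ∈ 𝒩 j) (hl : l = i + j) : a • x ∈ 𝒩 l := by
  subst hl
  rcases (mem_intPiece 𝒜).1 ha with rfl | ⟨n, rfl, ha⟩
  · simp
  · exact h n j a x ha hx

variable {β : Type*} (hom : β → ℕ) (deg : β → ℤ)

/-- The piece of homological degree `n` and internal degree `j` of the bigraded free module with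
basis vectors of homological degrees `hom` and internal degrees `deg`. -/
def biPiece (n : ℕ) (j : ℤ) : AddSubgroup (β →₀ A) where
  carrier := {x | ∀ b, x b ∈ intPiece 𝒜 (j - deg b) ∧ (x b ≠ 0 → hom b = n)}
  zero_mem' := fun b => ⟨zero_mem _, fun h => absurd rfl h⟩
  add_mem' := fun {x y} hx hy b => ⟨add_mem (hx b).1 (hy b).1, fun h => by
    by_cases h' : x b = 0
    · exact (hy b).2 (by simpa [h'] using h)
    · exact (hx b).2 h'⟩
  neg_mem' := fun {x} hx b => ⟨neg_mem (hx b).1, fun h => (hx b).2 (by simpa using h)⟩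

variable {hom deg}

/-- A linear map on a bigraded free module respects degrees if it does so on the basis. -/
lemma map_mem_of_basis {N : Type*} [AddCommGroup N] [Module A N]
    {𝒩 : ℤ → AddSubgroup N} (h : SMulGraded 𝒜 𝒩) (L : (β →₀ A) →ₗ[A] N) {n : ℕ} {c : ℤ}
    (hL : ∀ b, hom b = n → L (Finsupp.single b 1) ∈ 𝒩 (deg b + c)) {j : ℤ} {x : β →₀ A}
    (hx : x ∈ biPiece 𝒜 hom deg n j) : L x ∈ 𝒩 (j + c) := by
  rw [← Finsupp.sum_single x, Finsupp.sum, map_sum]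
  refine sum_mem fun b hb => ?_
  have h1 : Finsupp.single b (x b) = x b • Finsupp.single b (1 : A) := by simp
  rw [h1, map_smul]
  exact h.intPiece_smul_mem 𝒜 (hx b).1 (hL b ((hx b).2 (Finsupp.mem_support_iff.1 hb))) (by ring)

lemma single_mem_biPiece {b : β} {n : ℕ} {j : ℤ} {a : A} (hn : hom b = n)
    (ha : a ∈ intPiece 𝒜 (j - deg b)) : Finsupp.single b a ∈ biPiece 𝒜 hom deg n j := by
  classical
  intro c
  rw [Finsupp.single_apply]
  split_ifs with h
  · subst h; exact ⟨ha, fun _ => hn⟩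
  · exact ⟨zero_mem _, fun h => absurd rfl h⟩

variable [GradedAlgebra 𝒜]

lemma intPiece_mul_mem {i j l : ℤ} {a b : A} (ha : a ∈ intPiece 𝒜 i) (hb : b ∈ intPiece 𝒜 j)
    (hl : l = i + j) : a * b ∈ intPiece 𝒜 l := by
  subst hl
  rcases (mem_intPiece 𝒜).1 ha with rfl | ⟨n, rfl, ha⟩
  · simp
  rcases (mem_intPiece 𝒜).1 hb with rfl | ⟨m, rfl, hb⟩
  · simp
  rw [← Nat.cast_add, intPiece_natCast]
  exact SetLike.GradedMul.mul_mem ha hb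

lemma biPiece_smulGraded (n : ℕ) : SMulGraded 𝒜 (biPiece 𝒜 hom deg n) := by
  intro m j a x ha hx b
  refine ⟨?_, fun h => (hx b).2 fun h0 => h (by simp [h0])⟩
  rw [Finsupp.smul_apply, smul_eq_mul]
  exact intPiece_mul_mem 𝒜 (by rwa [intPiece_natCast]) (hx b).1 (by ring)

lemma single_one_mem_biPiece (b : β) :
    Finsupp.single b 1 ∈ biPiece 𝒜 hom deg (hom b) (deg b) :=
  single_mem_biPiece 𝒜 rfl (by
    rw [sub_self, ← Nat.cast_zero, intPiece_natCast]; exact SetLike.GradedOne.one_mem)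

end Pieces

/-! ### The augmentation `A → A / A₊ = K`. -/

section Augmentation

universe w u

variable {K : Type w} [Field K] {A : Type u} [CommRing A] [Algebra K A]
  (𝒜 : ℕ → Submodule K A) [GradedAlgebra 𝒜]

lemma mem_plusIdeal_of_mem {n : ℕ} (hn : n ≠ 0) {a : A} (ha : a ∈ 𝒜 n) : a ∈ plusIdeal 𝒜 := by
  change a ∈ HomogeneousIdeal.irrelevant 𝒜
  rw [HomogeneousIdeal.mem_irrelevant_iff, GradedRing.proj_apply,
    DirectSum.decompose_of_mem_ne 𝒜 ha hn]

lemma sub_proj_zero_mem_plusIdeal (a : A) : a - GradedRing.proj 𝒜 0 a ∈ plusIdeal 𝒜 := by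
  change _ ∈ HomogeneousIdeal.irrelevant 𝒜
  rw [HomogeneousIdeal.mem_irrelevant_iff, map_sub, sub_eq_zero, GradedRing.proj_apply,
    GradedRing.proj_apply, DirectSum.decompose_coe, DirectSum.of_eq_same]

/-- `aug` is the projection of `A` onto `A / A₊ = K`. -/
def IsAug (aug : A →ₐ[K] K) : Prop := ∀ a, aug a = 0 ↔ a ∈ plusIdeal 𝒜

/-- Modulo `A₊` every element equals its component of degree zero, which is a scalar, and `1 ∉ A₊`.
So `K → A / A₊` is bijective, and its inverse gives the augmentation. -/
lemma exists_isAug (h0 : 𝒜 0 = 1) [Nontrivial A] : ∃ aug : A →ₐ[K] K, IsAug 𝒜 aug := by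
  have hne : plusIdeal 𝒜 ≠ ⊤ := by
    rw [Ne, Ideal.eq_top_iff_one]
    change ¬ (1 ∈ HomogeneousIdeal.irrelevant 𝒜)
    rw [HomogeneousIdeal.mem_irrelevant_iff, GradedRing.proj_apply,
      DirectSum.decompose_of_mem_same 𝒜 SetLike.GradedOne.one_mem]
    exact one_ne_zero
  have : Nontrivial (A ⧸ plusIdeal 𝒜) := Ideal.Quotient.nontrivial_iff.2 hne
  have hbij : Function.Bijective (algebraMap K (A ⧸ plusIdeal 𝒜)) := by
    refine ⟨(algebraMap K _).injective, fun y => ?_⟩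
    obtain ⟨a, rfl⟩ := Ideal.Quotient.mk_surjective y
    have h1 : GradedRing.proj 𝒜 0 a ∈ 𝒜 0 := by
      rw [GradedRing.proj_apply]; exact SetLike.coe_mem _
    rw [h0, Submodule.mem_one] at h1
    obtain ⟨c, hc⟩ := h1
    refine ⟨c, ?_⟩
    rw [IsScalarTower.algebraMap_apply K A, Ideal.Quotient.algebraMap_eq, hc]
    exact (Ideal.Quotient.eq.2 (sub_proj_zero_mem_plusIdeal 𝒜 a)).symm
  let E := AlgEquiv.ofBijective (Algebra.ofId K (A ⧸ plusIdeal 𝒜)) hbij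
  refine ⟨E.symm.toAlgHom.comp (Ideal.Quotient.mkₐ K _), fun a => ?_⟩
  rw [← Ideal.Quotient.eq_zero_iff_mem]
  exact map_eq_zero_iff E.symm E.symm.injective

variable {𝒜} {aug : A →ₐ[K] K}

lemma IsAug.eq_zero_of_apply_ne_zero (haug : IsAug 𝒜 aug) {j : ℤ} {a : A}
    (ha : a ∈ intPiece 𝒜 j) (hj : aug a ≠ 0) : j = 0 := by
  rcases (mem_intPiece 𝒜).1 ha with rfl | ⟨n, rfl, ha⟩
  · simp at hj
  · by_contra h
    exact hj ((haug a).2 (mem_plusIdeal_of_mem 𝒜 (by simpa using h) ha))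

end Augmentation

/-! ### Graded free resolutions, and the independence of `Tor` from the resolution. -/

section Resolutions

universe w u v t

/-- A graded free resolution of `M`, presented as one free module with a bigraded basis. -/
structure FreeResolution {K : Type w} [Field K] {A : Type u} [CommRing A] [Algebra K A]
    (𝒜 : ℕ → Submodule K A) {M : Type v} [AddCommGroup M] [Module A M]
    (ℳ : ℤ → AddSubgroup M) : Type (max u v (t + 1)) where
  β : Type t
  hom : β → ℕ
  deg : β → ℤ
  D : (β →₀ A) →ₗ[A] (β →₀ A)
  ε : (β →₀ A) →ₗ[A] M
  D_mem : ∀ n b, hom b = n + 1 → D (Finsupp.single b 1) ∈ biPiece 𝒜 hom deg n (deg b)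
  D_zero : ∀ b, hom b = 0 → D (Finsupp.single b 1) = 0
  ε_mem : ∀ b, hom b = 0 → ε (Finsupp.single b 1) ∈ ℳ (deg b)
  D_D : ∀ x, D (D x) = 0
  ε_D : ∀ x, ε (D x) = 0
  -- Exactness is required of bihomogeneous elements only; lifting basis vectors needs no more.
  exact : ∀ n j, ∀ x ∈ biPiece 𝒜 hom deg (n + 1) j, D x = 0 →
    ∃ y ∈ biPiece 𝒜 hom deg (n + 2) j, D y = x
  exact_zero : ∀ j, ∀ x ∈ biPiece 𝒜 hom deg 0 j, ε x = 0 →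
    ∃ y ∈ biPiece 𝒜 hom deg 1 j, D y = x
  surj : ∀ j, ∀ m ∈ ℳ j, ∃ x ∈ biPiece 𝒜 hom deg 0 j, ε x = m

section HomNZ

variable {K : Type w} [Field K] {β γ : Type*}

/-- The elements of bidegree `(n, j)` of a vector space with a bigraded basis. -/
def biSupp (K : Type w) [Field K] (hom : β → ℕ) (deg : β → ℤ) (n : ℕ) (j : ℤ) :
    Submodule K (β →₀ K) where
  carrier := {z | ∀ b, z b ≠ 0 → hom b = n ∧ deg b = j}
  zero_mem' := fun b h => absurd rfl h
  add_mem' := fun {x y} hx hy b h => by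
    by_cases h' : x b = 0
    · exact hy b (by simpa [h'] using h)
    · exact hx b h'
  smul_mem' := fun c x hx b h => hx b fun h0 => h (by simp [h0])

/-- The complex `D` of vector spaces has non-zero homology in bidegree `(n, j)`. -/
def HomologyNonzero (hom : β → ℕ) (deg : β → ℤ) (D : (β →₀ K) →ₗ[K] (β →₀ K))
    (n : ℕ) (j : ℤ) : Prop :=
  ∃ z ∈ biSupp K hom deg n j, D z = 0 ∧ ∀ y, D y ≠ z

lemma map_mem_biSupp {hom : β → ℕ} {deg : β → ℤ} {hom' : γ → ℕ} {deg' : γ → ℤ}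
    (L : (β →₀ K) →ₗ[K] (γ →₀ K)) {n n' : ℕ} {j j' : ℤ}
    (hL : ∀ b, hom b = n → deg b = j → L (Finsupp.single b 1) ∈ biSupp K hom' deg' n' j')
    {z : β →₀ K} (hz : z ∈ biSupp K hom deg n j) : L z ∈ biSupp K hom' deg' n' j' := by
  rw [← Finsupp.sum_single z, Finsupp.sum, map_sum]
  refine sum_mem fun b hb => ?_
  have h1 : Finsupp.single b (z b) = z b • Finsupp.single b (1 : K) := by simp
  have h2 := hz b (Finsupp.mem_support_iff.1 hb)
  rw [h1, map_smul]
  exact Submodule.smul_mem _ _ (hL b h2.1 h2.2)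

/-- The differential `D` lowers the homological degree by one and preserves the internal one. -/
def IsBigraded (hom : β → ℕ) (deg : β → ℤ) (D : (β →₀ K) →ₗ[K] (β →₀ K)) : Prop :=
  ∀ b c, D (Finsupp.single b 1) c ≠ 0 → hom b = hom c + 1 ∧ deg b = deg c

open Classical in
lemma IsBigraded.filter {hom : β → ℕ} {deg : β → ℤ} {D : (β →₀ K) →ₗ[K] (β →₀ K)}
    (hD : IsBigraded hom deg D) (n : ℕ) (j : ℤ) (y : β →₀ K) :
    D (y.filter fun b => hom b = n + 1 ∧ deg b = j) =
      (D y).filter fun b => hom b = n ∧ deg b = j := by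
  induction y using Finsupp.induction_linear with
  | zero => rw [Finsupp.filter_zero, map_zero, Finsupp.filter_zero]
  | add x y hx hy => simp only [Finsupp.filter_add, map_add, hx, hy]
  | single b a =>
    have h1 : Finsupp.single b a = a • Finsupp.single b (1 : K) := by simp
    rw [h1, Finsupp.filter_smul, map_smul, map_smul, Finsupp.filter_smul]
    congr 1
    ext c
    by_cases hb : hom b = n + 1 ∧ deg b = j
    · rw [Finsupp.filter_single_of_pos (fun b => hom b = n + 1 ∧ deg b = j) hb,
        Finsupp.filter_apply]
      split_ifs with hc
      · rfl
      · by_contra h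
        obtain ⟨h1, h2⟩ := hD b c h
        exact hc ⟨by omega, by omega⟩
    · rw [Finsupp.filter_single_of_neg (fun b => hom b = n + 1 ∧ deg b = j) hb, map_zero,
        Finsupp.filter_apply]
      split_ifs with hc
      · by_contra h
        obtain ⟨h1, h2⟩ := hD b c (Ne.symm h)
        exact hb ⟨by omega, by omega⟩
      · rfl

/-- `HomologyNonzero` excludes boundaries of arbitrary chains. Truncating a chain to bidegree `(n +
1, j)` shows that this is the same as excluding boundaries of chains of the right bidegree. -/
lemma IsBigraded.exists_mem {hom : β → ℕ} {deg : β → ℤ} {D : (β →₀ K) →ₗ[K] (β →₀ K)}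
    (hD : IsBigraded hom deg D) {n : ℕ} {j : ℤ} {y : β →₀ K}
    (hy : D y ∈ biSupp K hom deg n j) : ∃ y' ∈ biSupp K hom deg (n + 1) j, D y' = D y := by
  classical
  refine ⟨y.filter fun b => hom b = n + 1 ∧ deg b = j, fun b hb => ?_, ?_⟩
  · by_contra h
    exact hb (Finsupp.filter_apply_neg _ _ h)
  · rw [hD.filter, Finsupp.filter_eq_self_iff]
    exact hy

lemma IsBigraded.map_mem {hom : β → ℕ} {deg : β → ℤ} {D : (β →₀ K) →ₗ[K] (β →₀ K)}
    (hD : IsBigraded hom deg D) {n : ℕ} {j : ℤ} {z : β →₀ K}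
    (hz : z ∈ biSupp K hom deg (n + 1) j) : D z ∈ biSupp K hom deg n j :=
  map_mem_biSupp D (fun b h1 h2 c hc => by
    have := hD b c hc
    exact ⟨by omega, by omega⟩) hz

end HomNZ

variable {K : Type w} [Field K] {A : Type u} [CommRing A] [Algebra K A]
  {𝒜 : ℕ → Submodule K A} {M : Type v} [AddCommGroup M] [Module A M]
  {ℳ : ℤ → AddSubgroup M}

lemma FreeResolution.D_eq_zero (F : FreeResolution.{w, u, v, t} 𝒜 ℳ) {j : ℤ}
    {x : F.β →₀ A} (hx : x ∈ biPiece 𝒜 F.hom F.deg 0 j) : F.D x = 0 := by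
  rw [← Finsupp.sum_single x, Finsupp.sum, map_sum]
  refine Finset.sum_eq_zero fun b hb => ?_
  have h1 : Finsupp.single b (x b) = x b • Finsupp.single b (1 : A) := by simp
  rw [h1, map_smul, F.D_zero b ((hx b).2 (Finsupp.mem_support_iff.1 hb)), smul_zero]

lemma linearMap_eq_on_biPiece {β N : Type*} [AddCommGroup N] [Module A N]
    {hom : β → ℕ} {deg : β → ℤ} {L L' : (β →₀ A) →ₗ[A] N} {n : ℕ} {j : ℤ}
    (h : ∀ b, hom b = n → L (Finsupp.single b 1) = L' (Finsupp.single b 1)) {x : β →₀ A}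
    (hx : x ∈ biPiece 𝒜 hom deg n j) : L x = L' x := by
  rw [← Finsupp.sum_single x, Finsupp.sum, map_sum, map_sum]
  refine Finset.sum_congr rfl fun b hb => ?_
  have h1 : Finsupp.single b (x b) = x b • Finsupp.single b (1 : A) := by simp
  rw [h1, map_smul, map_smul, h b ((hx b).2 (Finsupp.mem_support_iff.1 hb))]

variable [GradedAlgebra 𝒜]

/-- A coordinate that survives the augmentation has degree zero, so the internal degree is carried
by the basis vector alone. -/
lemma mapCoeff_mem_biSupp {β : Type*} {hom : β → ℕ} {deg : β → ℤ} {aug : A →ₐ[K] K}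
    (haug : IsAug 𝒜 aug) {n : ℕ} {j : ℤ} {x : β →₀ A} (hx : x ∈ biPiece 𝒜 hom deg n j) :
    mapCoeff (aug : A →+* K) x ∈ biSupp K hom deg n j := fun b hb => by
  have hb' : aug (x b) ≠ 0 := by simpa using hb
  refine ⟨(hx b).2 fun h0 => hb' (by simp [h0]), ?_⟩
  have := haug.eq_zero_of_apply_ne_zero (hx b).1 hb'
  omega

/-- `Tor_n(k, M)_j ≠ 0`, computed from the resolution `F`. -/
def FreeResolution.TorNonzero (F : FreeResolution.{w, u, v, t} 𝒜 ℳ) (aug : A →ₐ[K] K)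
    (n : ℕ) (j : ℤ) : Prop :=
  HomologyNonzero F.hom F.deg (baseChangeMap (aug : A →+* K) F.D) n j

lemma FreeResolution.isBigraded (F : FreeResolution.{w, u, v, t} 𝒜 ℳ) {aug : A →ₐ[K] K}
    (haug : IsAug 𝒜 aug) : IsBigraded F.hom F.deg (baseChangeMap (aug : A →+* K) F.D) := by
  intro b c h
  rw [baseChangeMap_single_one] at h
  rcases hn : F.hom b with _ | n
  · rw [F.D_zero b hn, map_zero] at h
    exact absurd rfl h
  · have := mapCoeff_mem_biSupp haug (F.D_mem n b hn) c h
    exact ⟨by omega, by omega⟩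

/-- A sequence built step by step from a relation between consecutive terms. -/
lemma exists_seq_of_step {X : Type*} (P : ℕ → X → Prop) (r : ℕ → X → X → Prop) {x₀ : X}
    (h0 : P 0 x₀) (hstep : ∀ n x, P n x → ∃ y, P (n + 1) y ∧ r n x y) :
    ∃ s : ℕ → X, s 0 = x₀ ∧ (∀ n, P n (s n)) ∧ ∀ n, r n (s n) (s (n + 1)) := by
  choose! g hg using hstep
  let s : ℕ → X := fun n => Nat.rec x₀ (fun n x => g n x) n
  have hs : ∀ n, P n (s n) := fun n => by
    induction n with
    | zero => exact h0
    | succ n ih => exact (hg n _ ih).1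
  exact ⟨s, rfl, hs, fun n => (hg n _ (hs n)).2⟩

/-- A linear map of a bigraded free module that preserves degrees on the basis, in homological
degree `n`. -/
lemma map_mem_biPiece {β γ : Type*} {hom : β → ℕ} {deg : β → ℤ} {hom' : γ → ℕ} {deg' : γ → ℤ}
    (L : (β →₀ A) →ₗ[A] (γ →₀ A)) {n m : ℕ}
    (hL : ∀ b, hom b = n → L (Finsupp.single b 1) ∈ biPiece 𝒜 hom' deg' m (deg b)) {j : ℤ}
    {x : β →₀ A} (hx : x ∈ biPiece 𝒜 hom deg n j) : L x ∈ biPiece 𝒜 hom' deg' m j := by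
  have := map_mem_of_basis 𝒜 (biPiece_smulGraded 𝒜 (hom := hom') (deg := deg') m) L (c := 0)
    (fun b hb => by simpa using hL b hb) hx
  simpa using this

section Comparison

universe t'

variable (F : FreeResolution.{w, u, v, t} 𝒜 ℳ) (F' : FreeResolution.{w, u, v, t'} 𝒜 ℳ)

/-- The elements of homological degree `n` that exactness concerns. -/
def FreeResolution.Cycle : ℕ → (F.β →₀ A) → Prop
  | 0, x => F.ε x = 0
  | _ + 1, x => F.D x = 0

lemma FreeResolution.exists_of_cycle {n : ℕ} {j : ℤ} {x : F.β →₀ A}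
    (hx : x ∈ biPiece 𝒜 F.hom F.deg n j) (hc : F.Cycle n x) :
    ∃ y ∈ biPiece 𝒜 F.hom F.deg (n + 1) j, F.D y = x := by
  cases n with
  | zero => exact F.exact_zero j x hx hc
  | succ n => exact F.exact n j x hx hc

/-- A linear map with prescribed values on the basis vectors of homological degree `n`. -/
lemma exists_linearMap_of_basis {β N : Type*} [AddCommGroup N] [Module A N] (hom : β → ℕ) (n : ℕ)
    (p : β → N → Prop) (h : ∀ b, hom b = n → ∃ y, p b y) :
    ∃ L : (β →₀ A) →ₗ[A] N, ∀ b, hom b = n → p b (L (Finsupp.single b 1)) := by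
  choose! g hg using h
  exact ⟨Finsupp.linearCombination A g, fun b hb => by simpa using hg b hb⟩

/-- The linear map that agrees with `s n` in homological degree `n`. -/
def glue {β N : Type*} [AddCommGroup N] [Module A N] (hom : β → ℕ)
    (s : ℕ → (β →₀ A) →ₗ[A] N) : (β →₀ A) →ₗ[A] N :=
  Finsupp.linearCombination A fun b => s (hom b) (Finsupp.single b 1)

lemma glue_single {β N : Type*} [AddCommGroup N] [Module A N] (hom : β → ℕ)
    (s : ℕ → (β →₀ A) →ₗ[A] N) (b : β) :
    glue hom s (Finsupp.single b 1) = s (hom b) (Finsupp.single b 1) := by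
  simp [glue]

lemma glue_apply {β N : Type*} [AddCommGroup N] [Module A N] {hom : β → ℕ} {deg : β → ℤ}
    (s : ℕ → (β →₀ A) →ₗ[A] N) {n : ℕ} {j : ℤ} {x : β →₀ A}
    (hx : x ∈ biPiece 𝒜 hom deg n j) : glue hom s x = s n x :=
  linearMap_eq_on_biPiece (fun b hb => by rw [glue_single, hb]) hx

/-- The identity of `M` lifts to a morphism of graded free resolutions. -/
lemma FreeResolution.exists_chainMap : ∃ Φ : (F.β →₀ A) →ₗ[A] (F'.β →₀ A),
    (∀ b, Φ (Finsupp.single b 1) ∈ biPiece 𝒜 F'.hom F'.deg (F.hom b) (F.deg b)) ∧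
    (∀ x, F'.D (Φ x) = Φ (F.D x)) ∧
    ∀ b, F.hom b = 0 → F'.ε (Φ (Finsupp.single b 1)) = F.ε (Finsupp.single b 1) := by
  -- The map `φ` matters in homological degree `n` only; `glue` assembles the final map. The second
  -- condition is what allows the next lift.
  let P : ℕ → ((F.β →₀ A) →ₗ[A] (F'.β →₀ A)) → Prop := fun n φ =>
    (∀ b, F.hom b = n → φ (Finsupp.single b 1) ∈ biPiece 𝒜 F'.hom F'.deg n (F.deg b)) ∧
    ∀ b, F.hom b = n + 1 → F'.Cycle n (φ (F.D (Finsupp.single b 1)))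
  let r : ℕ → ((F.β →₀ A) →ₗ[A] (F'.β →₀ A)) → ((F.β →₀ A) →ₗ[A] (F'.β →₀ A)) → Prop :=
    fun n φ ψ => ∀ b, F.hom b = n + 1 →
      F'.D (ψ (Finsupp.single b 1)) = φ (F.D (Finsupp.single b 1))
  obtain ⟨φ₀, hφ₀⟩ := exists_linearMap_of_basis (A := A) F.hom 0
    (fun b y => y ∈ biPiece 𝒜 F'.hom F'.deg 0 (F.deg b) ∧ F'.ε y = F.ε (Finsupp.single b 1))
    (fun b hb => F'.surj _ _ (F.ε_mem b hb))
  have h0 : P 0 φ₀ := by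
    refine ⟨fun b hb => (hφ₀ b hb).1, fun b hb => ?_⟩
    have h1 := linearMap_eq_on_biPiece (L := F'.ε ∘ₗ φ₀) (L' := F.ε)
      (fun b hb => (hφ₀ b hb).2) (F.D_mem 0 b hb)
    exact h1.trans (F.ε_D _)
  have hstep : ∀ n φ, P n φ → ∃ ψ, P (n + 1) ψ ∧ r n φ ψ := by
    intro n φ hφ
    obtain ⟨ψ, hψ⟩ := exists_linearMap_of_basis (A := A) F.hom (n + 1)
      (fun b y => y ∈ biPiece 𝒜 F'.hom F'.deg (n + 1) (F.deg b) ∧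
        F'.D y = φ (F.D (Finsupp.single b 1)))
      (fun b hb => F'.exists_of_cycle (map_mem_biPiece φ hφ.1 (F.D_mem n b hb)) (hφ.2 b hb))
    refine ⟨ψ, ⟨fun b hb => (hψ b hb).1, fun b hb => ?_⟩, fun b hb => (hψ b hb).2⟩
    have h1 := linearMap_eq_on_biPiece (L := F'.D ∘ₗ ψ) (L' := φ ∘ₗ F.D)
      (fun b hb => (hψ b hb).2) (F.D_mem (n + 1) b hb)
    exact h1.trans (by simp [F.D_D])
  obtain ⟨s, hs0, hsP, hsr⟩ := exists_seq_of_step P r h0 hstep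
  refine ⟨glue F.hom s, fun b => ?_, fun x => ?_, fun b hb => ?_⟩
  · rw [glue_single]
    exact (hsP _).1 b rfl
  · have : F'.D ∘ₗ glue F.hom s = glue F.hom s ∘ₗ F.D := by
      refine free_ext fun b => ?_
      simp only [LinearMap.comp_apply, glue_single]
      rcases hn : F.hom b with _ | n
      · rw [F.D_zero b hn, map_zero]
        exact F'.D_eq_zero ((hsP 0).1 b hn)
      · rw [glue_apply s (F.D_mem n b hn), hsr n b hn]
    exact LinearMap.congr_fun this x
  · rw [glue_single, hb, hs0]
    exact (hφ₀ b hb).2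

/-- A degree-preserving endomorphism of a graded free resolution that lifts zero is homotopic to
zero. -/
lemma FreeResolution.exists_homotopy (θ : (F.β →₀ A) →ₗ[A] (F.β →₀ A))
    (hθ : ∀ b, θ (Finsupp.single b 1) ∈ biPiece 𝒜 F.hom F.deg (F.hom b) (F.deg b))
    (hD : ∀ x, F.D (θ x) = θ (F.D x))
    (hε : ∀ b, F.hom b = 0 → F.ε (θ (Finsupp.single b 1)) = 0) :
    ∃ H : (F.β →₀ A) →ₗ[A] (F.β →₀ A), ∀ x, F.D (H x) + H (F.D x) = θ x := by
  -- The second condition makes `θ - h D` a cycle in degree `n + 1`; a lift of it through `D` is the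
  -- next component of the homotopy.
  let P : ℕ → ((F.β →₀ A) →ₗ[A] (F.β →₀ A)) → Prop := fun n h =>
    (∀ b, F.hom b = n → h (Finsupp.single b 1) ∈ biPiece 𝒜 F.hom F.deg (n + 1) (F.deg b)) ∧
    ∀ b, F.hom b = n + 1 →
      F.D (θ (Finsupp.single b 1) - h (F.D (Finsupp.single b 1))) = 0
  let r : ℕ → ((F.β →₀ A) →ₗ[A] (F.β →₀ A)) → ((F.β →₀ A) →ₗ[A] (F.β →₀ A)) → Prop :=
    fun n h h' => ∀ b, F.hom b = n + 1 → F.D (h' (Finsupp.single b 1)) =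
      θ (Finsupp.single b 1) - h (F.D (Finsupp.single b 1))
  obtain ⟨h₀, hh₀⟩ := exists_linearMap_of_basis (A := A) F.hom 0
    (fun b y => y ∈ biPiece 𝒜 F.hom F.deg 1 (F.deg b) ∧ F.D y = θ (Finsupp.single b 1))
    (fun b hb => F.exact_zero _ _ (hb ▸ hθ b) (hε b hb))
  have h0 : P 0 h₀ := by
    refine ⟨fun b hb => (hh₀ b hb).1, fun b hb => ?_⟩
    have h1 := linearMap_eq_on_biPiece (L := F.D ∘ₗ h₀) (L' := θ)
      (fun b hb => (hh₀ b hb).2) (F.D_mem 0 b hb)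
    rw [LinearMap.comp_apply] at h1
    rw [map_sub, h1, hD, sub_self]
  have hstep : ∀ n h, P n h → ∃ h', P (n + 1) h' ∧ r n h h' := by
    intro n h hh
    obtain ⟨h', hh'⟩ := exists_linearMap_of_basis (A := A) F.hom (n + 1)
      (fun b y => y ∈ biPiece 𝒜 F.hom F.deg (n + 2) (F.deg b) ∧
        F.D y = θ (Finsupp.single b 1) - h (F.D (Finsupp.single b 1)))
      (fun b hb => F.exact n _ _
        (sub_mem (hb ▸ hθ b) (map_mem_biPiece h hh.1 (F.D_mem n b hb))) (hh.2 b hb))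
    refine ⟨h', ⟨fun b hb => (hh' b hb).1, fun b hb => ?_⟩, fun b hb => (hh' b hb).2⟩
    have h1 := linearMap_eq_on_biPiece (L := F.D ∘ₗ h') (L' := θ - h ∘ₗ F.D)
      (fun b hb => (hh' b hb).2) (F.D_mem (n + 1) b hb)
    simp only [LinearMap.comp_apply, LinearMap.sub_apply, F.D_D, map_zero, sub_zero] at h1
    rw [map_sub, h1, hD, sub_self]
  obtain ⟨s, hs0, hsP, hsr⟩ := exists_seq_of_step P r h0 hstep
  refine ⟨glue F.hom s, fun x => ?_⟩
  have : F.D ∘ₗ glue F.hom s + glue F.hom s ∘ₗ F.D = θ := by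
    refine free_ext fun b => ?_
    simp only [LinearMap.comp_apply, LinearMap.add_apply, glue_single]
    rcases hn : F.hom b with _ | n
    · rw [F.D_zero b hn, map_zero, add_zero, hs0]
      exact (hh₀ b hn).2
    · rw [glue_apply s (F.D_mem n b hn), hsr n b hn, sub_add_cancel]
  exact LinearMap.congr_fun this x

/-- `Tor` does not depend on the graded free resolution. -/
lemma FreeResolution.TorNonzero.of_resolution {aug : A →ₐ[K] K} (haug : IsAug 𝒜 aug) {n : ℕ}
    {j : ℤ} (h : F.TorNonzero aug n j) : F'.TorNonzero aug n j := by
  obtain ⟨Φ, hΦ, hΦD, hΦε⟩ := F.exists_chainMap F'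
  obtain ⟨Ψ, hΨ, hΨD, hΨε⟩ := F'.exists_chainMap F
  -- One homotopy `Ψ Φ ≃ 1` suffices: it makes `Φ` injective on homology, and only non-vanishing is
  -- to be transported.
  obtain ⟨H, hH⟩ := F.exists_homotopy (Ψ ∘ₗ Φ - LinearMap.id)
    (fun b => sub_mem (map_mem_biPiece Ψ (fun c hc => hc ▸ hΨ c) (hΦ b))
      (single_one_mem_biPiece 𝒜 b))
    (fun x => by simp [hΨD, hΦD])
    (fun b hb => by
      have h1 := linearMap_eq_on_biPiece (L := F.ε ∘ₗ Ψ) (L' := F'.ε)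
        (fun c hc => hΨε c hc) (hb ▸ hΦ b)
      rw [LinearMap.comp_apply] at h1
      simp [h1, hΦε b hb])
  obtain ⟨z, hz, hDz, hbd⟩ := h
  let g : A →+* K := aug
  have hc : ∀ x, baseChangeMap g F'.D (baseChangeMap g Φ x) =
      baseChangeMap g Φ (baseChangeMap g F.D x) := fun x => by
    rw [baseChangeMap_comp, baseChangeMap_comp]
    congr 2
    exact LinearMap.ext hΦD
  have hc' : ∀ x, baseChangeMap g F.D (baseChangeMap g Ψ x) =
      baseChangeMap g Ψ (baseChangeMap g F'.D x) := fun x => by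
    rw [baseChangeMap_comp, baseChangeMap_comp]
    congr 2
    exact LinearMap.ext hΨD
  have hh : ∀ x, baseChangeMap g F.D (baseChangeMap g H x) +
      baseChangeMap g H (baseChangeMap g F.D x) =
      baseChangeMap g Ψ (baseChangeMap g Φ x) - x := fun x => by
    have h1 : F.D ∘ₗ H + H ∘ₗ F.D = Ψ ∘ₗ Φ - LinearMap.id := LinearMap.ext hH
    have h2 := congrArg (fun L => baseChangeMap g L x) h1
    simpa [baseChangeMap_comp] using h2
  refine ⟨baseChangeMap g Φ z, ?_, ?_, fun y hy => ?_⟩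
  · refine map_mem_biSupp _ (fun b hb1 hb2 => ?_) hz
    rw [baseChangeMap_single_one]
    exact hb1 ▸ hb2 ▸ mapCoeff_mem_biSupp haug (hΦ b)
  · rw [hc]
    exact (congrArg _ hDz).trans (map_zero _)
  -- If `D y = Φ z`, then `D (Ψ y) = Ψ Φ z = z + D (H z)`, because `D z = 0`.
  · refine hbd (baseChangeMap g Ψ y - baseChangeMap g H z) ?_
    have h1 := hh z
    have h2 : baseChangeMap g F.D z = 0 := hDz
    rw [h2, map_zero, add_zero] at h1
    change baseChangeMap g F.D _ = z
    rw [map_sub, hc', h1, hy]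
    abel

end Comparison

end Resolutions

/-! ### The standard resolution, and `gradedTor` as homology of a complex over `K`. -/

section Standard

universe w u v

section Sigma

variable {K : Type w} [Field K] {A : Type u} [CommRing A] [Algebra K A]
  {𝒜 : ℕ → Submodule K A} {ι : ℕ → Type v} {deg : ∀ n, ι n → ℤ}

variable (A) in
/-- The inclusion of the `n`-th summand in a direct sum of free modules. -/
def sigmaIncl (ι : ℕ → Type v) (n : ℕ) : (ι n →₀ A) →ₗ[A] ((Σ n, ι n) →₀ A) :=
  Finsupp.lmapDomain A A (Sigma.mk (β := ι) n)

lemma sigmaIncl_single (n : ℕ) (e : ι n) (a : A) :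
    sigmaIncl A ι n (Finsupp.single e a) = Finsupp.single ⟨n, e⟩ a :=
  Finsupp.mapDomain_single

lemma sigmaIncl_injective (n : ℕ) : Function.Injective (sigmaIncl A ι n) :=
  Finsupp.mapDomain_injective sigma_mk_injective

lemma sigmaIncl_apply (n : ℕ) (x : ι n →₀ A) (e : ι n) :
    sigmaIncl A ι n x ⟨n, e⟩ = x e :=
  Finsupp.mapDomain_apply sigma_mk_injective x e

lemma sigmaIncl_apply_ne {n m : ℕ} (x : ι n →₀ A) (e : ι m) (h : m ≠ n) :
    sigmaIncl A ι n x ⟨m, e⟩ = 0 :=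
  Finsupp.mapDomain_of_notMem_range x _ (by
    rintro ⟨e', he'⟩
    exact h (congrArg Sigma.fst he').symm)

lemma sigmaIncl_mem {n : ℕ} {j : ℤ} {x : ι n →₀ A} :
    sigmaIncl A ι n x ∈
      biPiece 𝒜 (fun b : Σ n, ι n => b.1) (fun b => deg b.1 b.2) n j ↔
    x ∈ freePiece 𝒜 (deg n) j := by
  constructor
  · intro h e
    have := (h ⟨n, e⟩).1
    rwa [sigmaIncl_apply] at this
  · rintro h ⟨m, e⟩
    by_cases hm : m = n
    · subst hm
      rw [sigmaIncl_apply]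
      exact ⟨h e, fun _ => rfl⟩
    · rw [sigmaIncl_apply_ne x e hm]
      exact ⟨zero_mem _, fun h => absurd rfl h⟩

lemma exists_sigmaIncl_eq {n : ℕ} {j : ℤ} {y : (Σ n, ι n) →₀ A}
    (hy : y ∈ biPiece 𝒜 (fun b : Σ n, ι n => b.1) (fun b => deg b.1 b.2) n j) :
    ∃ x ∈ freePiece 𝒜 (deg n) j, sigmaIncl A ι n x = y := by
  have h : sigmaIncl A ι n
      (y.comapDomain (Sigma.mk n) sigma_mk_injective.injOn) = y :=
    Finsupp.mapDomain_comapDomain _ sigma_mk_injective _ fun b hb =>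
      ⟨(((hy b).2 (Finsupp.mem_support_iff.1 hb) : b.1 = n) ▸ b.2), by
        have := (hy b).2 (Finsupp.mem_support_iff.1 hb)
        obtain ⟨m, e⟩ := b
        subst this
        rfl⟩
  exact ⟨_, sigmaIncl_mem.1 (h.symm ▸ hy), h⟩

end Sigma

variable {K : Type w} [Field K] {A : Type u} [CommRing A] [Algebra K A]
  (𝒜 : ℕ → Submodule K A) {M : Type v} [AddCommGroup M] [Module A M]
  (ℳ : ℤ → AddSubgroup M)

/-- The basis of the direct sum of the modules of the standard resolution. -/
abbrev StdIndex : Type (max u v) := Σ n, (stage 𝒜 ℳ n).ι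

/-- The inclusion of `Fₙ` in the direct sum of the modules of the standard resolution. -/
abbrev stdIncl (n : ℕ) : resModule 𝒜 ℳ n →ₗ[A] (StdIndex 𝒜 ℳ →₀ A) :=
  sigmaIncl A (fun n => (stage 𝒜 ℳ n).ι) n

/-- The differential of the standard resolution. -/
def stdD : (StdIndex 𝒜 ℳ →₀ A) →ₗ[A] (StdIndex 𝒜 ℳ →₀ A) :=
  Finsupp.linearCombination A fun b => match b with
    | ⟨0, _⟩ => 0
    | ⟨n + 1, e⟩ => stdIncl 𝒜 ℳ n (resD 𝒜 ℳ n (Finsupp.single e 1))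

/-- The augmentation of the standard resolution. -/
def stdε : (StdIndex 𝒜 ℳ →₀ A) →ₗ[A] M :=
  Finsupp.linearCombination A fun b => match b with
    | ⟨0, e⟩ => augmentation ℳ (Finsupp.single e (1 : A))
    | ⟨_ + 1, _⟩ => 0

lemma stdIncl_single (n : ℕ) (e : (stage 𝒜 ℳ n).ι) (a : A) :
    stdIncl 𝒜 ℳ n (Finsupp.single e a) = Finsupp.single ⟨n, e⟩ a :=
  sigmaIncl_single (ι := fun n => (stage 𝒜 ℳ n).ι) n e a

lemma stdIncl_mem {n : ℕ} {j : ℤ} {x : resModule 𝒜 ℳ n} :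
    stdIncl 𝒜 ℳ n x ∈
      biPiece 𝒜 (fun b : StdIndex 𝒜 ℳ => b.1) (fun b => (stage 𝒜 ℳ b.1).deg b.2) n j ↔
    x ∈ resPiece 𝒜 ℳ n j :=
  sigmaIncl_mem (ι := fun n => (stage 𝒜 ℳ n).ι) (deg := fun n => (stage 𝒜 ℳ n).deg)

lemma exists_stdIncl_eq {n : ℕ} {j : ℤ} {y : StdIndex 𝒜 ℳ →₀ A}
    (hy : y ∈ biPiece 𝒜 (fun b : StdIndex 𝒜 ℳ => b.1)
      (fun b => (stage 𝒜 ℳ b.1).deg b.2) n j) :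
    ∃ x ∈ resPiece 𝒜 ℳ n j, stdIncl 𝒜 ℳ n x = y :=
  exists_sigmaIncl_eq (ι := fun n => (stage 𝒜 ℳ n).ι) (deg := fun n => (stage 𝒜 ℳ n).deg) hy

lemma augmentation_single_mem (e : ULift.{u} (Σ j : ℤ, ℳ j)) :
    augmentation ℳ (Finsupp.single e (1 : A)) ∈ ℳ e.down.1 := by
  rw [augmentation, Finsupp.linearCombination_single, one_smul]
  exact e.down.2.2

lemma stdD_incl_zero (x : resModule 𝒜 ℳ 0) : stdD 𝒜 ℳ (stdIncl 𝒜 ℳ 0 x) = 0 := by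
  have : stdD 𝒜 ℳ ∘ₗ stdIncl 𝒜 ℳ 0 = 0 :=
    free_ext fun b => by
      rw [LinearMap.comp_apply, stdIncl_single, stdD, Finsupp.linearCombination_single, smul_zero,
        LinearMap.zero_apply]
  exact LinearMap.congr_fun this x

lemma stdD_incl_succ (n : ℕ) (x : resModule 𝒜 ℳ (n + 1)) :
    stdD 𝒜 ℳ (stdIncl 𝒜 ℳ (n + 1) x) = stdIncl 𝒜 ℳ n (resD 𝒜 ℳ n x) := by
  have : stdD 𝒜 ℳ ∘ₗ stdIncl 𝒜 ℳ (n + 1) = stdIncl 𝒜 ℳ n ∘ₗ resD 𝒜 ℳ n :=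
    free_ext fun b => by
      rw [LinearMap.comp_apply, stdIncl_single, stdD, Finsupp.linearCombination_single, one_smul,
        LinearMap.comp_apply]
  exact LinearMap.congr_fun this x

lemma stdε_incl_zero (x : resModule 𝒜 ℳ 0) :
    stdε 𝒜 ℳ (stdIncl 𝒜 ℳ 0 x) = augmentation ℳ x := by
  have : stdε 𝒜 ℳ ∘ₗ stdIncl 𝒜 ℳ 0 = augmentation ℳ :=
    free_ext fun b => by
      rw [LinearMap.comp_apply, stdIncl_single, stdε, Finsupp.linearCombination_single, one_smul]
      rfl
  exact LinearMap.congr_fun this x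

lemma stdε_incl_succ (n : ℕ) (x : resModule 𝒜 ℳ (n + 1)) :
    stdε 𝒜 ℳ (stdIncl 𝒜 ℳ (n + 1) x) = 0 := by
  have : stdε 𝒜 ℳ ∘ₗ stdIncl 𝒜 ℳ (n + 1) = 0 :=
    free_ext fun b => by
      rw [LinearMap.comp_apply, stdIncl_single, stdε, Finsupp.linearCombination_single, smul_zero,
        LinearMap.zero_apply]
  exact LinearMap.congr_fun this x

variable {𝒜 ℳ}

lemma resD_single_mem (n : ℕ) (e : (stage 𝒜 ℳ (n + 1)).ι) :
    resD 𝒜 ℳ n (Finsupp.single e 1) ∈ resPiece 𝒜 ℳ n ((stage 𝒜 ℳ (n + 1)).deg e) := by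
  have h : resD 𝒜 ℳ n (Finsupp.single e 1) = e.2.1 :=
    (Finsupp.linearCombination_single A 1 e).trans (one_smul _ _)
  rw [h]
  exact e.2.2.1

lemma resD_mem_Z (n : ℕ) (x : resModule 𝒜 ℳ (n + 1)) :
    resD 𝒜 ℳ n x ∈ (stage 𝒜 ℳ n).Z := by
  refine Submodule.sum_mem _ fun e _ => Submodule.smul_mem _ _ ?_
  exact e.2.2.2

/-- Each homogeneous element to be covered has its own basis vector in the next module. Exactness of
the standard resolution follows at once. -/
lemma exists_resD_eq {n : ℕ} {j : ℤ} {x : resModule 𝒜 ℳ n} (hx : x ∈ resPiece 𝒜 ℳ n j)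
    (hZ : x ∈ (stage 𝒜 ℳ n).Z) : ∃ e : (stage 𝒜 ℳ (n + 1)).ι,
      (stage 𝒜 ℳ (n + 1)).deg e = j ∧ resD 𝒜 ℳ n (Finsupp.single e 1) = x :=
  ⟨⟨j, x, hx, hZ⟩, rfl, (Finsupp.linearCombination_single A 1 _).trans (one_smul _ _)⟩

lemma resD_resD (n : ℕ) (x : resModule 𝒜 ℳ (n + 2)) :
    resD 𝒜 ℳ n (resD 𝒜 ℳ (n + 1) x) = 0 :=
  resD_mem_Z (n + 1) x

lemma augmentation_resD (x : resModule 𝒜 ℳ 1) : augmentation ℳ (resD 𝒜 ℳ 0 x) = 0 :=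
  resD_mem_Z 0 x

variable [GradedAlgebra 𝒜]

lemma stdIncl_single_mem {n : ℕ} {e : (stage 𝒜 ℳ n).ι} {j : ℤ} (he : (stage 𝒜 ℳ n).deg e = j) :
    stdIncl 𝒜 ℳ n (Finsupp.single e 1) ∈
      biPiece 𝒜 (fun b : StdIndex 𝒜 ℳ => b.1) (fun b => (stage 𝒜 ℳ b.1).deg b.2) n j := by
  rw [stdIncl_single]
  subst he
  exact single_one_mem_biPiece 𝒜 (hom := fun b : StdIndex 𝒜 ℳ => b.1)
    (deg := fun b => (stage 𝒜 ℳ b.1).deg b.2) ⟨n, e⟩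

variable (𝒜 ℳ)

/-- The standard resolution as a graded free resolution. -/
def stdResolution : FreeResolution.{w, u, v, max u v} 𝒜 ℳ where
  β := StdIndex 𝒜 ℳ
  hom := fun b => b.1
  deg := fun b => (stage 𝒜 ℳ b.1).deg b.2
  D := stdD 𝒜 ℳ
  ε := stdε 𝒜 ℳ
  D_mem := by
    rintro n ⟨m, e⟩ (rfl : m = n + 1)
    have h : stdD 𝒜 ℳ (Finsupp.single ⟨n + 1, e⟩ 1) =
        stdIncl 𝒜 ℳ n (resD 𝒜 ℳ n (Finsupp.single e 1)) := by
      rw [← stdIncl_single, stdD_incl_succ]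
    rw [h]
    exact (stdIncl_mem 𝒜 ℳ).2 (resD_single_mem n e)
  D_zero := by
    rintro ⟨m, e⟩ (rfl : m = 0)
    rw [← stdIncl_single, stdD_incl_zero]
  ε_mem := by
    rintro ⟨m, e⟩ (rfl : m = 0)
    rw [← stdIncl_single, stdε_incl_zero]
    exact augmentation_single_mem ℳ e
  D_D := by
    have : stdD 𝒜 ℳ ∘ₗ stdD 𝒜 ℳ = 0 := by
      refine free_ext ?_
      rintro ⟨_ | _ | n, e⟩
      · rw [LinearMap.comp_apply, ← stdIncl_single, stdD_incl_zero, map_zero, LinearMap.zero_apply]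
      · rw [LinearMap.comp_apply, ← stdIncl_single, stdD_incl_succ, stdD_incl_zero,
          LinearMap.zero_apply]
      · rw [LinearMap.comp_apply, ← stdIncl_single, stdD_incl_succ, stdD_incl_succ, resD_resD,
          map_zero, LinearMap.zero_apply]
    exact LinearMap.congr_fun this
  ε_D := by
    have : stdε 𝒜 ℳ ∘ₗ stdD 𝒜 ℳ = 0 := by
      refine free_ext ?_
      rintro ⟨_ | _ | n, e⟩
      · rw [LinearMap.comp_apply, ← stdIncl_single, stdD_incl_zero, map_zero, LinearMap.zero_apply]
      · rw [LinearMap.comp_apply, ← stdIncl_single, stdD_incl_succ, stdε_incl_zero,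
          augmentation_resD, LinearMap.zero_apply]
      · rw [LinearMap.comp_apply, ← stdIncl_single, stdD_incl_succ, stdε_incl_succ,
          LinearMap.zero_apply]
    exact LinearMap.congr_fun this
  exact := by
    intro n j x hx hD
    obtain ⟨y, hy, rfl⟩ := exists_stdIncl_eq 𝒜 ℳ hx
    have hy0 : resD 𝒜 ℳ n y = 0 := by
      have h := (stdD_incl_succ 𝒜 ℳ n y).symm.trans hD
      exact sigmaIncl_injective n (h.trans (map_zero _).symm)
    obtain ⟨e, he, hee⟩ := exists_resD_eq hy hy0
    exact ⟨stdIncl 𝒜 ℳ (n + 2) (Finsupp.single e 1), stdIncl_single_mem he,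
      (stdD_incl_succ 𝒜 ℳ (n + 1) _).trans (by rw [hee])⟩
  exact_zero := by
    intro j x hx hε
    obtain ⟨y, hy, rfl⟩ := exists_stdIncl_eq 𝒜 ℳ hx
    have hy0 : augmentation ℳ y = 0 := (stdε_incl_zero 𝒜 ℳ y).symm.trans hε
    obtain ⟨e, he, hee⟩ := exists_resD_eq hy hy0
    exact ⟨stdIncl 𝒜 ℳ 1 (Finsupp.single e 1), stdIncl_single_mem he,
      (stdD_incl_succ 𝒜 ℳ 0 _).trans (by rw [hee])⟩
  surj := by
    intro j m hm
    refine ⟨stdIncl 𝒜 ℳ 0 (Finsupp.single ⟨⟨j, m, hm⟩⟩ 1), stdIncl_single_mem rfl, ?_⟩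
    rw [stdε_incl_zero]
    exact (Finsupp.linearCombination_single A 1 _).trans (one_smul _ _)

lemma nontrivial_quotient_addSubgroupOf {G : Type*} [AddCommGroup G] (H L : AddSubgroup G) :
    Nontrivial (H ⧸ L.addSubgroupOf H) ↔ ∃ c ∈ H, c ∉ L := by
  rw [QuotientAddGroup.nontrivial_iff, Ne, AddSubgroup.addSubgroupOf_eq_top,
    SetLike.not_le_iff_exists]

/-- `k ⊗ F` is `F / A₊F`, and `A₊F` is described coordinatewise. -/
lemma one_tmul_eq_zero_iff {ι : Type*} (x : ι →₀ A) :
    (1 : residue 𝒜) ⊗ₜ[A] x = 0 ↔ ∀ e, x e ∈ plusIdeal 𝒜 := by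
  constructor
  · intro h e
    have h1 := congrArg (fun t => TensorProduct.rid A (residue 𝒜)
      ((Finsupp.lapply e : (ι →₀ A) →ₗ[A] A).lTensor (residue 𝒜) t)) h
    simp only [LinearMap.lTensor_tmul, Finsupp.lapply_apply, TensorProduct.rid_tmul, map_zero] at h1
    rw [Algebra.smul_def, mul_one] at h1
    exact Ideal.Quotient.eq_zero_iff_mem.1 h1
  · intro h
    rw [← Finsupp.sum_single x, Finsupp.sum, TensorProduct.tmul_sum]
    refine Finset.sum_eq_zero fun e _ => ?_
    have h1 : Finsupp.single e (x e) = x e • Finsupp.single e (1 : A) := by simp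
    have h2 : x e • (1 : residue 𝒜) = 0 := by
      rw [Algebra.smul_def, mul_one]
      exact Ideal.Quotient.eq_zero_iff_mem.2 (h e)
    rw [h1, ← TensorProduct.smul_tmul, h2, TensorProduct.zero_tmul]

variable {𝒜}

lemma one_tmul_eq_zero_iff_incl {aug : A →ₐ[K] K} (haug : IsAug 𝒜 aug) {n : ℕ}
    (x : resModule 𝒜 ℳ n) : (1 : residue 𝒜) ⊗ₜ[A] x = 0 ↔
      mapCoeff (aug : A →+* K) (stdIncl 𝒜 ℳ n x) = 0 := by
  rw [one_tmul_eq_zero_iff]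
  constructor
  · intro h
    ext ⟨m, e⟩
    rw [mapCoeff_apply, Finsupp.zero_apply]
    by_cases hm : m = n
    · subst hm
      rw [sigmaIncl_apply]
      exact (haug _).2 (h e)
    · rw [sigmaIncl_apply_ne (ι := fun n => (stage 𝒜 ℳ n).ι) x e hm, map_zero]
  · intro h e
    have := DFunLike.congr_fun h ⟨n, e⟩
    rw [mapCoeff_apply, Finsupp.zero_apply, sigmaIncl_apply] at this
    exact (haug _).1 this

lemma mem_torCycles_iff {aug : A →ₐ[K] K} (haug : IsAug 𝒜 aug) {i : ℕ} {j : ℤ}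
    {x : resModule 𝒜 ℳ i} (hx : x ∈ resPiece 𝒜 ℳ i j) :
    (1 : residue 𝒜) ⊗ₜ[A] x ∈ torCycles 𝒜 ℳ i j ↔
      mapCoeff (aug : A →+* K) (stdD 𝒜 ℳ (stdIncl 𝒜 ℳ i x)) = 0 := by
  have hmem : (1 : residue 𝒜) ⊗ₜ[A] x ∈ tensorPiece 𝒜 ℳ i j := ⟨x, hx, rfl⟩
  cases i with
  | zero =>
    rw [stdD_incl_zero, map_zero]
    exact ⟨fun _ => rfl, fun _ => hmem⟩
  | succ i =>
    rw [stdD_incl_succ, ← one_tmul_eq_zero_iff_incl ℳ haug]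
    exact ⟨fun h => h.1, fun h => ⟨h, hmem⟩⟩

/-- Scalars have degree zero, so chains over `K` lift to chains over `A` of the same bidegree. -/
lemma mapCoeff_algebraMap_mem {β : Type*} {hom : β → ℕ} {deg : β → ℤ} {n : ℕ} {j : ℤ}
    {z : β →₀ K} (hz : z ∈ biSupp K hom deg n j) :
    mapCoeff (algebraMap K A) z ∈ biPiece 𝒜 hom deg n j := fun b => by
  rw [mapCoeff_apply]
  by_cases h : z b = 0
  · rw [h, map_zero]
    exact ⟨zero_mem _, fun h => absurd rfl h⟩
  · obtain ⟨h1, h2⟩ := hz b h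
    refine ⟨?_, fun _ => h1⟩
    rw [h2, sub_self, ← Nat.cast_zero, intPiece_natCast]
    exact SetLike.algebraMap_mem_graded 𝒜 _

lemma mapCoeff_aug_algebraMap {β : Type*} (aug : A →ₐ[K] K) (z : β →₀ K) :
    mapCoeff (aug : A →+* K) (mapCoeff (algebraMap K A) z) = z := by
  ext b
  simp

/-- Elements of `tensorPiece` are of the form `1 ⊗ x`, and `1 ⊗ x` is determined by the reduction of
`x` modulo `A₊`. Through this bridge any graded free resolution may be used to compute `gradedTor`.
-/
lemma nontrivial_gradedTor_iff {aug : A →ₐ[K] K} (haug : IsAug 𝒜 aug) (i : ℕ) (j : ℤ) :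
    Nontrivial (gradedTor 𝒜 ℳ i j) ↔ (stdResolution 𝒜 ℳ).TorNonzero aug i j := by
  have hbc : ∀ x, baseChangeMap (aug : A →+* K) (stdD 𝒜 ℳ) (mapCoeff (aug : A →+* K) x) =
    mapCoeff (aug : A →+* K) (stdD 𝒜 ℳ x) := baseChangeMap_mapCoeff _ _
  have hgr : IsBigraded (fun b : StdIndex 𝒜 ℳ => b.1) (fun b => (stage 𝒜 ℳ b.1).deg b.2)
    (baseChangeMap (aug : A →+* K) (stdD 𝒜 ℳ)) := (stdResolution 𝒜 ℳ).isBigraded haug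
  rw [gradedTor, nontrivial_quotient_addSubgroupOf]
  change _ ↔ HomologyNonzero (fun b : StdIndex 𝒜 ℳ => b.1) (fun b => (stage 𝒜 ℳ b.1).deg b.2)
    (baseChangeMap (aug : A →+* K) (stdD 𝒜 ℳ)) i j
  constructor
  · rintro ⟨c, hc, hcb⟩
    have hc' : c ∈ tensorPiece 𝒜 ℳ i j := by
      cases i with
      | zero => exact hc
      | succ i => exact hc.2
    obtain ⟨x, hx, rfl⟩ := hc'
    refine ⟨mapCoeff (aug : A →+* K) (stdIncl 𝒜 ℳ i x),
      mapCoeff_mem_biSupp haug ((stdIncl_mem 𝒜 ℳ).2 hx),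
      (hbc _).trans ((mem_torCycles_iff ℳ haug hx).1 hc), fun y hy => hcb ?_⟩
    obtain ⟨y', hy', hyy⟩ := hgr.exists_mem
      (hy ▸ mapCoeff_mem_biSupp haug ((stdIncl_mem 𝒜 ℳ).2 hx))
    obtain ⟨y₀, hy₀, hyy₀⟩ := exists_stdIncl_eq 𝒜 ℳ
      (mapCoeff_algebraMap_mem (𝒜 := 𝒜) hy')
    refine ⟨1 ⊗ₜ y₀, ⟨y₀, hy₀, rfl⟩, ?_⟩
    change 1 ⊗ₜ resD 𝒜 ℳ i y₀ = 1 ⊗ₜ[A] x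
    rw [← sub_eq_zero, ← TensorProduct.tmul_sub, one_tmul_eq_zero_iff_incl ℳ haug, map_sub,
      map_sub, ← stdD_incl_succ, ← hbc, hyy₀, mapCoeff_aug_algebraMap, sub_eq_zero]
    exact hyy.trans hy
  · rintro ⟨z, hz, hDz, hbd⟩
    obtain ⟨x, hx, hxz⟩ := exists_stdIncl_eq 𝒜 ℳ
      (mapCoeff_algebraMap_mem (𝒜 := 𝒜) hz)
    have hxz' : mapCoeff (aug : A →+* K) (stdIncl 𝒜 ℳ i x) = z := by
      rw [hxz, mapCoeff_aug_algebraMap]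
    refine ⟨1 ⊗ₜ x, (mem_torCycles_iff ℳ haug hx).2 ?_, ?_⟩
    · rw [← hbc, hxz']
      exact hDz
    · rintro ⟨_, ⟨y, hy, rfl⟩, h⟩
      refine hbd (mapCoeff (aug : A →+* K) (stdIncl 𝒜 ℳ (i + 1) y)) ?_
      change 1 ⊗ₜ resD 𝒜 ℳ i y = 1 ⊗ₜ[A] x at h
      rw [← sub_eq_zero, ← TensorProduct.tmul_sub, one_tmul_eq_zero_iff_incl ℳ haug, map_sub,
        map_sub, hxz', sub_eq_zero, ← stdD_incl_succ, ← hbc] at h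
      exact h

end Standard

/-! ### The bar resolution and its shuffle products. -/

section Bar

universe w

variable {K : Type w} [Field K] {Q : Type*} [CommRing Q] [Algebra K Q] {M : Type*} [AddCommGroup M]
  [Module Q M] [Module K M] [IsScalarTower K Q M] {βQ βM : Type*}
  (bQ : Module.Basis βQ K Q) (bM : Module.Basis βM K M)

/-- The basis of the bar resolution of `M` over `Q`: the vector `(b₁ :: ⋯ :: bₙ, m)` stands for
`1 ⊗ b₁ ⊗ ⋯ ⊗ bₙ ⊗ m` in `Q ⊗ Q ⊗ ⋯ ⊗ Q ⊗ M`, the tensor products being taken over `K`. -/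
abbrev BarIndex (βQ βM : Type*) := List βQ × βM

/-- The map `x ↦ 1 ⊗ x` from `M` to the bar resolution. -/
def barUnit : M →ₗ[K] (BarIndex βQ βM →₀ Q) :=
  bM.constr K fun m => Finsupp.single ([], m) 1

/-- The contraction `x ↦ 1 ⊗ x` of the bar resolution. -/
def barS : (BarIndex βQ βM →₀ Q) →ₗ[K] (BarIndex βQ βM →₀ Q) :=
  Finsupp.lsum K fun p => bQ.constr K fun b => Finsupp.single (b :: p.1, p.2) 1

/-- The augmentation of the bar resolution. -/
def barAug : (BarIndex βQ βM →₀ Q) →ₗ[Q] M :=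
  Finsupp.linearCombination Q fun p => match p.1 with
    | [] => bM p.2
    | _ :: _ => 0

/-- The values of the bar differential on the basis. -/
def barDAux (m : βM) : List βQ → (BarIndex βQ βM →₀ Q)
  | [] => 0
  -- The basis vector `(b :: l, m)` is `s (b · (l, m))`, so the value is forced by `D s = 1 - s D -
  -- s₀ ε`, where `s` is `barS`, `s₀` is `barUnit` and `ε` is `barAug`.
  | b :: l => Finsupp.single (l, m) (bQ b) - barS bQ (bQ b • barDAux m l) -
      barUnit bM (barAug bM (Finsupp.single (l, m) (bQ b)))

/-- The bar differential. -/
def barD : (BarIndex βQ βM →₀ Q) →ₗ[Q] (BarIndex βQ βM →₀ Q) :=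
  Finsupp.linearCombination Q fun p => barDAux bQ bM p.2 p.1

/-- The values of the shuffle product with `c` on the basis. -/
def barEAux (c : Q) (m : βM) : List βQ → (BarIndex βQ βM →₀ Q)
  | [] => barS bQ (Finsupp.single ([], m) c)
  -- The first term inserts `c` in front of the word, the second behind `b`. In terms of `s` this is
  -- the rule `E s = s c s - s E`.
  | b :: l => barS bQ (Finsupp.single (b :: l, m) c) - barS bQ (bQ b • barEAux c m l)

/-- The shuffle product with `c ∈ Q`. -/
def barE (c : Q) : (BarIndex βQ βM →₀ Q) →ₗ[Q] (BarIndex βQ βM →₀ Q) :=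
  Finsupp.linearCombination Q fun p => barEAux bQ c p.2 p.1

@[simp] lemma barUnit_basis (m : βM) :
    barUnit (Q := Q) (βQ := βQ) bM (bM m) = Finsupp.single ([], m) 1 :=
  bM.constr_basis K _ m

@[simp] lemma barS_single (p : BarIndex βQ βM) (b : βQ) :
    barS bQ (Finsupp.single p (bQ b)) = Finsupp.single (b :: p.1, p.2) 1 := by
  simp [barS]

lemma barS_single' (p : BarIndex βQ βM) (q : Q) :
    barS bQ (Finsupp.single p q) =
      (bQ.repr q).sum fun b c => c • Finsupp.single (b :: p.1, p.2) 1 := by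
  simp [barS, Module.Basis.constr_apply]

lemma bar_linearMap_ext {N : Type*} [AddCommGroup N] [Module K N]
    {L L' : (BarIndex βQ βM →₀ Q) →ₗ[K] N}
    (h : ∀ p b, L (Finsupp.single p (bQ b)) = L' (Finsupp.single p (bQ b))) : L = L' :=
  Finsupp.lhom_ext' fun p => bQ.ext fun b => h p b

lemma single_nil_eq (m : βM) :
    (Finsupp.single ([], m) 1 : BarIndex βQ βM →₀ Q) = barUnit bM (bM m) :=
  (barUnit_basis bM m).symm

lemma single_cons_eq (b : βQ) (l : List βQ) (m : βM) :
    (Finsupp.single (b :: l, m) 1 : BarIndex βQ βM →₀ Q) =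
      barS bQ (bQ b • Finsupp.single (l, m) 1) := by
  simp

/-- A linear map on the bar resolution vanishes if it vanishes on `1 ⊗ M` and on `1 ⊗ x` whenever
it vanishes on `x`. -/
lemma bar_eq_zero {N : Type*} [AddCommGroup N] [Module Q N]
    (g : (BarIndex βQ βM →₀ Q) →ₗ[Q] N) (h0 : ∀ m, g (barUnit bM m) = 0)
    (hs : ∀ x, g x = 0 → g (barS bQ x) = 0) : g = 0 := by
  refine free_ext ?_
  rintro ⟨l, m⟩
  induction l with
  | nil => rw [single_nil_eq bM, h0, LinearMap.zero_apply]
  | cons b l ih =>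
    rw [single_cons_eq bQ, hs _ (by rw [map_smul, ih, LinearMap.zero_apply, smul_zero]),
      LinearMap.zero_apply]

@[simp] lemma barAug_barUnit (m : M) : barAug bM (barUnit (Q := Q) (βQ := βQ) bM m) = m := by
  have : (barAug (Q := Q) (βQ := βQ) bM).restrictScalars K ∘ₗ barUnit bM = LinearMap.id :=
    bM.ext fun i => by simp [barAug]
  exact LinearMap.congr_fun this m

@[simp] lemma barAug_barS (x : BarIndex βQ βM →₀ Q) : barAug bM (barS bQ x) = 0 := by
  have : (barAug (Q := Q) (βQ := βQ) bM).restrictScalars K ∘ₗ barS bQ = 0 :=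
    bar_linearMap_ext bQ fun p b => by simp [barAug]
  exact LinearMap.congr_fun this x

@[simp] lemma barD_barUnit (m : M) : barD bQ bM (barUnit bM m) = 0 := by
  have : (barD bQ bM).restrictScalars K ∘ₗ barUnit bM = 0 :=
    bM.ext fun i => by simp [barD, barDAux]
  exact LinearMap.congr_fun this m

/-- The contracting homotopy, which is `K`-linear but not `Q`-linear. It yields exactness, and with
`bar_eq_zero` it reduces identities about `D` to formal computations with `s`. -/
lemma barD_barS (x : BarIndex βQ βM →₀ Q) :
    barD bQ bM (barS bQ x) = x - barS bQ (barD bQ bM x) - barUnit bM (barAug bM x) := by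
  have : (barD bQ bM).restrictScalars K ∘ₗ barS bQ =
      LinearMap.id - barS bQ ∘ₗ (barD bQ bM).restrictScalars K -
        barUnit bM ∘ₗ (barAug bM).restrictScalars K :=
    bar_linearMap_ext bQ fun p b => by simp [barD, barDAux]
  exact LinearMap.congr_fun this x

@[simp] lemma barAug_barD (x : BarIndex βQ βM →₀ Q) : barAug bM (barD bQ bM x) = 0 := by
  have : barAug bM ∘ₗ barD bQ bM = 0 := by
    refine bar_eq_zero bQ bM _ (fun m => by simp) fun x _ => ?_
    rw [LinearMap.comp_apply, barD_barS]
    simp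
  exact LinearMap.congr_fun this x

@[simp] lemma barD_barD (x : BarIndex βQ βM →₀ Q) : barD bQ bM (barD bQ bM x) = 0 := by
  have : barD bQ bM ∘ₗ barD bQ bM = 0 := by
    refine bar_eq_zero bQ bM _ (fun m => by simp) fun x hx => ?_
    rw [LinearMap.comp_apply] at hx ⊢
    rw [barD_barS, map_sub, map_sub, barD_barS, hx]
    simp
  exact LinearMap.congr_fun this x

@[simp] lemma barE_barUnit (c : Q) (m : M) :
    barE bQ c (barUnit bM m) = barS bQ (c • barUnit bM m) := by
  have : (barE bQ c).restrictScalars K ∘ₗ barUnit bM =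
      barS bQ ∘ₗ (LinearMap.lsmul Q _ c).restrictScalars K ∘ₗ barUnit bM :=
    bM.ext fun i => by simp [barE, barEAux]
  exact LinearMap.congr_fun this m

lemma barE_barS (c : Q) (x : BarIndex βQ βM →₀ Q) :
    barE bQ c (barS bQ x) = barS bQ (c • barS bQ x) - barS bQ (barE bQ c x) := by
  have : (barE (βM := βM) bQ c).restrictScalars K ∘ₗ barS bQ =
      barS bQ ∘ₗ (LinearMap.lsmul Q _ c).restrictScalars K ∘ₗ barS bQ -
        barS bQ ∘ₗ (barE bQ c).restrictScalars K :=
    bar_linearMap_ext bQ fun p b => by simp [barE, barEAux]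
  exact LinearMap.congr_fun this x

lemma barAug_barE (c : Q) (x : BarIndex βQ βM →₀ Q) : barAug bM (barE bQ c x) = 0 := by
  have : barAug bM ∘ₗ barE bQ c = 0 := by
    refine bar_eq_zero bQ bM _ (fun m => by simp) fun x _ => ?_
    rw [LinearMap.comp_apply, barE_barS]
    simp
  exact LinearMap.congr_fun this x

/-- The shuffle product with `c ∈ Ann M` is a homotopy from multiplication by `c` to zero. -/
lemma barD_barE (c : Q) (hc : ∀ m : M, c • m = 0) (x : BarIndex βQ βM →₀ Q) :
    barD bQ bM (barE bQ c x) + barE bQ c (barD bQ bM x) = c • x := by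
  have : barD bQ bM ∘ₗ barE bQ c + barE bQ c ∘ₗ barD bQ bM - LinearMap.lsmul Q _ c = 0 := by
    refine bar_eq_zero bQ bM _ (fun m => ?_) fun x hx => ?_
    -- Here `D s (c · s₀ m) = c · s₀ m - s₀ (c m)`; the last term vanishes because `c` annihilates
    -- `M`.
    · simp [barD_barS, hc]
    · simp only [LinearMap.sub_apply, LinearMap.add_apply, LinearMap.comp_apply,
        LinearMap.lsmul_apply, sub_eq_zero] at hx ⊢
      simp only [barE_barS, barD_barS, map_sub, map_smul, barAug_barS, smul_zero, map_zero,
        sub_zero, barAug_barE, barE_barUnit, smul_sub, ← hx, map_add]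
      abel
  have h := LinearMap.congr_fun this x
  simpa [sub_eq_zero] using h

/-- Two insertions of `c` cancel in pairs. The case `c = c'` of `barE_barE` gives only `2 E² = 0`,
which is empty in characteristic two. -/
lemma barE_barE_self (bM : Module.Basis βM K M) (c : Q) (x : BarIndex βQ βM →₀ Q) :
    barE bQ c (barE bQ c x) = 0 := by
  have : barE bQ c ∘ₗ barE (βM := βM) bQ c = 0 := by
    refine bar_eq_zero bQ bM _ (fun m => ?_) fun x hx => ?_
    · simp only [LinearMap.comp_apply, barE_barUnit, barE_barS, map_smul, sub_self]
    · simp only [LinearMap.comp_apply] at hx ⊢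
      simp only [barE_barS, map_sub, map_smul, hx, map_zero, smul_sub]
      abel
  exact LinearMap.congr_fun this x

lemma barE_barE (bM : Module.Basis βM K M) (c c' : Q) (x : BarIndex βQ βM →₀ Q) :
    barE bQ c (barE bQ c' x) + barE bQ c' (barE bQ c x) = 0 := by
  have : barE bQ c ∘ₗ barE (βM := βM) bQ c' + barE bQ c' ∘ₗ barE bQ c = 0 := by
    refine bar_eq_zero bQ bM _ (fun m => ?_) fun x hx => ?_
    · simp only [LinearMap.add_apply, LinearMap.comp_apply, barE_barUnit, barE_barS, map_smul]
      abel
    · simp only [LinearMap.add_apply, LinearMap.comp_apply] at hx ⊢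
      have hx' := congrArg (barS bQ) hx
      simp only [map_add, map_zero] at hx'
      simp only [barE_barS, map_sub, map_smul, smul_sub]
      rw [← hx']
      abel
  exact LinearMap.congr_fun this x

section Span

/-- The `Q`-span of the shuffle products with elements of `Q`. -/
def shuffleSpan (βM : Type*) :
    Submodule Q ((BarIndex βQ βM →₀ Q) →ₗ[Q] (BarIndex βQ βM →₀ Q)) :=
  Submodule.span Q (Set.range (barE bQ))

lemma barE_mem_shuffleSpan (c : Q) : barE bQ c ∈ shuffleSpan bQ βM :=
  Submodule.subset_span ⟨c, rfl⟩

lemma shuffleSpan_anticomm (bM : Module.Basis βM K M)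
    {E E' : (BarIndex βQ βM →₀ Q) →ₗ[Q] (BarIndex βQ βM →₀ Q)}
    (hE : E ∈ shuffleSpan bQ βM) (hE' : E' ∈ shuffleSpan bQ βM) (x : BarIndex βQ βM →₀ Q) :
    E (E' x) + E' (E x) = 0 := by
  induction hE using Submodule.span_induction with
  | zero => simp
  | add E F _ _ hE hF =>
    simp only [LinearMap.add_apply, map_add]
    rw [← add_zero (0 : BarIndex βQ βM →₀ Q)]
    nth_rewrite 1 [← hE]
    rw [← hF]
    abel
  | smul a E _ hE => simp only [LinearMap.smul_apply, map_smul, ← smul_add, hE, smul_zero]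
  | mem E hE =>
    obtain ⟨c, rfl⟩ := hE
    induction hE' using Submodule.span_induction with
    | zero => simp
    | add E F _ _ hE hF =>
      simp only [LinearMap.add_apply, map_add]
      rw [← add_zero (0 : BarIndex βQ βM →₀ Q)]
      nth_rewrite 1 [← hE]
      rw [← hF]
      abel
    | smul a E _ hE => simp only [LinearMap.smul_apply, map_smul, ← smul_add, hE, smul_zero]
    | mem E hE =>
      obtain ⟨c', rfl⟩ := hE
      exact barE_barE bQ bM c c' x

/-- Generators have square zero and the cross terms cancel by anticommutation. This admits the
combinations `∑ aᵢ · barE cᵢ` as square-zero homotopies. -/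
lemma shuffleSpan_sq (bM : Module.Basis βM K M)
    {E : (BarIndex βQ βM →₀ Q) →ₗ[Q] (BarIndex βQ βM →₀ Q)}
    (hE : E ∈ shuffleSpan bQ βM) (x : BarIndex βQ βM →₀ Q) : E (E x) = 0 := by
  induction hE using Submodule.span_induction with
  | zero => simp
  | add E F hE' hF' hE hF =>
    simp only [LinearMap.add_apply, map_add, hE, hF, zero_add, add_zero]
    exact shuffleSpan_anticomm bQ bM hF' hE' x
  | smul a E _ hE => simp only [LinearMap.smul_apply, map_smul, hE, smul_zero]
  | mem E hE =>
    obtain ⟨c, rfl⟩ := hE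
    exact barE_barE_self bQ bM c x

lemma barAug_shuffleSpan {E : (BarIndex βQ βM →₀ Q) →ₗ[Q] (BarIndex βQ βM →₀ Q)}
    (hE : E ∈ shuffleSpan bQ βM) (x : BarIndex βQ βM →₀ Q) : barAug bM (E x) = 0 := by
  induction hE using Submodule.span_induction with
  | zero => simp
  | add E F _ _ hE hF => simp only [LinearMap.add_apply, map_add, hE, hF, zero_add]
  | smul a E _ hE => simp only [LinearMap.smul_apply, map_smul, hE, smul_zero]
  | mem E hE =>
    obtain ⟨c, rfl⟩ := hE
    exact barAug_barE bQ bM c x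

end Span

/-! ### Contraction of `k ⊗ B` against a derivation. -/

section Contraction

variable (aug : Q →ₐ[K] K) (φ : Q →ₗ[K] K)

/-- Contraction of the first tensor factor of `k ⊗ B` against `φ`. -/
def barContract : (BarIndex βQ βM →₀ K) →ₗ[K] (BarIndex βQ βM →₀ K) :=
  Finsupp.linearCombination K fun p => match p.1 with
    | [] => 0
    | b :: l => Finsupp.single (l, p.2) (φ (bQ b))

/-- `φ` applied to all coordinates. -/
abbrev mapFunctional : (BarIndex βQ βM →₀ Q) →ₗ[K] (BarIndex βQ βM →₀ K) :=
  Finsupp.mapRange.linearMap φ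

lemma mapFunctional_aug (x : BarIndex βQ βM →₀ Q) :
    mapFunctional aug.toLinearMap x = mapCoeff (aug : Q →+* K) x := by
  ext b; simp

/-- `s` puts the coefficient into the first slot, where the contraction evaluates `φ` on it. -/
lemma barContract_barS (x : BarIndex βQ βM →₀ Q) :
    barContract bQ φ (mapCoeff (aug : Q →+* K) (barS bQ x)) = mapFunctional φ x := by
  have : barContract bQ φ ∘ₗ mapFunctional aug.toLinearMap ∘ₗ barS bQ =
      mapFunctional (βQ := βQ) (βM := βM) φ :=
    bar_linearMap_ext bQ fun p b => by simp [barContract]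
  rw [← mapFunctional_aug]
  exact LinearMap.congr_fun this x

lemma barContract_barUnit (m : M) :
    barContract bQ φ (mapCoeff (aug : Q →+* K) (barUnit bM m)) = 0 := by
  have : barContract bQ φ ∘ₗ mapFunctional aug.toLinearMap ∘ₗ barUnit bM = 0 :=
    bM.ext fun b => by simp [barContract]
  rw [← mapFunctional_aug]
  exact LinearMap.congr_fun this m

variable {aug φ}

/-- The coordinates of `s x` are scalars, and `φ` vanishes on scalars. -/
lemma mapFunctional_barS (h1 : φ 1 = 0) (x : BarIndex βQ βM →₀ Q) :
    mapFunctional φ (barS bQ x) = 0 := by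
  have : mapFunctional φ ∘ₗ barS (βM := βM) bQ = 0 :=
    bar_linearMap_ext bQ fun p b => by simp [h1]
  exact LinearMap.congr_fun this x

lemma mapFunctional_barUnit (h1 : φ 1 = 0) (m : M) :
    mapFunctional (βQ := βQ) φ (barUnit bM m) = 0 := by
  have : mapFunctional (βQ := βQ) φ ∘ₗ barUnit bM = 0 :=
    bM.ext fun b => by simp [h1]
  exact LinearMap.congr_fun this m

lemma mapFunctional_smul (hφ : ∀ p q, φ (p * q) = aug p * φ q + φ p * aug q) (q : Q)
    (x : BarIndex βQ βM →₀ Q) : mapFunctional φ (q • x) =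
      aug q • mapFunctional φ x + φ q • mapCoeff (aug : Q →+* K) x := by
  ext b; simp [hφ]

/-- Only the leading term of `D` of a bar word has a non-scalar coefficient, namely the first letter
of the word. -/
lemma mapFunctional_barD_single (h1 : φ 1 = 0) (p : BarIndex βQ βM) :
    mapFunctional φ (barD bQ bM (Finsupp.single p 1)) =
      barContract bQ φ (Finsupp.single p 1) := by
  obtain ⟨_ | ⟨b, l⟩, m⟩ := p
  · simp [barD, barDAux, barContract]
  · rw [single_cons_eq bQ, barD_barS, map_sub, map_sub, mapFunctional_barS bQ h1,
      mapFunctional_barUnit bM h1]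
    simp [barContract]

lemma mapFunctional_barD (h1 : φ 1 = 0)
    (hφ : ∀ p q, φ (p * q) = aug p * φ q + φ p * aug q) (x : BarIndex βQ βM →₀ Q) :
    mapFunctional φ (barD bQ bM x) =
      baseChangeMap (aug : Q →+* K) (barD bQ bM) (mapFunctional φ x) +
        barContract bQ φ (mapCoeff (aug : Q →+* K) x) := by
  induction x using Finsupp.induction_linear with
  | zero => simp
  | add x y hx hy => simp only [map_add, hx, hy]; abel
  | single p q =>
    have h2 : Finsupp.single p q = q • Finsupp.single p (1 : Q) := by simp
    have h3 : mapFunctional φ (Finsupp.single p (1 : Q)) = 0 := by simp [h1]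
    rw [h2, map_smul, mapFunctional_smul hφ, mapFunctional_smul hφ, h3, smul_zero, zero_add,
      mapFunctional_barD_single bQ bM h1, mapCoeff_smul, map_smul, ← baseChangeMap_mapCoeff,
      add_comm]
    simp only [mapCoeff_single, map_one, RingHom.coe_coe]
    rw [← map_smul, Finsupp.smul_single_one, map_smul (barContract bQ φ)]

/-- Contraction against a derivation anticommutes with the bar differential. -/
lemma barContract_barD (h1 : φ 1 = 0)
    (hφ : ∀ p q, φ (p * q) = aug p * φ q + φ p * aug q) (w : BarIndex βQ βM →₀ K) :
    barContract bQ φ (baseChangeMap (aug : Q →+* K) (barD bQ bM) w) +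
      baseChangeMap (aug : Q →+* K) (barD bQ bM) (barContract bQ φ w) = 0 := by
  have : barContract bQ φ ∘ₗ baseChangeMap (aug : Q →+* K) (barD bQ bM) +
      baseChangeMap (aug : Q →+* K) (barD bQ bM) ∘ₗ barContract bQ φ = 0 := by
    refine free_ext ?_
    rintro ⟨_ | ⟨b, l⟩, m⟩
    · simp [barD, barDAux, barContract]
    -- The basis vector is the reduction of `s x` with `x = b · (l, m)`. With `I` the contraction,
    -- `I D s x = I x - φ (D x)` and `φ (D x) = D (φ x) + I x`, so `I D s x = -D (φ x) = -D (I s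
    -- x)`.
    · have h2 : (Finsupp.single (b :: l, m) 1 : BarIndex βQ βM →₀ K) =
          mapCoeff (aug : Q →+* K) (barS bQ (bQ b • Finsupp.single (l, m) 1)) := by
        rw [← single_cons_eq]; simp
      rw [LinearMap.add_apply, LinearMap.comp_apply, LinearMap.comp_apply, h2,
        baseChangeMap_mapCoeff, barD_barS, map_sub, map_sub, map_sub, map_sub, barContract_barS,
        barContract_barS, barContract_barUnit, mapFunctional_barD bQ bM h1 hφ]
      simp
  exact LinearMap.congr_fun this w

lemma mapFunctional_barE_single (h1 : φ 1 = 0) (c : Q) (p : BarIndex βQ βM) :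
    mapFunctional φ (barE bQ c (Finsupp.single p 1)) = 0 := by
  obtain ⟨_ | ⟨b, l⟩, m⟩ := p
  · rw [barE, Finsupp.linearCombination_single, one_smul]
    exact mapFunctional_barS bQ h1 _
  · rw [single_cons_eq bQ, barE_barS, map_sub, mapFunctional_barS bQ h1,
      mapFunctional_barS bQ h1, sub_zero]

lemma mapFunctional_barE (h1 : φ 1 = 0)
    (hφ : ∀ p q, φ (p * q) = aug p * φ q + φ p * aug q) (c : Q) (x : BarIndex βQ βM →₀ Q) :
    mapFunctional φ (barE bQ c x) =
      baseChangeMap (aug : Q →+* K) (barE bQ c) (mapFunctional φ x) := by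
  induction x using Finsupp.induction_linear with
  | zero => simp
  | add x y hx hy => simp only [map_add, hx, hy]
  | single p q =>
    have h2 : Finsupp.single p q = q • Finsupp.single p (1 : Q) := by simp
    have h3 : mapFunctional φ (Finsupp.single p (1 : Q)) = 0 := by simp [h1]
    rw [h2, map_smul, mapFunctional_smul hφ, mapFunctional_smul hφ, h3, smul_zero, zero_add,
      mapFunctional_barE_single bQ h1, smul_zero, zero_add, map_smul, ← baseChangeMap_mapCoeff]

/-- Contraction against a derivation `φ` is a homotopy from `φ c` to zero for the shuffle product
with `c`. -/
lemma barContract_barE (h1 : φ 1 = 0)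
    (hφ : ∀ p q, φ (p * q) = aug p * φ q + φ p * aug q) {c : Q} (hc : aug c = 0)
    (w : BarIndex βQ βM →₀ K) :
    barContract bQ φ (baseChangeMap (aug : Q →+* K) (barE bQ c) w) +
      baseChangeMap (aug : Q →+* K) (barE bQ c) (barContract bQ φ w) = φ c • w := by
  have : barContract bQ φ ∘ₗ baseChangeMap (aug : Q →+* K) (barE bQ c) +
      baseChangeMap (aug : Q →+* K) (barE bQ c) ∘ₗ barContract bQ φ =
        LinearMap.lsmul K (BarIndex βQ βM →₀ K) (φ c) := by
    refine free_ext ?_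
    rintro ⟨_ | ⟨b, l⟩, m⟩
    · have h2 : barContract bQ φ (Finsupp.single (([], m) : BarIndex βQ βM) 1) = 0 := by
        simp [barContract]
      rw [LinearMap.add_apply, LinearMap.comp_apply, LinearMap.comp_apply,
        baseChangeMap_single_one, h2, map_zero, add_zero, barE, Finsupp.linearCombination_single,
        one_smul, barEAux, barContract_barS]
      simp
    -- With `x` as before, `I E s x = φ (c · s x) - φ (E x) = φ c · s x - E (φ x)`, and `φ x = I s
    -- x`.
    · have h2 : (Finsupp.single (b :: l, m) 1 : BarIndex βQ βM →₀ K) =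
          mapCoeff (aug : Q →+* K) (barS bQ (bQ b • Finsupp.single (l, m) 1)) := by
        rw [← single_cons_eq]; simp
      rw [LinearMap.add_apply, LinearMap.comp_apply, LinearMap.comp_apply, h2,
        baseChangeMap_mapCoeff, barE_barS, map_sub, map_sub, barContract_barS,
        barContract_barS, barContract_barS, mapFunctional_smul hφ, mapFunctional_barS bQ h1, hc,
        mapFunctional_barE bQ h1 hφ]
      simp
  exact LinearMap.congr_fun this w

end Contraction

end Bar

/-! ### Homogeneous components; graded resolutions from exact complexes. -/

section Projections

universe w u v t

variable {K : Type w} [Field K] {A : Type u} [CommRing A] [Algebra K A]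
  (𝒜 : ℕ → Submodule K A) [GradedAlgebra 𝒜]

/-- The projection of `A` onto its piece of degree `j ∈ ℤ`. -/
def intProj (j : ℤ) : A →+ A := if 0 ≤ j then GradedRing.proj 𝒜 j.toNat else 0

lemma intProj_mem (j : ℤ) (a : A) : intProj 𝒜 j a ∈ intPiece 𝒜 j := by
  unfold intProj intPiece
  split_ifs with h
  · rw [GradedRing.proj_apply]; exact SetLike.coe_mem _
  · exact zero_mem _

lemma intProj_of_mem {n : ℕ} {a : A} (ha : a ∈ 𝒜 n) (j : ℤ) :
    intProj 𝒜 j a = if j = n then a else 0 := by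
  unfold intProj
  split_ifs with h1 h2 h2
  · subst h2
    rw [GradedRing.proj_apply, Int.toNat_natCast, DirectSum.decompose_of_mem_same 𝒜 ha]
  · rw [GradedRing.proj_apply, DirectSum.decompose_of_mem_ne 𝒜 ha (by omega)]
  · omega
  · rfl

variable {β : Type*} (hom : β → ℕ) (deg : β → ℤ)

/-- The projection of a bigraded free module onto the piece of bidegree `(n, j)`. -/
def biProj (n : ℕ) (j : ℤ) : (β →₀ A) →+ (β →₀ A) :=
  Finsupp.liftAddHom fun b =>
    if hom b = n then (Finsupp.singleAddHom b).comp (intProj 𝒜 (j - deg b)) else 0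

lemma biProj_single (n : ℕ) (j : ℤ) (b : β) (a : A) : biProj 𝒜 hom deg n j (Finsupp.single b a) =
    if hom b = n then Finsupp.single b (intProj 𝒜 (j - deg b) a) else 0 := by
  rw [biProj, Finsupp.liftAddHom_apply_single]
  split_ifs <;> rfl

lemma biProj_mem (n : ℕ) (j : ℤ) (x : β →₀ A) :
    biProj 𝒜 hom deg n j x ∈ biPiece 𝒜 hom deg n j := by
  induction x using Finsupp.induction_linear with
  | zero => rw [map_zero]; exact zero_mem _
  | add x y hx hy => rw [map_add]; exact add_mem hx hy
  | single b a =>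
    rw [biProj_single]
    split_ifs with h
    · exact single_mem_biPiece 𝒜 h (intProj_mem 𝒜 _ _)
    · exact zero_mem _

lemma biProj_of_mem {n n' : ℕ} {j j' : ℤ} {x : β →₀ A} (hx : x ∈ biPiece 𝒜 hom deg n j) :
    biProj 𝒜 hom deg n' j' x = if n = n' ∧ j = j' then x else 0 := by
  have key : ∀ b, biProj 𝒜 hom deg n' j' (Finsupp.single b (x b)) =
      if n = n' ∧ j = j' then Finsupp.single b (x b) else 0 := fun b => by
    rw [biProj_single]
    rcases (mem_intPiece 𝒜).1 (hx b).1 with h0 | ⟨m, hm, hxm⟩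
    · simp [h0]
    by_cases h0 : x b = 0
    · simp [h0]
    have h1 := (hx b).2 h0
    rw [intProj_of_mem 𝒜 hxm]
    split_ifs with h2 h3 h4 h5 h6 <;> first | rfl | omega | exact Finsupp.single_zero b
  have h := congrArg (biProj 𝒜 hom deg n' j') (Finsupp.sum_single x)
  rw [Finsupp.sum, map_sum, Finset.sum_congr rfl fun b _ => key b] at h
  rw [← h]
  split_ifs with hc
  · exact Finsupp.sum_single x
  · exact Finset.sum_const_zero

variable {hom deg}

lemma map_biProj {D : (β →₀ A) →ₗ[A] (β →₀ A)}
    (hD : ∀ n b, hom b = n + 1 → D (Finsupp.single b 1) ∈ biPiece 𝒜 hom deg n (deg b))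
    (hD0 : ∀ b, hom b = 0 → D (Finsupp.single b 1) = 0) (n : ℕ) (j : ℤ) (x : β →₀ A) :
    D (biProj 𝒜 hom deg (n + 1) j x) = biProj 𝒜 hom deg n j (D x) := by
  classical
  induction x using Finsupp.induction_linear with
  | zero => simp
  | add x y hx hy => simp only [map_add, hx, hy]
  | single b a =>
    rw [← DirectSum.sum_support_decompose 𝒜 a, Finsupp.single_finsetSum]
    simp only [map_sum]
    refine Finset.sum_congr rfl fun m _ => ?_
    generalize (DirectSum.decompose 𝒜 a) m = c
    have hc : (c : A) ∈ 𝒜 m := c.2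
    have hb : Finsupp.single b (c : A) ∈ biPiece 𝒜 hom deg (hom b) (m + deg b) :=
      single_mem_biPiece 𝒜 rfl (by rw [add_sub_cancel_right, intPiece_natCast]; exact hc)
    have h1 : Finsupp.single b (c : A) = (c : A) • Finsupp.single b (1 : A) := by simp
    rw [biProj_of_mem 𝒜 hom deg hb]
    rcases hn : hom b with _ | k
    · rw [h1, map_smul, hD0 b hn, smul_zero, map_zero, if_neg (by omega), map_zero]
    · have h2 : D (Finsupp.single b (c : A)) ∈ biPiece 𝒜 hom deg k (m + deg b) := by
        rw [h1, map_smul]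
        exact biPiece_smulGraded 𝒜 k _ _ _ _ hc (hD k b hn)
      rw [biProj_of_mem 𝒜 hom deg h2]
      by_cases h3 : k = n ∧ (m : ℤ) + deg b = j
      · rw [if_pos h3, if_pos (by omega)]
      · rw [if_neg h3, if_neg (by omega), map_zero]

variable {M : Type v} [AddCommGroup M] [Module A M] (ℳ : ℤ → AddSubgroup M)

/-- A graded complex of free modules that is exact is a graded free resolution. -/
def FreeResolution.ofExact {β : Type t} (hom : β → ℕ) (deg : β → ℤ)
    (D : (β →₀ A) →ₗ[A] (β →₀ A)) (ε : (β →₀ A) →ₗ[A] M)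
    (D_mem : ∀ n b, hom b = n + 1 → D (Finsupp.single b 1) ∈ biPiece 𝒜 hom deg n (deg b))
    (D_zero : ∀ b, hom b = 0 → D (Finsupp.single b 1) = 0)
    (ε_mem : ∀ b, hom b = 0 → ε (Finsupp.single b 1) ∈ ℳ (deg b))
    (ε_zero : ∀ b, hom b ≠ 0 → ε (Finsupp.single b 1) = 0)
    (D_D : ∀ x, D (D x) = 0) (ε_D : ∀ x, ε (D x) = 0)
    (exact : ∀ x, D x = 0 → ε x = 0 → ∃ y, D y = x)
    (surj : ∀ j, ∀ m ∈ ℳ j, ∃ x ∈ biPiece 𝒜 hom deg 0 j, ε x = m) :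
    FreeResolution.{w, u, v, t} 𝒜 ℳ :=
  -- A preimage of a homogeneous element need not be homogeneous, but its component of bidegree `(n
  -- + 1, j)` is again a preimage.
  have key : ∀ n j, ∀ x ∈ biPiece 𝒜 hom deg n j, D x = 0 → ε x = 0 →
      ∃ y ∈ biPiece 𝒜 hom deg (n + 1) j, D y = x := fun n j x hx h1 h2 => by
    obtain ⟨y, rfl⟩ := exact x h1 h2
    refine ⟨_, biProj_mem 𝒜 hom deg (n + 1) j y, ?_⟩
    rw [map_biProj 𝒜 D_mem D_zero, biProj_of_mem 𝒜 hom deg hx, if_pos ⟨rfl, rfl⟩]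
  { β, hom, deg, D, ε, D_mem, D_zero, ε_mem, D_D, ε_D, surj
    exact := fun n j x hx h => key (n + 1) j x hx h <| by
      have h1 := linearMap_eq_on_biPiece (L := ε) (L' := 0)
        (fun b hb => by rw [ε_zero b (by omega), LinearMap.zero_apply]) hx
      simpa using h1
    exact_zero := fun j x hx h => key 0 j x hx (by
      have h1 := linearMap_eq_on_biPiece (L := D) (L' := 0)
        (fun b hb => by rw [D_zero b hb, LinearMap.zero_apply]) hx
      simpa using h1) h }

end Projections

/-! ### Homogeneous bases over `K`. -/

section HomogeneousBasis

universe u v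

variable {K N ι : Type*} [Field K] [AddCommGroup N] [Module K N]

/-- The vectors of the basis `b` are homogeneous, and so are their multiples in the expansion of a
homogeneous element. -/
structure IsHomogeneousBasis {σ β : Type*} [SetLike σ N] (𝒩 : ι → σ) (b : Module.Basis β K N)
    (deg : β → ι) : Prop where
  mem : ∀ i, b i ∈ 𝒩 (deg i)
  repr : ∀ n, ∀ x ∈ 𝒩 n, ∀ i, b.repr x i ≠ 0 → deg i = n

lemma exists_isHomogeneousBasis {K : Type*} {N : Type v} {ι : Type u} [Field K] [AddCommGroup N]
    [Module K N] [DecidableEq ι] (𝒩 : ι → Submodule K N) (h : DirectSum.IsInternal 𝒩) :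
    ∃ (β : Type (max u v)) (deg : β → ι) (b : Module.Basis β K N), IsHomogeneousBasis 𝒩 b deg :=
  ⟨_, Sigma.fst, h.collectedBasis fun i => Module.Basis.ofVectorSpace K (𝒩 i),
    h.collectedBasis_mem _, fun n x hx i hi => by
      by_contra hne
      exact hi (h.collectedBasis_repr_of_mem_ne _ (Ne.symm hne) hx)⟩

end HomogeneousBasis

/-! ### The bigrading of the bar resolution. -/

section GradedBar

universe w u v t t'

variable {K : Type w} [Field K] {Q : Type u} [CommRing Q] [Algebra K Q]
  {𝒬 : ℕ → Submodule K Q} [GradedAlgebra 𝒬] {M : Type v} [AddCommGroup M]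
  [Module Q M] [Module K M] [IsScalarTower K Q M] {ℳ : ℤ → AddSubgroup M} {βQ βM : Type*}
  {bQ : Module.Basis βQ K Q} {bM : Module.Basis βM K M} {degQ : βQ → ℕ} {degM : βM → ℤ}

/-- The homological degrees of the basis of the bar resolution. -/
def barHom (p : BarIndex βQ βM) : ℕ := p.1.length

/-- The internal degrees of the basis of the bar resolution. -/
def barDeg (degQ : βQ → ℕ) (degM : βM → ℤ) (p : BarIndex βQ βM) : ℤ :=
  ((p.1.map degQ).sum : ℕ) + degM p.2

lemma barDeg_cons (b : βQ) (p : BarIndex βQ βM) :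
    barDeg degQ degM (b :: p.1, p.2) = degQ b + barDeg degQ degM p := by
  simp [barDeg, add_assoc]

lemma biPiece_field_smul_mem {β : Type*} {hom : β → ℕ} {deg : β → ℤ} {n : ℕ} {j : ℤ} (c : K)
    {x : β →₀ Q} (hx : x ∈ biPiece 𝒬 hom deg n j) : c • x ∈ biPiece 𝒬 hom deg n j := fun b =>
  ⟨Submodule.smul_mem _ c (hx b).1, fun h => (hx b).2 fun h0 => h (by simp [h0])⟩

/-- A coefficient of degree `m` expands in basis elements of degree `m`, and `s` turns it into a new
tensor slot of that degree. The total internal degree is unchanged. -/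
lemma barS_mem (hQ : IsHomogeneousBasis 𝒬 bQ degQ) {n : ℕ} {j : ℤ} {x : BarIndex βQ βM →₀ Q}
    (hx : x ∈ biPiece 𝒬 barHom (barDeg degQ degM) n j) :
    barS bQ x ∈ biPiece 𝒬 barHom (barDeg degQ degM) (n + 1) j := by
  rw [← Finsupp.sum_single x, Finsupp.sum, map_sum]
  refine sum_mem fun p hp => ?_
  rw [barS_single', Finsupp.sum]
  refine sum_mem fun b hb => biPiece_field_smul_mem _ ?_
  have hn := (hx p).2 (Finsupp.mem_support_iff.1 hp)
  rcases (mem_intPiece 𝒬).1 (hx p).1 with h0 | ⟨m, hm, hxm⟩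
  · exact absurd h0 (Finsupp.mem_support_iff.1 hp)
  · have h1 := hQ.repr m _ hxm b (Finsupp.mem_support_iff.1 hb)
    refine single_mem_biPiece 𝒬 (by simpa [barHom] using hn) ?_
    have h2 : j - barDeg degQ degM (b :: p.1, p.2) = (0 : ℕ) := by
      rw [barDeg_cons]; push_cast; omega
    rw [h2, intPiece_natCast]
    exact SetLike.GradedOne.one_mem

lemma barUnit_mem (hM : IsHomogeneousBasis ℳ bM degM) {j : ℤ} {m : M} (hm : m ∈ ℳ j) :
    barUnit bM m ∈ biPiece 𝒬 barHom (barDeg (βQ := βQ) degQ degM) 0 j := by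
  rw [barUnit, Module.Basis.constr_apply, Finsupp.sum]
  refine sum_mem fun i hi => biPiece_field_smul_mem _ ?_
  have h1 := hM.repr j m hm i (Finsupp.mem_support_iff.1 hi)
  have := single_one_mem_biPiece 𝒬 (hom := barHom) (deg := barDeg (βQ := βQ) degQ degM) ([], i)
  simpa [barHom, barDeg, h1] using this

lemma single_basis_mem (hQ : IsHomogeneousBasis 𝒬 bQ degQ) (b : βQ) (p : BarIndex βQ βM) :
    Finsupp.single p (bQ b) ∈
      biPiece 𝒬 barHom (barDeg degQ degM) p.1.length (degQ b + barDeg degQ degM p) :=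
  single_mem_biPiece 𝒬 rfl (by rw [add_sub_cancel_right, intPiece_natCast]; exact hQ.mem b)

lemma barD_mem (hQ : IsHomogeneousBasis 𝒬 bQ degQ) (hM : IsHomogeneousBasis ℳ bM degM)
    (hsmul : SMulGraded 𝒬 ℳ) (n : ℕ) (p : BarIndex βQ βM) (hp : barHom p = n + 1) :
    barD bQ bM (Finsupp.single p 1) ∈
      biPiece 𝒬 barHom (barDeg degQ degM) n (barDeg degQ degM p) := by
  obtain ⟨l, m⟩ := p
  induction l generalizing n with
  | nil => simp [barHom] at hp
  | cons b l ih =>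
    have hl : l.length = n := by simpa [barHom] using hp
    rw [single_cons_eq bQ, barD_barS, barDeg_cons b (l, m), map_smul, Finsupp.smul_single,
      smul_eq_mul, mul_one]
    refine sub_mem (sub_mem (hl ▸ single_basis_mem hQ b (l, m)) ?_) ?_
    -- For `l = []` the term containing `D` is zero; for longer words the term containing the
    -- augmentation is.
    · cases n with
      | zero =>
        rw [List.length_eq_zero_iff] at hl
        subst hl
        simp [barD, barDAux]
      | succ n =>
        exact barS_mem hQ (biPiece_smulGraded 𝒬 n _ _ _ _ (hQ.mem b) (ih n hl))
    · cases n with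
      | zero =>
        rw [List.length_eq_zero_iff] at hl
        subst hl
        refine barUnit_mem hM ?_
        rw [barAug, Finsupp.linearCombination_single]
        refine hsmul _ _ _ _ (hQ.mem b) ?_
        simpa [barDeg] using hM.mem m
      | succ n =>
        obtain ⟨c, l, rfl⟩ := List.exists_cons_of_length_eq_add_one hl
        rw [barAug, Finsupp.linearCombination_single, smul_zero, map_zero]
        exact zero_mem _

lemma barE_mem (hQ : IsHomogeneousBasis 𝒬 bQ degQ) {d : ℕ} {c : Q} (hc : c ∈ 𝒬 d)
    (p : BarIndex βQ βM) :
    barE bQ c (Finsupp.single p 1) ∈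
      biPiece 𝒬 barHom (barDeg degQ degM) (barHom p + 1) (barDeg degQ degM p + d) := by
  have h1 : ∀ p : BarIndex βQ βM, Finsupp.single p c ∈
      biPiece 𝒬 barHom (barDeg degQ degM) (barHom p) (barDeg degQ degM p + d) := fun p =>
    single_mem_biPiece 𝒬 rfl (by rw [add_sub_cancel_left, intPiece_natCast]; exact hc)
  obtain ⟨l, m⟩ := p
  rw [barE, Finsupp.linearCombination_single, one_smul]
  dsimp only
  induction l with
  | nil => exact barS_mem hQ (h1 _)
  | cons b l ih =>
    refine sub_mem (barS_mem hQ (h1 _)) ?_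
    rw [barDeg_cons b (l, m), add_assoc]
    exact barS_mem hQ (biPiece_smulGraded 𝒬 _ _ _ _ _ (hQ.mem b) ih)

/-- The bar resolution of `M` over `Q`. -/
def barResolution {βQ : Type t} {βM : Type t'} {bQ : Module.Basis βQ K Q} {bM : Module.Basis βM K M}
    {degQ : βQ → ℕ} {degM : βM → ℤ} (hQ : IsHomogeneousBasis 𝒬 bQ degQ)
    (hM : IsHomogeneousBasis ℳ bM degM) (hsmul : SMulGraded 𝒬 ℳ) :
    FreeResolution.{w, u, v, max t t'} 𝒬 ℳ :=
  FreeResolution.ofExact 𝒬 ℳ barHom (barDeg degQ degM) (barD bQ bM) (barAug bM)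
    (barD_mem hQ hM hsmul)
    (by
      rintro ⟨l, m⟩ h
      obtain rfl := List.length_eq_zero_iff.1 h
      simp [barD, barDAux])
    (by
      rintro ⟨l, m⟩ h
      obtain rfl := List.length_eq_zero_iff.1 h
      simpa [barAug, barDeg] using hM.mem m)
    (by
      rintro ⟨_ | ⟨b, l⟩, m⟩ h
      · exact absurd rfl h
      · simp [barAug])
    (barD_barD bQ bM) (barAug_barD bQ bM)
    (fun x h1 h2 => ⟨barS bQ x, by rw [barD_barS, h1, h2]; simp⟩)
    (fun j m hm => ⟨barUnit bM m, barUnit_mem hM hm, barAug_barUnit bM m⟩)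

end GradedBar

/-! ### The cone of a square-zero homotopy and its exactness modulo `f`. -/

section Cone

variable {A X β : Type*} [CommRing A] [AddCommGroup X] [Module A X]

/-- The shift `(zᵢ) ↦ (zᵢ₊₁)` of finite sequences. -/
def shift (A X : Type*) [CommRing A] [AddCommGroup X] [Module A X] : (ℕ →₀ X) →ₗ[A] (ℕ →₀ X) :=
  Finsupp.lcomapDomain Nat.succ Nat.succ_injective

@[simp] lemma shift_apply (z : ℕ →₀ X) (i : ℕ) : shift A X z i = z (i + 1) := rfl

/-- The operator `(zᵢ) ↦ (D zᵢ + E zᵢ₊₁)` on finite sequences. -/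
def coneAux (D E : X →ₗ[A] X) : (ℕ →₀ X) →ₗ[A] (ℕ →₀ X) :=
  Finsupp.mapRange.linearMap D + Finsupp.mapRange.linearMap E ∘ₗ shift A X

@[simp] lemma coneAux_apply (D E : X →ₗ[A] X) (z : ℕ →₀ X) (i : ℕ) :
    coneAux D E z i = D (z i) + E (z (i + 1)) := by
  simp [coneAux]

/-- If `E` is a homotopy of square zero from multiplication by `f` to zero on a contractible
augmented complex, then `coneAux D E` is exact modulo `f`. -/
lemma coneAux_exact {N : Type*} [AddCommGroup N] [Module A N] {D E : X →ₗ[A] X} {ε : X →ₗ[A] N}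
    {f : A} {s : X →+ X} {s₀ : N →+ X} (hεD : ∀ x, ε (D x) = 0)
    (hs : ∀ x, D (s x) = x - s (D x) - s₀ (ε x)) (hs₀ : ∀ m, D (s₀ m) = 0)
    (hDD : ∀ x, D (D x) = 0)
    (hεs₀ : ∀ m, ε (s₀ m) = m) (hDE : ∀ x, D (E x) + E (D x) = f • x) (hEE : ∀ x, E (E x) = 0)
    (hεE : ∀ x, ε (E x) = 0) (hf : ∀ x : X, f • x = 0 → x = 0) {z w : ℕ →₀ X}
    (hz : coneAux D E z = f • w) (hz0 : ε (z 0) = 0) : ∃ u v, z = coneAux D E u + f • v := by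
  have hz1 : ∀ i, D (z i) + E (z (i + 1)) = f • w i := fun i => by
    simpa using DFunLike.congr_fun hz i
  -- Write `V` for `coneAux D E`, so that `V² = f · shift`. Applying `V` to `V z = f w` and
  -- cancelling `f` gives `V w = shift z`.
  have hw : ∀ i, D (w i) + E (w (i + 1)) = z (i + 1) := fun i => by
    rw [← sub_eq_zero]
    refine hf _ ?_
    rw [smul_sub, smul_add, ← D.map_smul, ← E.map_smul, ← hz1, ← hz1, D.map_add, E.map_add, hDD,
      hEE, ← hDE]
    abel
  -- Subtracting `E w` turns every coordinate into a cycle of `D`, to which the contraction applies.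
  let z' : ℕ →₀ X := z - Finsupp.mapRange.linearMap E w
  have hz' : ∀ i, z' i = z i - E (w i) := fun i => by simp [z']
  have hDz' : ∀ i, D (z' i) = 0 := fun i => by
    have h1 := congrArg E (hw i)
    rw [map_add, hEE, add_zero] at h1
    rw [hz', map_sub, eq_sub_of_add_eq (hz1 i), eq_sub_of_add_eq (hDE (w i)), h1]
    abel
  have hεz' : ∀ i, ε (z' i) = 0 := fun i => by
    rw [hz', map_sub, hεE, sub_zero]
    cases i with
    | zero => exact hz0
    | succ i => rw [← hw, map_add, hεD, hεE, add_zero]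
  have hsz' : ∀ i, D (s (z' i)) = z' i := fun i => by
    rw [hs, hDz', hεz', map_zero, map_zero, sub_zero, sub_zero]
  let sz : ℕ →₀ X := Finsupp.mapRange s (map_zero s) z'
  -- A correction by cycles `s₀ m` does not change `D u = z'`. It is chosen so that `ε` kills `wᵢ -
  -- uᵢ₊₁`, which can then be contracted as well.
  let t : ℕ →₀ X := Finsupp.mapRange (fun x => s₀ (ε x)) (by simp) (w - shift A X sz)
  let u : ℕ →₀ X := sz + Finsupp.mapDomain Nat.succ t
  have hu0 : u 0 = s (z' 0) := by
    have : Finsupp.mapDomain Nat.succ t 0 = 0 :=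
      Finsupp.mapDomain_of_notMem_range _ _ (by simp)
    simp [u, sz, this]
  have hu1 : ∀ i, u (i + 1) = s (z' (i + 1)) + s₀ (ε (w i - s (z' (i + 1)))) := fun i => by
    have : Finsupp.mapDomain Nat.succ t (i + 1) = t i :=
      Finsupp.mapDomain_apply Nat.succ_injective t i
    simp [u, sz, this, t]
  have hDu : ∀ i, D (u i) = z' i := fun i => by
    cases i with
    | zero => rw [hu0, hsz']
    | succ i => rw [hu1, map_add, hs₀, hsz', add_zero]
  let w' : ℕ →₀ X := w - shift A X u
  have hw' : ∀ i, w' i = w i - u (i + 1) := fun i => by simp [w']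
  have hεw' : ∀ i, ε (w' i) = 0 := fun i => by
    rw [hw', hu1, map_sub, map_add, hεs₀, map_sub]
    abel
  have hDw' : ∀ i, D (w' i) = 0 := fun i => by
    rw [hw', map_sub, hDu, hz', ← hw]
    abel
  let v : ℕ →₀ X := Finsupp.mapRange s (map_zero s) w'
  have hDv : ∀ i, D (v i) = w' i := fun i => by
    rw [Finsupp.mapRange_apply, hs, hDw', hεw', map_zero, map_zero, sub_zero, sub_zero]
  -- Since `D v = w - shift u`, one has `f v - D E v = E D v = E w - E (shift u)`. Adding `V u = z'
  -- + E (shift u)` gives `z' + E w = z`.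
  refine ⟨u - Finsupp.mapRange.linearMap E v, v, Finsupp.ext fun i => ?_⟩
  have h1 := hDE (v i)
  have h2 := congrArg E (hw' i)
  rw [hDv] at h1
  rw [map_sub] at h2
  simp only [Finsupp.add_apply, coneAux_apply, Finsupp.sub_apply, Finsupp.mapRange.linearMap_apply,
    Finsupp.mapRange_apply, map_sub, hEE, Finsupp.smul_apply, hDu, hz', ← h1, h2]
  abel

variable (D E : (β →₀ A) →ₗ[A] (β →₀ A))

/-- The operator `(zᵢ) ↦ (D zᵢ + E zᵢ₊₁)` on the free module on pairs `(i, b)`. -/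
def coneD : (ℕ × β →₀ A) →ₗ[A] (ℕ × β →₀ A) :=
  (Finsupp.curryLinearEquiv A).symm.toLinearMap ∘ₗ coneAux D E ∘ₗ
    (Finsupp.curryLinearEquiv A).toLinearMap

lemma curry_coneD (z : ℕ × β →₀ A) : (coneD D E z).curry = coneAux D E z.curry :=
  (Finsupp.curryLinearEquiv A).apply_symm_apply _

lemma curry_coneD_apply (z : ℕ × β →₀ A) (i : ℕ) :
    (coneD D E z).curry i = D (z.curry i) + E (z.curry (i + 1)) := by
  rw [curry_coneD, coneAux_apply]

/-- The inclusion of the `i`-th copy of a free module. -/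
def coneIncl (A : Type*) [CommRing A] (i : ℕ) : (β →₀ A) →ₗ[A] (ℕ × β →₀ A) :=
  (Finsupp.curryLinearEquiv A).symm.toLinearMap ∘ₗ Finsupp.lsingle i

lemma curry_coneIncl (i : ℕ) (x : β →₀ A) : (coneIncl A i x).curry = Finsupp.single i x :=
  (Finsupp.curryLinearEquiv A).apply_symm_apply _

lemma curry_injective' : Function.Injective (Finsupp.curry : (ℕ × β →₀ A) → _) :=
  (Finsupp.curryLinearEquiv A).injective

lemma coneIncl_apply (i k : ℕ) (b : β) (x : β →₀ A) :
    coneIncl A i x (k, b) = if i = k then x b else 0 := by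
  rw [← Finsupp.curry_apply, curry_coneIncl, Finsupp.single_apply]
  split_ifs <;> rfl

lemma coneIncl_single (i : ℕ) (b : β) (a : A) :
    coneIncl A i (Finsupp.single b a) = Finsupp.single (i, b) a := by
  classical
  ext ⟨k, c⟩
  rw [coneIncl_apply, Finsupp.single_apply, Finsupp.single_apply]
  by_cases h1 : i = k <;> by_cases h2 : b = c <;> simp [h1, h2]

lemma coneD_coneIncl_zero (x : β →₀ A) : coneD D E (coneIncl A 0 x) = coneIncl A 0 (D x) := by
  refine curry_injective' (Finsupp.ext fun i => ?_)
  rw [curry_coneD_apply, curry_coneIncl, curry_coneIncl]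
  cases i <;> simp

lemma coneD_coneIncl_succ (i : ℕ) (x : β →₀ A) :
    coneD D E (coneIncl A (i + 1) x) = coneIncl A (i + 1) (D x) + coneIncl A i (E x) := by
  refine curry_injective' (Finsupp.ext fun k => ?_)
  have h : (coneIncl A (i + 1) (D x) + coneIncl A i (E x)).curry =
      (coneIncl A (i + 1) (D x)).curry + (coneIncl A i (E x)).curry :=
    map_add (Finsupp.curryLinearEquiv A) _ _
  rw [h, curry_coneD_apply, Finsupp.add_apply, curry_coneIncl, curry_coneIncl, curry_coneIncl,
    Finsupp.single_apply, Finsupp.single_apply, Finsupp.single_apply, Finsupp.single_apply]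
  by_cases h1 : i = k
  · subst h1; simp
  · by_cases h2 : i + 1 = k <;> simp [h1, h2]

lemma baseChangeMap_coneD {B : Type*} [CommRing B] (g : A →+* B) :
    baseChangeMap g (coneD D E) = coneD (baseChangeMap g D) (baseChangeMap g E) := by
  have hincl : ∀ i (x : β →₀ A), mapCoeff g (coneIncl A i x) = coneIncl B i (mapCoeff g x) :=
    fun i x => by
      ext ⟨k, b⟩
      rw [mapCoeff_apply, coneIncl_apply, coneIncl_apply]
      split_ifs <;> simp
  refine free_ext ?_
  rintro ⟨_ | i, b⟩
  · rw [baseChangeMap_single_one, ← coneIncl_single, ← coneIncl_single, coneD_coneIncl_zero,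
      coneD_coneIncl_zero, baseChangeMap_single_one, hincl]
  · rw [baseChangeMap_single_one, ← coneIncl_single, ← coneIncl_single, coneD_coneIncl_succ,
      coneD_coneIncl_succ, baseChangeMap_single_one, baseChangeMap_single_one, map_add, hincl,
      hincl]

/-- The homological degrees of the cone. -/
def coneHom (hom : β → ℕ) (p : ℕ × β) : ℕ := 2 * p.1 + hom p.2

/-- The internal degrees of the cone. -/
def coneDeg (deg : β → ℤ) (d : ℕ) (p : ℕ × β) : ℤ := p.1 * d + deg p.2

end Cone

/-! ### The cone as a resolution over `R = Q/(f)`. -/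

section ConeResolution

universe w u v t

variable {K : Type w} [Field K] {Q : Type u} [CommRing Q] [Algebra K Q]
  {𝒬 : ℕ → Submodule K Q} [GradedAlgebra 𝒬] {M : Type v} [AddCommGroup M] [Module Q M]
  {ℳ : ℤ → AddSubgroup M}

lemma coneIncl_mem {β : Type*} {hom : β → ℕ} {deg : β → ℤ} (d : ℕ) (i : ℕ) {n m : ℕ} {j l : ℤ}
    {x : β →₀ Q} (hx : x ∈ biPiece 𝒬 hom deg n j) (hm : m = 2 * i + n) (hl : l = i * d + j) :
    coneIncl Q i x ∈ biPiece 𝒬 (coneHom hom) (coneDeg deg d) m l := by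
  rintro ⟨k, b⟩
  rw [coneIncl_apply]
  split_ifs with h
  · subst h
    refine ⟨?_, fun h0 => ?_⟩
    · have : l - coneDeg deg d (i, b) = j - deg b := by simp only [coneDeg, hl]; ring
      rw [this]
      exact (hx b).1
    · simp only [coneHom, (hx b).2 h0, hm]
  · exact ⟨zero_mem _, fun h => absurd rfl h⟩

/-- A contraction of the augmented complex `F` together with a homotopy `E`, of square zero and
internal degree `d`, from multiplication by `f` to zero. -/
structure SquareZeroHomotopy (F : FreeResolution.{w, u, v, t} 𝒬 ℳ) (f : Q) (d : ℕ) where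
  s : (F.β →₀ Q) →+ (F.β →₀ Q)
  s₀ : M →+ (F.β →₀ Q)
  E : (F.β →₀ Q) →ₗ[Q] (F.β →₀ Q)
  D_s : ∀ x, F.D (s x) = x - s (F.D x) - s₀ (F.ε x)
  D_s₀ : ∀ m, F.D (s₀ m) = 0
  ε_s₀ : ∀ m, F.ε (s₀ m) = m
  D_E : ∀ x, F.D (E x) + E (F.D x) = f • x
  E_E : ∀ x, E (E x) = 0
  ε_E : ∀ x, F.ε (E x) = 0
  ε_zero : ∀ b, F.hom b ≠ 0 → F.ε (Finsupp.single b 1) = 0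
  E_mem : ∀ b, E (Finsupp.single b 1) ∈ biPiece 𝒬 F.hom F.deg (F.hom b + 1) (F.deg b + d)

variable {R : Type*} [CommRing R] [Algebra K R] {ℛ : ℕ → Submodule K R} [GradedAlgebra ℛ]
  [Algebra Q R] [Module R M] [IsScalarTower Q R M]

lemma mapCoeff_mem (hgr : ∀ (n : ℕ) (q : Q), q ∈ 𝒬 n → algebraMap Q R q ∈ ℛ n)
    {β : Type*} {hom : β → ℕ} {deg : β → ℤ} {n : ℕ} {j : ℤ}
    {x : β →₀ Q} (hx : x ∈ biPiece 𝒬 hom deg n j) :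
    mapCoeff (algebraMap Q R) x ∈ biPiece ℛ hom deg n j := fun b => by
  rw [mapCoeff_apply]
  refine ⟨?_, fun h => (hx b).2 fun h0 => h (by rw [h0, map_zero])⟩
  rcases (mem_intPiece 𝒬).1 (hx b).1 with h0 | ⟨m, hm, hxm⟩
  · rw [h0, map_zero]; exact zero_mem _
  · rw [hm, intPiece_natCast]; exact hgr m _ hxm

lemma exists_eq_smul_of_mapCoeff_eq_zero {β : Type*} {f : Q}
    (hker : RingHom.ker (algebraMap Q R) = Ideal.span {f}) {x : β →₀ Q}
    (hx : mapCoeff (algebraMap Q R) x = 0) : ∃ w, x = f • w := by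
  have h : ∀ b, ∃ q, x b = f * q := fun b => by
    have h1 : x b ∈ RingHom.ker (algebraMap Q R) := by
      rw [RingHom.mem_ker, ← mapCoeff_apply, hx, Finsupp.zero_apply]
    rw [hker, Ideal.mem_span_singleton'] at h1
    obtain ⟨q, hq⟩ := h1
    exact ⟨q, by rw [← hq, mul_comm]⟩
  choose q hq using h
  refine ⟨∑ b ∈ x.support, Finsupp.single b (q b), ?_⟩
  rw [Finset.smul_sum]
  nth_rewrite 1 [← Finsupp.sum_single x]
  refine Finset.sum_congr rfl fun b _ => ?_
  rw [Finsupp.smul_single, smul_eq_mul, ← hq]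

variable (R) in
/-- The augmentation of the cone. -/
def coneAug {β : Type*} (ε : (β →₀ Q) →ₗ[Q] M) : (ℕ × β →₀ R) →ₗ[R] M :=
  Finsupp.linearCombination R fun p => if p.1 = 0 then ε (Finsupp.single p.2 1) else 0

lemma coneAug_mapCoeff {β : Type*} (ε : (β →₀ Q) →ₗ[Q] M) (z : ℕ × β →₀ Q) :
    coneAug R ε (mapCoeff (algebraMap Q R) z) = ε (z.curry 0) := by
  induction z using Finsupp.induction_linear with
  | zero =>
    have : (0 : ℕ × β →₀ Q).curry 0 = 0 := by ext; simp
    rw [this, map_zero, map_zero, map_zero]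
  | add x y hx hy =>
    have : (x + y).curry 0 = x.curry 0 + y.curry 0 := by ext; simp
    rw [this, map_add, map_add, map_add, hx, hy]
  | single p q =>
    obtain ⟨i, b⟩ := p
    rw [mapCoeff_single, ← coneIncl_single i b q, curry_coneIncl, coneAug,
      Finsupp.linearCombination_single, algebraMap_smul, Finsupp.single_apply]
    split_ifs with h
    · rw [← map_smul, Finsupp.smul_single_one]
    · rw [smul_zero, map_zero]

lemma coneD_mem {F : FreeResolution.{w, u, v, t} 𝒬 ℳ} {f : Q} {d : ℕ}
    (H : SquareZeroHomotopy F f d) (n : ℕ) (p : ℕ × F.β) (hp : coneHom F.hom p = n + 1) :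
    coneD F.D H.E (Finsupp.single p 1) ∈
      biPiece 𝒬 (coneHom F.hom) (coneDeg F.deg d) n (coneDeg F.deg d p) := by
  have hD : ∀ i b n, coneHom F.hom (i, b) = n + 1 →
      coneIncl Q i (F.D (Finsupp.single b 1)) ∈
        biPiece 𝒬 (coneHom F.hom) (coneDeg F.deg d) n (coneDeg F.deg d (i, b)) := by
    intro i b n hn
    rcases hb : F.hom b with _ | m
    · rw [F.D_zero b hb, map_zero]
      exact zero_mem _
    · exact coneIncl_mem d i (F.D_mem m b hb) (by simp only [coneHom] at hn; omega) rfl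
  obtain ⟨_ | i, b⟩ := p
  · rw [← coneIncl_single, coneD_coneIncl_zero]
    exact hD 0 b n hp
  · rw [← coneIncl_single, coneD_coneIncl_succ]
    refine add_mem (hD _ b n hp) (coneIncl_mem d i (H.E_mem b) ?_ ?_)
    · simp only [coneHom] at hp; omega
    · simp only [coneDeg]; push_cast; ring

lemma coneD_zero {F : FreeResolution.{w, u, v, t} 𝒬 ℳ} (E : (F.β →₀ Q) →ₗ[Q] (F.β →₀ Q))
    (p : ℕ × F.β) (hp : coneHom F.hom p = 0) : coneD F.D E (Finsupp.single p 1) = 0 := by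
  obtain ⟨i, b⟩ := p
  have h1 : i = 0 := by simp only [coneHom] at hp; omega
  have h2 : F.hom b = 0 := by simp only [coneHom] at hp; omega
  rw [h1, ← coneIncl_single, coneD_coneIncl_zero, F.D_zero b h2, map_zero]

/-- The square of the operator is `f` times the shift, by `D E + E D = f`. It is a differential only
modulo `f`. -/
lemma coneD_coneD {F : FreeResolution.{w, u, v, t} 𝒬 ℳ} {f : Q} {d : ℕ}
    (H : SquareZeroHomotopy F f d) (z : ℕ × F.β →₀ Q) : ∃ w,
    coneD F.D H.E (coneD F.D H.E z) = f • w := by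
  refine ⟨(Finsupp.curryLinearEquiv Q).symm (shift Q _ z.curry), curry_injective' ?_⟩
  have h : ∀ w : ℕ →₀ F.β →₀ Q, (f • (Finsupp.curryLinearEquiv Q).symm w).curry = f • w :=
    fun w => by
      rw [← map_smul]
      exact (Finsupp.curryLinearEquiv Q).apply_symm_apply _
  rw [h]
  ext1 i
  rw [curry_coneD_apply, curry_coneD_apply, curry_coneD_apply, F.D.map_add, H.E.map_add, F.D_D,
    H.E_E, zero_add, add_zero, H.D_E]
  rfl

/-- A resolution over `R = Q/(f)` of a module, from a resolution over `Q` and a homotopy. -/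
def coneResolution (F : FreeResolution.{w, u, v, t} 𝒬 ℳ) {f : Q} {d : ℕ}
    (H : SquareZeroHomotopy F f d) (hf : f ∈ nonZeroDivisors Q)
    (hgr : ∀ (n : ℕ) (q : Q), q ∈ 𝒬 n → algebraMap Q R q ∈ ℛ n)
    (hsurj : Function.Surjective (algebraMap Q R))
    (hker : RingHom.ker (algebraMap Q R) = Ideal.span {f}) :
    FreeResolution ℛ ℳ :=
  have hlift := mapCoeff_surjective (β := ℕ × F.β) (algebraMap Q R) hsurj
  have hf0 : algebraMap Q R f = 0 := by
    rw [← RingHom.mem_ker, hker]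
    exact Ideal.mem_span_singleton_self f
  FreeResolution.ofExact ℛ ℳ (coneHom F.hom) (coneDeg F.deg d)
    (baseChangeMap (algebraMap Q R) (coneD F.D H.E)) (coneAug R F.ε)
    (fun n p hp => by
      rw [baseChangeMap_single_one]
      exact mapCoeff_mem hgr (coneD_mem H n p hp))
    (fun p hp => by rw [baseChangeMap_single_one, coneD_zero _ p hp, map_zero])
    (fun p hp => by
      obtain ⟨i, b⟩ := p
      have h1 : i = 0 := by simp only [coneHom] at hp; omega
      have h2 : F.hom b = 0 := by simp only [coneHom] at hp; omega
      subst h1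
      simpa [coneAug, coneDeg] using F.ε_mem b h2)
    (fun p hp => by
      obtain ⟨i, b⟩ := p
      rw [coneAug, Finsupp.linearCombination_single, one_smul]
      split_ifs with h
      · exact H.ε_zero b fun hb => hp (by simp only [coneHom] at h ⊢; omega)
      · rfl)
    (fun z => by
      obtain ⟨z, rfl⟩ := hlift z
      obtain ⟨w, hw⟩ := coneD_coneD H z
      rw [baseChangeMap_mapCoeff, baseChangeMap_mapCoeff, hw, mapCoeff_smul, hf0, zero_smul])
    (fun z => by
      obtain ⟨z, rfl⟩ := hlift z
      rw [baseChangeMap_mapCoeff, coneAug_mapCoeff, curry_coneD_apply, map_add, F.ε_D, H.ε_E,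
        add_zero])
    (fun z h1 h2 => by
      obtain ⟨z, rfl⟩ := hlift z
      rw [baseChangeMap_mapCoeff] at h1
      rw [coneAug_mapCoeff] at h2
      -- A cycle over `R` lifts to a chain over `Q` whose image is divisible by `f`; this is the
      -- situation of `coneAux_exact`.
      obtain ⟨w, hw⟩ := exists_eq_smul_of_mapCoeff_eq_zero hker h1
      have hw' : coneAux F.D H.E z.curry = f • w.curry := by
        rw [← curry_coneD, hw]
        exact map_smul (Finsupp.curryLinearEquiv Q) f w
      obtain ⟨u, v, huv⟩ := coneAux_exact F.ε_D H.D_s H.D_s₀ F.D_D H.ε_s₀ H.D_E H.E_E H.ε_E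
        (fun x hx => by
          ext b
          have := DFunLike.congr_fun hx b
          rw [Finsupp.smul_apply, smul_eq_mul, mul_comm] at this
          exact (mem_nonZeroDivisors_iff.1 hf).2 _ this) hw' h2
      refine ⟨mapCoeff (algebraMap Q R) ((Finsupp.curryLinearEquiv Q).symm u), ?_⟩
      have hz : z = coneD F.D H.E ((Finsupp.curryLinearEquiv Q).symm u) +
          f • (Finsupp.curryLinearEquiv Q).symm v := by
        have h3 := congrArg (Finsupp.curryLinearEquiv Q).symm huv
        rw [map_add, map_smul] at h3
        have h4 : (Finsupp.curryLinearEquiv Q).symm z.curry = z :=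
          (Finsupp.curryLinearEquiv Q).symm_apply_apply z
        rw [h4] at h3
        rw [h3]
        congr 1
        simp [coneD]
      rw [baseChangeMap_mapCoeff]
      conv_rhs => rw [hz]
      rw [map_add, mapCoeff_smul, hf0, zero_smul, add_zero])
    (fun j m hm => by
      obtain ⟨x, hx, hxm⟩ := F.surj j m hm
      refine ⟨mapCoeff (algebraMap Q R) (coneIncl Q 0 x),
        mapCoeff_mem hgr (coneIncl_mem d 0 hx (by simp) (by simp)), ?_⟩
      rw [coneAug_mapCoeff, curry_coneIncl, Finsupp.single_eq_same, hxm])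

end ConeResolution

/-! ### The long exact sequence of the cone over `K`. -/

section ConeHomology

variable {K β : Type*} [Field K] {hom : β → ℕ} {deg : β → ℤ} {d : ℕ}
  {D E : (β →₀ K) →ₗ[K] (β →₀ K)}

/-- The shift of the cone. -/
def coneShift (β K : Type*) [Field K] : (ℕ × β →₀ K) →ₗ[K] (ℕ × β →₀ K) :=
  (Finsupp.curryLinearEquiv K).symm.toLinearMap ∘ₗ shift K (β →₀ K) ∘ₗ
    (Finsupp.curryLinearEquiv K).toLinearMap

/-- The right inverse of `coneShift`. -/
def coneUnshift (β K : Type*) [Field K] : (ℕ × β →₀ K) →ₗ[K] (ℕ × β →₀ K) :=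
  (Finsupp.curryLinearEquiv K).symm.toLinearMap ∘ₗ Finsupp.lmapDomain _ K Nat.succ ∘ₗ
    (Finsupp.curryLinearEquiv K).toLinearMap

lemma curry_coneShift (z : ℕ × β →₀ K) (i : ℕ) :
    (coneShift β K z).curry i = z.curry (i + 1) := by
  have : (coneShift β K z).curry = shift K _ z.curry :=
    (Finsupp.curryLinearEquiv K).apply_symm_apply _
  rw [this, shift_apply]

lemma curry_coneUnshift_succ (z : ℕ × β →₀ K) (i : ℕ) :
    (coneUnshift β K z).curry (i + 1) = z.curry i := by
  have : (coneUnshift β K z).curry = Finsupp.mapDomain Nat.succ z.curry :=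
    (Finsupp.curryLinearEquiv K).apply_symm_apply _
  rw [this]
  exact Finsupp.mapDomain_apply Nat.succ_injective _ i

lemma curry_ext {z w : ℕ × β →₀ K} (h : ∀ i, z.curry i = w.curry i) : z = w :=
  curry_injective' (Finsupp.ext h)

lemma curry_zero_apply (i : ℕ) : (0 : ℕ × β →₀ K).curry i = 0 := by
  ext; simp

lemma curry_sub (z w : ℕ × β →₀ K) (i : ℕ) : (z - w).curry i = z.curry i - w.curry i := by
  ext; simp

lemma coneIncl_mem_biSupp {i n m : ℕ} {j l : ℤ} {x : β →₀ K} (hx : x ∈ biSupp K hom deg n j)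
    (hm : m = 2 * i + n) (hl : l = i * d + j) :
    coneIncl K i x ∈ biSupp K (coneHom hom) (coneDeg deg d) m l := by
  rintro ⟨k, b⟩ h
  rw [coneIncl_apply] at h
  split_ifs at h with hk
  · subst hk
    obtain ⟨h1, h2⟩ := hx b h
    exact ⟨by simp only [coneHom]; omega, by simp only [coneDeg]; rw [hl, h2]⟩
  · exact absurd rfl h

lemma curry_zero_mem_biSupp {n : ℕ} {j : ℤ} {z : ℕ × β →₀ K}
    (hz : z ∈ biSupp K (coneHom hom) (coneDeg deg d) n j) : z.curry 0 ∈ biSupp K hom deg n j := by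
  intro b h
  obtain ⟨h1, h2⟩ := hz (0, b) h
  exact ⟨by simpa [coneHom] using h1, by simpa [coneDeg] using h2⟩

lemma coneShift_mem_biSupp {n : ℕ} {j : ℤ} {z : ℕ × β →₀ K}
    (hz : z ∈ biSupp K (coneHom hom) (coneDeg deg d) (n + 2) j) :
    coneShift β K z ∈ biSupp K (coneHom hom) (coneDeg deg d) n (j - d) := by
  rintro ⟨i, b⟩ h
  rw [← Finsupp.curry_apply, curry_coneShift] at h
  obtain ⟨h1, h2⟩ := hz (i + 1, b) h
  simp only [coneHom, coneDeg] at h1 h2 ⊢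
  push_cast at h2
  exact ⟨by omega, by linarith⟩

/-- The copies with `i ≥ 1` start in homological degree two. -/
lemma coneShift_eq_zero {n : ℕ} {j : ℤ} {z : ℕ × β →₀ K} (hn : n < 2)
    (hz : z ∈ biSupp K (coneHom hom) (coneDeg deg d) n j) : coneShift β K z = 0 := by
  ext ⟨i, b⟩
  by_contra h
  rw [← Finsupp.curry_apply, curry_coneShift] at h
  obtain ⟨h1, h2⟩ := hz (i + 1, b) h
  simp only [coneHom] at h1
  omega

lemma coneShift_coneD (z : ℕ × β →₀ K) :
    coneShift β K (coneD D E z) = coneD D E (coneShift β K z) :=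
  curry_ext fun i => by
    rw [curry_coneShift, curry_coneD_apply, curry_coneD_apply, curry_coneShift, curry_coneShift]

lemma coneUnshift_mem_biSupp {n : ℕ} {j : ℤ} {z : ℕ × β →₀ K}
    (hz : z ∈ biSupp K (coneHom hom) (coneDeg deg d) n (j - d)) :
    coneUnshift β K z ∈ biSupp K (coneHom hom) (coneDeg deg d) (n + 2) j := by
  rintro ⟨i, b⟩ h
  rw [← Finsupp.curry_apply] at h
  cases i with
  | zero =>
    have h1 : (coneUnshift β K z).curry = Finsupp.mapDomain Nat.succ z.curry :=
      (Finsupp.curryLinearEquiv K).apply_symm_apply _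
    rw [h1, Finsupp.mapDomain_of_notMem_range _ _ (by simp)] at h
    exact absurd rfl h
  | succ i =>
    rw [curry_coneUnshift_succ] at h
    obtain ⟨h1, h2⟩ := hz (i, b) h
    simp only [coneHom, coneDeg] at h1 h2 ⊢
    push_cast
    exact ⟨by omega, by linarith⟩

lemma eq_coneIncl_of_curry_succ {z : ℕ × β →₀ K} (h : ∀ i, z.curry (i + 1) = 0) :
    z = coneIncl K 0 (z.curry 0) := curry_ext fun i => by
  rw [curry_coneIncl]
  cases i with
  | zero => simp
  | succ i => rw [h, Finsupp.single_eq_of_ne (by simp)]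

lemma coneIncl_injective (i : ℕ) : Function.Injective (coneIncl (β := β) K i) := by
  intro x y h
  have h1 := congrArg (fun z => z.curry i) h
  simpa [curry_coneIncl] using h1

/-- A homology class of the cone that is killed by the shift comes from `D`. -/
lemma homologyNonzero_of_coneShift_eq
    (hV : IsBigraded (coneHom hom) (coneDeg deg d) (coneD D E))
    (hVV : ∀ z, coneD D E (coneD D E z) = 0) {n : ℕ} {j : ℤ}
    {z : ℕ × β →₀ K} (hz : z ∈ biSupp K (coneHom hom) (coneDeg deg d) n j)
    (hDz : coneD D E z = 0) (hbd : ∀ y, coneD D E y ≠ z)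
    (hu : ∃ u, coneD D E u = coneShift β K z) : HomologyNonzero hom deg D n j := by
  obtain ⟨u, hu, hmem⟩ : ∃ u, coneD D E u = coneShift β K z ∧
      coneD D E (coneUnshift β K u) ∈ biSupp K (coneHom hom) (coneDeg deg d) n j := by
    obtain ⟨u, hu⟩ := hu
    rcases lt_or_ge n 2 with hn | hn
    · exact ⟨0, by rw [coneShift_eq_zero hn hz, map_zero], by
        rw [map_zero, map_zero]; exact zero_mem _⟩
    · obtain ⟨n, rfl⟩ := Nat.exists_eq_add_of_le' hn
      obtain ⟨u', hu', h⟩ := hV.exists_mem (hu ▸ coneShift_mem_biSupp hz)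
      exact ⟨u', h.trans hu, hV.map_mem (coneUnshift_mem_biSupp hu')⟩
  -- The subtracted boundary has the same shift as `z`, so only the coordinate `i = 0` of the
  -- difference remains.
  set w := z - coneD D E (coneUnshift β K u) with hw
  have h1 : ∀ i, w.curry (i + 1) = 0 := fun i => by
    have h2 : (coneD D E (coneUnshift β K u)).curry (i + 1) = (coneD D E u).curry i := by
      rw [curry_coneD_apply, curry_coneD_apply, curry_coneUnshift_succ, curry_coneUnshift_succ]
    rw [hw, curry_sub, h2, hu, curry_coneShift, sub_self]
  have hw0 := eq_coneIncl_of_curry_succ h1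
  refine ⟨w.curry 0, curry_zero_mem_biSupp (sub_mem hz hmem), ?_, fun y hy => ?_⟩
  · refine coneIncl_injective 0 ?_
    rw [← coneD_coneIncl_zero D E, ← hw0, hw, map_sub, hDz, hVV, sub_zero, (coneIncl K 0).map_zero]
  · refine hbd (coneIncl K 0 y + coneUnshift β K u) ?_
    rw [map_add, coneD_coneIncl_zero, hy, ← hw0, hw, sub_add_cancel]

/-- The long exact sequence of the cone: the term before the homology of the cone. -/
lemma HomologyNonzero.of_cone
    (hV : IsBigraded (coneHom hom) (coneDeg deg d) (coneD D E))
    (hVV : ∀ z, coneD D E (coneD D E z) = 0) {n : ℕ} {j : ℤ}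
    (h : HomologyNonzero (coneHom hom) (coneDeg deg d) (coneD D E) n j) :
    HomologyNonzero hom deg D n j ∨ ∃ m, n = m + 2 ∧
      HomologyNonzero (coneHom hom) (coneDeg deg d) (coneD D E) m (j - d) := by
  obtain ⟨z, hz, hDz, hbd⟩ := h
  by_cases hu : ∃ u, coneD D E u = coneShift β K z
  · exact Or.inl (homologyNonzero_of_coneShift_eq hV hVV hz hDz hbd hu)
  · right
    have hn : 2 ≤ n := by
      by_contra hn
      exact hu ⟨0, by rw [coneShift_eq_zero (by omega) hz, map_zero]⟩
    obtain ⟨m, rfl⟩ := Nat.exists_eq_add_of_le' hn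
    refine ⟨m, rfl, coneShift β K z, coneShift_mem_biSupp hz, ?_, fun y hy => hu ⟨y, hy⟩⟩
    rw [← coneShift_coneD, hDz, map_zero]

/-- The long exact sequence of the cone: the term before the homology of `D`. -/
lemma HomologyNonzero.to_cone
    (hV : IsBigraded (coneHom hom) (coneDeg deg d) (coneD D E))
    (hDE : ∀ x, D (E x) + E (D x) = 0) (hEE : ∀ x, E (E x) = 0) {n : ℕ} {j : ℤ}
    (h : HomologyNonzero hom deg D n j) :
    HomologyNonzero (coneHom hom) (coneDeg deg d) (coneD D E) n j ∨ ∃ m, n = m + 1 ∧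
      HomologyNonzero (coneHom hom) (coneDeg deg d) (coneD D E) m (j - d) := by
  obtain ⟨z, hz, hDz, hbd⟩ := h
  have hz' : coneIncl K 0 z ∈ biSupp K (coneHom hom) (coneDeg deg d) n j :=
    coneIncl_mem_biSupp hz (by simp) (by simp)
  by_cases hu : ∃ v, coneD D E v = coneIncl K 0 z
  · right
    obtain ⟨v, hv⟩ := hu
    obtain ⟨v, hv', hvv⟩ := hV.exists_mem (hv ▸ hz')
    rw [hv] at hvv
    have h0 : D (v.curry 0) + E (v.curry 1) = z := by
      rw [← curry_coneD_apply, hvv, curry_coneIncl, Finsupp.single_eq_same]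
    -- The connecting map sends the class of `shift v` to that of `E v₁`, which is the class of `z`.
    -- If `shift v` were the boundary of `y`, then `z = D v₀ + E D y₀ = D (v₀ - E y₀)`.
    have key : ∀ y, coneD D E y ≠ coneShift β K v := fun y hy => by
      have h1 : v.curry 1 = D (y.curry 0) + E (y.curry 1) := by
        rw [← curry_coneD_apply, hy, curry_coneShift]
      refine hbd (v.curry 0 - E (y.curry 0)) ?_
      rw [map_sub, ← h0, h1, map_add, hEE, add_zero, eq_neg_of_add_eq_zero_left (hDE (y.curry 0)),
        sub_neg_eq_add]
    have hn : n ≠ 0 := by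
      rintro rfl
      exact key 0 (by rw [coneShift_eq_zero (by omega) hv', map_zero])
    obtain ⟨m, rfl⟩ := Nat.exists_eq_succ_of_ne_zero hn
    refine ⟨m, rfl, coneShift β K v, coneShift_mem_biSupp hv', ?_, key⟩
    rw [← coneShift_coneD, hvv]
    exact curry_ext fun i => by
      rw [curry_coneShift, curry_coneIncl, Finsupp.single_eq_of_ne (by simp), curry_zero_apply]
  · exact Or.inl ⟨coneIncl K 0 z, hz', by rw [coneD_coneIncl_zero, hDz, map_zero],
      fun y hy => hu ⟨y, hy⟩⟩

section Contraction

variable {I : (β →₀ K) →ₗ[K] (β →₀ K)}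

/-- If the shift is null-homotopic, then the homology of the cone comes from `D`. -/
lemma HomologyNonzero.of_cone_of_contraction
    (hV : IsBigraded (coneHom hom) (coneDeg deg d) (coneD D E))
    (hVV : ∀ z, coneD D E (coneD D E z) = 0)
    (hID : ∀ x, I (D x) + D (I x) = 0) (hIE : ∀ x, I (E x) + E (I x) = x) {n : ℕ} {j : ℤ}
    (h : HomologyNonzero (coneHom hom) (coneDeg deg d) (coneD D E) n j) :
    HomologyNonzero hom deg D n j := by
  obtain ⟨z, hz, hDz, hbd⟩ := h
  -- Applying `I` to each copy gives `V I + I V = shift`, where `V` is the differential of the cone.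
  -- So the shift of a cycle `z` is the boundary of `I z`.
  refine homologyNonzero_of_coneShift_eq hV hVV hz hDz hbd
    ⟨(Finsupp.curryLinearEquiv K).symm (Finsupp.mapRange.linearMap I z.curry),
      curry_ext fun i => ?_⟩
  have h1 : ((Finsupp.curryLinearEquiv K).symm (Finsupp.mapRange.linearMap I z.curry)).curry =
      Finsupp.mapRange.linearMap I z.curry := (Finsupp.curryLinearEquiv K).apply_symm_apply _
  have h2 : I (D (z.curry i) + E (z.curry (i + 1))) = 0 := by
    rw [← curry_coneD_apply, hDz, curry_zero_apply, map_zero]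
  rw [map_add] at h2
  rw [curry_coneD_apply, h1, curry_coneShift, Finsupp.mapRange.linearMap_apply,
    Finsupp.mapRange_apply, Finsupp.mapRange_apply]
  calc D (I (z.curry i)) + E (I (z.curry (i + 1)))
      = (I (D (z.curry i)) + D (I (z.curry i))) +
        (I (E (z.curry (i + 1))) + E (I (z.curry (i + 1)))) -
        (I (D (z.curry i)) + I (E (z.curry (i + 1)))) := by abel
    _ = z.curry (i + 1) := by rw [hID, hIE, h2, zero_add, sub_zero]

/-- `E` is injective from homology in degree zero to degree one: `I z = 0` there, so `z = I E z`,
and `E z = D y` would give `z = I D y = D (-I y)`. -/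
lemma HomologyNonzero.one_of_contraction
    (hE : ∀ b, hom b = 0 → E (Finsupp.single b 1) ∈ biSupp K hom deg 1 (deg b + d))
    (hDE : ∀ x, D (E x) + E (D x) = 0)
    (hI : ∀ b, hom b = 0 → I (Finsupp.single b 1) = 0)
    (hID : ∀ x, I (D x) + D (I x) = 0) (hIE : ∀ x, I (E x) + E (I x) = x) {j : ℤ}
    (h : HomologyNonzero hom deg D 0 j) : HomologyNonzero hom deg D 1 (j + d) := by
  obtain ⟨z, hz, hDz, hbd⟩ := h
  have hIz : I z = 0 := by
    rw [← Finsupp.sum_single z, Finsupp.sum, map_sum]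
    refine Finset.sum_eq_zero fun b hb => ?_
    have h1 : Finsupp.single b (z b) = z b • Finsupp.single b (1 : K) := by simp
    rw [h1, map_smul, hI b (hz b (Finsupp.mem_support_iff.1 hb)).1, smul_zero]
  refine ⟨E z, map_mem_biSupp E (fun b h1 h2 => h2 ▸ hE b h1) hz, ?_, fun y hy => ?_⟩
  · have := hDE z
    rwa [hDz, map_zero, add_zero] at this
  · refine hbd (-I y) ?_
    have h1 := hIE z
    rw [hIz, map_zero, add_zero, ← hy] at h1
    rw [map_neg, ← h1]
    exact (eq_neg_of_add_eq_zero_left (hID y)).symm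

end Contraction

/-- For `E = 0` the cone is the direct sum of copies of the complex, the `i`-th shifted by `(2i, i
d)`. This lemma and the next use the copies `0` and `1`. -/
lemma HomologyNonzero.to_cone_zero {n : ℕ} {j : ℤ} (h : HomologyNonzero hom deg D n j) :
    HomologyNonzero (coneHom hom) (coneDeg deg d) (coneD D 0) n j := by
  obtain ⟨z, hz, hDz, hbd⟩ := h
  refine ⟨coneIncl K 0 z, coneIncl_mem_biSupp hz (by simp) (by simp), by
    rw [coneD_coneIncl_zero, hDz, map_zero], fun y hy => hbd (y.curry 0) ?_⟩
  have := curry_coneD_apply D 0 y 0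
  rw [hy, curry_coneIncl, Finsupp.single_eq_same] at this
  simpa using this.symm

lemma HomologyNonzero.to_cone_two {n : ℕ} {j : ℤ} (h : HomologyNonzero hom deg D n j) :
    HomologyNonzero (coneHom hom) (coneDeg deg d) (coneD D 0) (n + 2) (j + d) := by
  obtain ⟨z, hz, hDz, hbd⟩ := h
  refine ⟨coneIncl K 1 z, coneIncl_mem_biSupp hz (by omega) (by push_cast; ring), by
    rw [coneD_coneIncl_succ, hDz]; simp, fun y hy => hbd (y.curry 1) ?_⟩
  have := curry_coneD_apply D 0 y 1
  rw [hy, curry_coneIncl, Finsupp.single_eq_same] at this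
  simpa using this.symm

end ConeHomology

/-! ### From degree bounds to slopes. -/

section ExtendedReals

/-- The supremum of the degrees `j` with `T i j`. -/
def supDegree (T : ℕ → ℤ → Prop) (i : ℕ) : EReal := ⨆ (j : ℤ) (_ : T i j), ((j : ℝ) : EReal)

open Classical in
/-- The slope of a bigraded object that is non-zero in the bidegrees `(i, j)` with `T i j`. -/
def slopeOf (T : ℕ → ℤ → Prop) : EReal :=
  if supDegree T 0 = ⊤ then ⊤
  else ⨆ (i : ℕ) (_ : 1 ≤ i), (supDegree T i - supDegree T 0) / (i : EReal)

lemma supDegree_le_coe {T : ℕ → ℤ → Prop} {i : ℕ} {c : ℝ} :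
    supDegree T i ≤ (c : EReal) ↔ ∀ j, T i j → (j : ℝ) ≤ c := by
  simp only [supDegree, iSup_le_iff, EReal.coe_le_coe_iff]

lemma slopeOf_eq_bot {T : ℕ → ℤ → Prop} (h : ∀ i j, ¬ T i j) : slopeOf T = ⊥ := by
  have h1 : ∀ i, supDegree T i = ⊥ := fun i => by
    simp only [supDegree, iSup_eq_bot]
    exact fun j hj => absurd hj (h i j)
  rw [slopeOf, if_neg (by rw [h1]; exact bot_ne_top)]
  simp only [iSup_eq_bot, h1]
  intro i hi
  rw [EReal.bot_sub, EReal.bot_div_of_pos_ne_top (by exact_mod_cast hi) (EReal.natCast_ne_top i)]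

/-- For finite `t_0` a real bound on the slope becomes a family of real linear inequalities, free of
extended-real arithmetic. -/
lemma slopeOf_le_coe {T : ℕ → ℤ → Prop} {c σ : ℝ} (hc : supDegree T 0 = c) :
    slopeOf T ≤ (σ : EReal) ↔ ∀ i, 1 ≤ i → ∀ j, T i j → (j : ℝ) - c ≤ i * σ := by
  rw [slopeOf, if_neg (by rw [hc]; exact EReal.coe_ne_top c), hc]
  simp only [iSup_le_iff]
  refine forall₂_congr fun i hi => ?_
  have h1 : (0 : EReal) < (i : EReal) := by exact_mod_cast hi
  rw [EReal.div_le_iff_le_mul h1 (EReal.natCast_ne_top i),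
    EReal.sub_le_iff_le_add (Or.inl (EReal.coe_ne_bot c)) (Or.inl (EReal.coe_ne_top c))]
  have h2 : (i : EReal) * (σ : EReal) + (c : EReal) = ((i * σ + c : ℝ) : EReal) := by
    push_cast; rfl
  rw [h2, supDegree_le_coe]
  refine forall₂_congr fun j _ => ?_
  rw [sub_le_iff_le_add]

/-- To bound a slope by a maximum with a real number, it is enough to do so for real bounds. -/
lemma le_max_coe_of_forall {x y : EReal} {r : ℝ}
    (h : ∀ σ : ℝ, y ≤ (σ : EReal) → r ≤ σ → x ≤ (σ : EReal)) : x ≤ max y (r : EReal) := by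
  rcases eq_or_ne y ⊤ with rfl | hy
  · rw [max_eq_left le_top]; exact le_top
  have h1 : max y (r : EReal) ≠ ⊤ := by
    rcases max_choice y (r : EReal) with h | h <;> rw [h]
    · exact hy
    · exact EReal.coe_ne_top r
  have h2 : max y (r : EReal) ≠ ⊥ := fun h =>
    EReal.coe_ne_bot r (le_bot_iff.1 (h ▸ le_max_right y (r : EReal)))
  lift max y (r : EReal) to ℝ using ⟨h1, h2⟩ with σ hσ
  refine h σ (hσ ▸ le_max_left _ _) ?_
  have := le_max_right y (r : EReal)
  rw [← hσ] at this
  exact_mod_cast this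

lemma le_of_forall_coe {x y : EReal} (hy : y ≠ ⊥) (h : ∀ σ : ℝ, y ≤ (σ : EReal) → x ≤ (σ : EReal)) :
    x ≤ y := by
  rcases eq_or_ne y ⊤ with rfl | hy'
  · exact le_top
  · lift y to ℝ using ⟨hy', hy⟩
    exact h y le_rfl

variable {T T' : ℕ → ℤ → Prop} {d : ℕ}

lemma supDegree_eq_of_iff (h0 : ∀ j, T 0 j ↔ T' 0 j) : supDegree T 0 = supDegree T' 0 := by
  simp only [supDegree, h0]

lemma supDegree_ne_bot (h : ∃ j, T 0 j) : supDegree T 0 ≠ ⊥ := by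
  obtain ⟨j, hj⟩ := h
  intro h
  simp only [supDegree, iSup_eq_bot] at h
  exact EReal.coe_ne_bot _ (h j hj)

/-- A bound for the slope of `T` from `t_i(T) ≤ max (t_i(T')) (t_{i-1}(T') + d)`. -/
lemma slopeOf_le_max_of_step_one (hne : ∃ j, T 0 j) (h0 : ∀ j, T 0 j ↔ T' 0 j)
    (h : ∀ n j, T n j → T' n j ∨ ∃ m, n = m + 1 ∧ T' m (j - d)) :
    slopeOf T ≤ max (slopeOf T') (d : EReal) := by
  rcases eq_or_ne (supDegree T 0) ⊤ with ht | ht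
  · rw [slopeOf, slopeOf, if_pos ht, if_pos (supDegree_eq_of_iff h0 ▸ ht)]
    exact le_max_left _ _
  obtain ⟨c, hc⟩ : ∃ c : ℝ, supDegree T 0 = c := by
    lift supDegree T 0 to ℝ using ⟨ht, supDegree_ne_bot hne⟩ with c
    exact ⟨c, rfl⟩
  have hc' : supDegree T' 0 = c := (supDegree_eq_of_iff h0) ▸ hc
  have hd : ((d : ℕ) : EReal) = ((d : ℝ) : EReal) := rfl
  rw [hd]
  refine le_max_coe_of_forall fun σ hσ hdσ => ?_
  rw [slopeOf_le_coe hc'] at hσ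
  rw [slopeOf_le_coe hc]
  intro i hi j hj
  rcases h i j hj with h1 | ⟨m, rfl, h1⟩
  · exact hσ i hi j h1
  · have h2 : ((j - d : ℤ) : ℝ) - c ≤ m * σ := by
      -- The slope has no term of index `0`; there the bound is `t_0 = c` itself.
      rcases Nat.eq_zero_or_pos m with rfl | hm
      · have := supDegree_le_coe.1 hc'.le _ h1
        simpa using this
      · exact hσ m hm _ h1
    push_cast at h2 ⊢
    linarith

/-- A bound for the slope of `T` from `t_i(T) ≤ max (t_i(T')) (t_{i-2}(T) + d)`. -/
lemma slopeOf_le_max_of_step_two (hne : ∃ j, T 0 j) (h0 : ∀ j, T 0 j ↔ T' 0 j)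
    (h : ∀ n j, T n j → T' n j ∨ ∃ m, n = m + 2 ∧ T m (j - d)) :
    slopeOf T ≤ max (slopeOf T') ((d : EReal) / 2) := by
  rcases eq_or_ne (supDegree T 0) ⊤ with ht | ht
  · rw [slopeOf, slopeOf, if_pos ht, if_pos (supDegree_eq_of_iff h0 ▸ ht)]
    exact le_max_left _ _
  obtain ⟨c, hc⟩ : ∃ c : ℝ, supDegree T 0 = c := by
    lift supDegree T 0 to ℝ using ⟨ht, supDegree_ne_bot hne⟩ with c
    exact ⟨c, rfl⟩
  have hc' : supDegree T' 0 = c := (supDegree_eq_of_iff h0) ▸ hc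
  have hd : (d : EReal) / 2 = ((d / 2 : ℝ) : EReal) := rfl
  rw [hd]
  refine le_max_coe_of_forall fun σ hσ hdσ => ?_
  rw [slopeOf_le_coe hc'] at hσ
  rw [slopeOf_le_coe hc]
  -- The index `0` is included as the base of an induction in steps of two, each of which costs `d ≤
  -- 2σ`.
  suffices H : ∀ i j, T i j → (j : ℝ) - c ≤ i * σ from fun i _ j hj => H i j hj
  intro i
  induction i using Nat.strong_induction_on with
  | _ i ih =>
    intro j hj
    rcases Nat.eq_zero_or_pos i with rfl | hi
    · have := supDegree_le_coe.1 hc.le _ hj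
      simpa using this
    rcases h i j hj with h1 | ⟨m, rfl, h1⟩
    · exact hσ i hi j h1
    · have h2 := ih m (by omega) _ h1
      push_cast at h2 ⊢
      linarith

/-- The slope of `T'` is at least `d / r` and at least the slope of `T`, if `t_r(T') ≥ t_0 + d` and
`t_i(T') ≥ t_i(T)`. -/
lemma max_le_slopeOf (hne : ∃ j, T 0 j) (h0 : ∀ j, T 0 j ↔ T' 0 j)
    (h : ∀ n j, T n j → T' n j) {r : ℕ} (hr : 1 ≤ r) (hd : ∀ j, T 0 j → T' r (j + d)) :
    max (slopeOf T) ((d / r : ℝ) : EReal) ≤ slopeOf T' := by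
  rcases eq_or_ne (supDegree T 0) ⊤ with ht | ht
  · rw [slopeOf, slopeOf, if_pos ht, if_pos (supDegree_eq_of_iff h0 ▸ ht)]
    exact le_top
  obtain ⟨c, hc⟩ : ∃ c : ℝ, supDegree T 0 = c := by
    lift supDegree T 0 to ℝ using ⟨ht, supDegree_ne_bot hne⟩ with c
    exact ⟨c, rfl⟩
  have hc' : supDegree T' 0 = c := (supDegree_eq_of_iff h0) ▸ hc
  have key : ∀ σ : ℝ, slopeOf T' ≤ (σ : EReal) →
      max (slopeOf T) ((d / r : ℝ) : EReal) ≤ (σ : EReal) := by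
    intro σ hσ
    rw [slopeOf_le_coe hc'] at hσ
    refine max_le ((slopeOf_le_coe hc).2 fun i hi j hj => hσ i hi j (h i j hj)) ?_
    rw [EReal.coe_le_coe_iff, div_le_iff₀ (by exact_mod_cast hr)]
    have h1 : supDegree T 0 ≤ ((c + r * σ - d : ℝ) : EReal) := by
      refine supDegree_le_coe.2 fun j hj => ?_
      have := hσ r hr _ (hd j hj)
      push_cast at this
      linarith
    rw [hc, EReal.coe_le_coe_iff] at h1
    linarith
  -- A slope of `⊥` would be bounded by `d / r - 1`, and `key` would then bound `d / r` by the same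
  -- number.
  refine le_of_forall_coe (fun hbot => ?_) key
  have h1 := (le_max_right _ _).trans (key ((d / r : ℝ) - 1) (hbot ▸ bot_le))
  rw [EReal.coe_le_coe_iff] at h1
  linarith

end ExtendedReals

/-! ### Non-vanishing of `Tor_0`, in the manner of Nakayama's lemma. -/

section TorZero

universe w u v t

variable {K : Type w} [Field K] {A : Type u} [CommRing A] [Algebra K A]
  {𝒜 : ℕ → Submodule K A} [GradedAlgebra 𝒜] {M : Type v} [AddCommGroup M] [Module A M]
  {ℳ : ℤ → AddSubgroup M}

/-- The projection of a graded module onto its piece of degree `j`. -/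
def gradedProj (ℳ : ℤ → AddSubgroup M) [DirectSum.Decomposition ℳ] (j : ℤ) : M →+ M :=
  (ℳ j).subtype.comp ((DFinsupp.evalAddMonoidHom j).comp
    (DirectSum.decomposeAddEquiv ℳ).toAddMonoidHom)

lemma gradedProj_of_mem [DirectSum.Decomposition ℳ] {i : ℤ} {m : M} (hm : m ∈ ℳ i) (j : ℤ) :
    gradedProj ℳ j m = if i = j then m else 0 := by
  change ((DirectSum.decompose ℳ m j : ℳ j) : M) = _
  split_ifs with h
  · subst h
    exact DirectSum.decompose_of_mem_same ℳ hm
  · exact DirectSum.decompose_of_mem_ne ℳ hm h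

/-- The annihilator of a graded module is homogeneous. -/
lemma decompose_smul_eq_zero (hM : DirectSum.IsInternal ℳ) (hsmul : SMulGraded 𝒜 ℳ) {a : A}
    (ha : ∀ m : M, a • m = 0) (n : ℕ) (m : M) :
    ((DirectSum.decompose 𝒜 a n : 𝒜 n) : A) • m = 0 := by
  classical
  let _ : DirectSum.Decomposition ℳ := hM.chooseDecomposition
  induction m using DirectSum.Decomposition.inductionOn ℳ with
  | zero => rw [smul_zero]
  | add m m' h h' => rw [smul_add, h, h', add_zero]
  | @homogeneous j m =>
    have h1 := congrArg (gradedProj ℳ (n + j)) (ha (m : M))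
    have h2 : ∀ k, gradedProj ℳ (n + j) (((DirectSum.decompose 𝒜 a k : 𝒜 k) : A) • (m : M)) =
        if k = n then ((DirectSum.decompose 𝒜 a k : 𝒜 k) : A) • (m : M) else 0 := fun k => by
      rw [gradedProj_of_mem (hsmul k j _ _ (SetLike.coe_mem _) m.2)]
      simp only [add_left_inj, Nat.cast_inj]
    nth_rewrite 1 [← DirectSum.sum_support_decompose 𝒜 a] at h1
    rw [Finset.sum_smul, map_sum, map_zero, Finset.sum_congr rfl fun k _ => h2 k,
      Finset.sum_ite_eq'] at h1
    split_ifs at h1 with hn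
    · exact h1
    · have h3 : ((DirectSum.decompose 𝒜 a n : 𝒜 n) : A) = 0 := by
        simpa using hn
      rw [h3, zero_smul]

/-- The elements of `A₊ M` have no component in the lowest degree of `M`. -/
lemma gradedProj_plusIdeal_smul [DirectSum.Decomposition ℳ] (hsmul : SMulGraded 𝒜 ℳ) {j₀ : ℤ}
    (hj₀ : ∀ j < j₀, ℳ j = ⊥) {a : A} (ha : a ∈ plusIdeal 𝒜) (m : M) :
    gradedProj ℳ j₀ (a • m) = 0 := by
  classical
  induction m using DirectSum.Decomposition.inductionOn ℳ with
  | zero => rw [smul_zero, map_zero]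
  | add m m' h h' => rw [smul_add, map_add, h, h', add_zero]
  | @homogeneous j m =>
    rw [← DirectSum.sum_support_decompose 𝒜 a, Finset.sum_smul, map_sum]
    refine Finset.sum_eq_zero fun n hn => ?_
    rw [gradedProj_of_mem (hsmul n j _ _ (SetLike.coe_mem _) m.2)]
    split_ifs with h
    · rcases Nat.eq_zero_or_pos n with rfl | hn'
      · have h0 : ((DirectSum.decompose 𝒜 a 0 : 𝒜 0) : A) = 0 := by
          have : a ∈ HomogeneousIdeal.irrelevant 𝒜 := ha
          rwa [HomogeneousIdeal.mem_irrelevant_iff, GradedRing.proj_apply] at this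
        rw [h0, zero_smul]
      · have h1 : (m : M) = 0 := AddSubgroup.mem_bot.1 ((hj₀ j (by omega)).le m.2)
        rw [h1, smul_zero]
    · rfl

/-- A non-zero module that is bounded below has a minimal generator. -/
lemma FreeResolution.exists_torNonzero_zero (F : FreeResolution.{w, u, v, t} 𝒜 ℳ)
    {aug : A →ₐ[K] K} (haug : IsAug 𝒜 aug) (hM : DirectSum.IsInternal ℳ)
    (hsmul : SMulGraded 𝒜 ℳ) (hbdd : ∃ j₀ : ℤ, ∀ j : ℤ, j < j₀ → ℳ j = ⊥) [Nontrivial M] :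
    ∃ j, F.TorNonzero aug 0 j := by
  classical
  let _ : DirectSum.Decomposition ℳ := hM.chooseDecomposition
  obtain ⟨j₀, hj₀, hmin⟩ : ∃ j₀, ℳ j₀ ≠ ⊥ ∧ ∀ j < j₀, ℳ j = ⊥ := by
    have hex : ∃ j, ℳ j ≠ ⊥ := by
      by_contra h
      push Not at h
      obtain ⟨m, hm⟩ := exists_ne (0 : M)
      refine hm (DirectSum.Decomposition.inductionOn ℳ rfl (fun {j} m => ?_)
        (fun m m' h h' => by rw [h, h', add_zero]) m)
      exact AddSubgroup.mem_bot.1 ((h j).le m.2)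
    obtain ⟨b, hb⟩ := hbdd
    obtain ⟨j₀, h1, h2⟩ := Int.exists_least_of_bdd (P := fun j => ℳ j ≠ ⊥)
      ⟨b, fun j hj => by
        by_contra hlt
        exact hj (hb j (not_le.1 hlt))⟩ hex
    exact ⟨j₀, h1, fun j hj => by
      by_contra hne
      exact absurd (h2 j hne) (not_le.2 hj)⟩
  obtain ⟨m, hm, hm0⟩ : ∃ m ∈ ℳ j₀, m ≠ 0 := (AddSubgroup.bot_or_exists_ne_zero _).resolve_left hj₀
  obtain ⟨x, hx, hxm⟩ := F.surj j₀ m hm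
  refine ⟨j₀, mapCoeff (aug : A →+* K) x, mapCoeff_mem_biSupp haug hx, ?_, fun y hy => hm0 ?_⟩
  · rw [baseChangeMap_mapCoeff, F.D_eq_zero hx, map_zero]
  -- If the class of `x` were the boundary of `y`, then `t` would have coordinates in `A₊` and still
  -- map to `m`. But `A₊ M` has no component in the lowest degree of `M`.
  · set t := x - F.D (mapCoeff (algebraMap K A) y) with ht
    have h1 : mapCoeff (aug : A →+* K) t = 0 := by
      rw [ht, map_sub, ← baseChangeMap_mapCoeff, mapCoeff_aug_algebraMap, hy, sub_self]
    have h2 : F.ε t = m := by rw [ht, map_sub, F.ε_D, hxm, sub_zero]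
    have h4 := gradedProj_of_mem hm j₀
    rw [if_pos rfl] at h4
    rw [← h4, ← h2, ← Finsupp.sum_single t, Finsupp.sum, map_sum, map_sum]
    refine Finset.sum_eq_zero fun b _ => ?_
    have h3 : Finsupp.single b (t b) = t b • Finsupp.single b (1 : A) := by simp
    rw [h3, map_smul]
    refine gradedProj_plusIdeal_smul hsmul hmin ((haug _).1 ?_) _
    simpa using DFunLike.congr_fun h1 b

/-- The zero module has a resolution with empty basis. -/
lemma FreeResolution.not_torNonzero [Subsingleton M] (F : FreeResolution.{w, u, v, t} 𝒜 ℳ)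
    {aug : A →ₐ[K] K} (haug : IsAug 𝒜 aug) (n : ℕ) (j : ℤ) : ¬ F.TorNonzero aug n j := by
  intro h
  let F' : FreeResolution.{w, u, v, 0} 𝒜 ℳ :=
    FreeResolution.ofExact 𝒜 ℳ (β := PEmpty) PEmpty.elim PEmpty.elim 0 0 (fun _ b => b.elim)
      (fun b => b.elim) (fun b => b.elim) (fun b => b.elim) (fun _ => rfl) (fun _ => rfl)
      (fun x _ _ => ⟨0, Subsingleton.elim _ _⟩)
      (fun _ _ _ => ⟨0, zero_mem _, Subsingleton.elim _ _⟩)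
  obtain ⟨z, -, -, hbd⟩ := h.of_resolution F F' haug
  have : IsEmpty F'.β := inferInstanceAs (IsEmpty PEmpty)
  exact hbd 0 (Subsingleton.elim _ _)

end TorZero

/-! ### A derivation detecting `f ∉ (Q₊)²`. -/

section Derivation

variable {K Q : Type*} [Field K] [CommRing Q] [Algebra K Q] {𝒬 : ℕ → Submodule K Q}
  [GradedAlgebra 𝒬] {aug : Q →ₐ[K] K}

/-- A derivation `Q → K` that does not vanish on `f ∉ (Q₊)²`. -/
lemma exists_derivation (haug : IsAug 𝒬 aug) {f : Q} (hf : f ∈ plusIdeal 𝒬)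
    (hf2 : f ∉ plusIdeal 𝒬 ^ 2) : ∃ φ : Q →ₗ[K] K, φ 1 = 0 ∧
      (∀ p q, φ (p * q) = aug p * φ q + φ p * aug q) ∧ φ f = 1 := by
  -- The functional is to vanish on `1` and on `(Q₊)²`. If `f = c + z` with `z ∈ (Q₊)²`, the
  -- augmentation gives `c = 0`, whence `f ∈ (Q₊)²`.
  have hmem : f ∉ Submodule.span K {(1 : Q)} ⊔ (plusIdeal 𝒬 ^ 2).restrictScalars K := by
    intro h
    obtain ⟨y, hy, z, hz, hyz⟩ := Submodule.mem_sup.1 h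
    obtain ⟨c, rfl⟩ := Submodule.mem_span_singleton.1 hy
    have hz' : z ∈ plusIdeal 𝒬 ^ 2 := hz
    have h1 : aug z = 0 := (haug z).2 (Ideal.pow_le_self two_ne_zero hz')
    have h2 : aug f = 0 := (haug f).2 hf
    rw [← hyz, map_add, h1, map_smul, map_one, smul_eq_mul, mul_one, add_zero] at h2
    rw [h2, zero_smul, zero_add] at hyz
    exact hf2 (hyz ▸ hz')
  obtain ⟨φ, hφf, hφ⟩ := Submodule.exists_le_ker_of_notMem hmem
  have h1 : φ 1 = 0 := hφ (Submodule.mem_sup_left (Submodule.mem_span_singleton_self 1))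
  have hmul : ∀ p q, φ (p * q) = aug p * φ q + φ p * aug q := fun p q => by
    have hsub : ∀ p, p - algebraMap K Q (aug p) ∈ plusIdeal 𝒬 := fun p => by
      rw [← haug]; simp
    -- Vanishing on this product of two elements of `Q₊` is the Leibniz rule.
    have h2 : φ ((p - algebraMap K Q (aug p)) * (q - algebraMap K Q (aug q))) = 0 := by
      refine hφ (Submodule.mem_sup_right ?_)
      change _ ∈ plusIdeal 𝒬 ^ 2
      rw [pow_two]
      exact Ideal.mul_mem_mul (hsub p) (hsub q)
    have h3 : (p - algebraMap K Q (aug p)) * (q - algebraMap K Q (aug q)) =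
        p * q - aug q • p - aug p • q + (aug p * aug q) • (1 : Q) := by
      simp only [Algebra.smul_def, map_mul]; ring
    rw [h3, map_add, map_sub, map_sub, map_smul, map_smul, map_smul, h1, smul_zero, add_zero,
      smul_eq_mul, smul_eq_mul, sub_sub, sub_eq_zero] at h2
    rw [h2]; ring
  refine ⟨(φ f)⁻¹ • φ, by simp [h1], fun p q => ?_, by simp [inv_mul_cancel₀ hφf]⟩
  simp only [LinearMap.smul_apply, smul_eq_mul, hmul]
  ring

end Derivation

/-! ### The two square-zero homotopies for `f`. -/

section Homotopies

universe w u v t t'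

variable {K : Type w} [Field K] {Q : Type u} [CommRing Q] [Algebra K Q]
  {𝒬 : ℕ → Submodule K Q} [GradedAlgebra 𝒬] {M : Type v} [AddCommGroup M]
  [Module Q M] [Module K M] [IsScalarTower K Q M] {ℳ : ℤ → AddSubgroup M}
  {βQ : Type t} {βM : Type t'}
  {bQ : Module.Basis βQ K Q} {bM : Module.Basis βM K M} {degQ : βQ → ℕ} {degM : βM → ℤ}

/-- `E` is a homotopy of internal degree `d` from multiplication by `f` to zero, in the span of the
shuffle products. -/
structure IsShuffleHomotopy (𝒬 : ℕ → Submodule K Q) (bQ : Module.Basis βQ K Q)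
    (bM : Module.Basis βM K M) (degQ : βQ → ℕ) (degM : βM → ℤ) (f : Q) (d : ℕ)
    (E : (BarIndex βQ βM →₀ Q) →ₗ[Q] (BarIndex βQ βM →₀ Q)) : Prop where
  mem_span : E ∈ shuffleSpan bQ βM
  D_E : ∀ x, barD bQ bM (E x) + E (barD bQ bM x) = f • x
  E_mem : ∀ b, E (Finsupp.single b 1) ∈
    biPiece 𝒬 barHom (barDeg degQ degM) (barHom b + 1) (barDeg degQ degM b + d)

lemma isShuffleHomotopy_barE (hQ : IsHomogeneousBasis 𝒬 bQ degQ) {f : Q} {d : ℕ} (hfd : f ∈ 𝒬 d)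
    (hf : ∀ m : M, f • m = 0) :
    IsShuffleHomotopy 𝒬 bQ bM degQ degM f d (barE bQ f) :=
  ⟨barE_mem_shuffleSpan bQ f, barD_barE bQ bM f hf, barE_mem hQ hfd⟩

/-- A shuffle homotopy gives a homotopy of square zero on the bar resolution. -/
def IsShuffleHomotopy.toSquareZeroHomotopy (hQ : IsHomogeneousBasis 𝒬 bQ degQ)
    (hM : IsHomogeneousBasis ℳ bM degM) (hsmul : SMulGraded 𝒬 ℳ) {f : Q} {d : ℕ}
    {E : (BarIndex βQ βM →₀ Q) →ₗ[Q] (BarIndex βQ βM →₀ Q)}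
    (hE : IsShuffleHomotopy 𝒬 bQ bM degQ degM f d E) :
    SquareZeroHomotopy (barResolution hQ hM hsmul) f d where
  s := (barS bQ).toAddMonoidHom
  s₀ := (barUnit bM).toAddMonoidHom
  E := E
  D_s := barD_barS bQ bM
  D_s₀ := barD_barUnit bQ bM
  ε_s₀ := barAug_barUnit bM
  D_E := hE.D_E
  E_E := shuffleSpan_sq bQ bM hE.mem_span
  ε_E := barAug_shuffleSpan bQ bM hE.mem_span
  ε_zero := by
    rintro ⟨_ | ⟨b, l⟩, m⟩ h
    · exact absurd rfl h
    · change barAug bM (Finsupp.single (b :: l, m) 1) = 0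
      simp [barAug]
  E_mem := hE.E_mem

/-- If `f ∈ Q₊ · Ann M`, then there is a shuffle homotopy with entries in `Q₊`. -/
lemma exists_isShuffleHomotopy {aug : Q →ₐ[K] K} (haug : IsAug 𝒬 aug)
    (hQ : IsHomogeneousBasis 𝒬 bQ degQ) (hM : DirectSum.IsInternal ℳ) (hsmul : SMulGraded 𝒬 ℳ)
    {f : Q} {d : ℕ} (hfd : f ∈ 𝒬 d) (hf : f ∈ plusIdeal 𝒬 * Module.annihilator Q M) :
    ∃ E, IsShuffleHomotopy 𝒬 bQ bM degQ degM f d E ∧ baseChangeMap (aug : Q →+* K) E = 0 := by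
  classical
  let P : Q → Prop := fun x =>
    ∃ E, IsShuffleHomotopy 𝒬 bQ bM degQ degM x d E ∧ baseChangeMap (aug : Q →+* K) E = 0
  have hP0 : P 0 := ⟨0, ⟨zero_mem _, fun x => by simp, fun b => zero_mem _⟩, by simp⟩
  have hPadd : ∀ x y, P x → P y → P (x + y) := by
    rintro x y ⟨E, hE, hE0⟩ ⟨E', hE', hE0'⟩
    refine ⟨E + E', ⟨add_mem hE.mem_span hE'.mem_span, fun z => ?_,
      fun b => add_mem (hE.E_mem b) (hE'.E_mem b)⟩, by simp [hE0, hE0']⟩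
    rw [add_smul, ← hE.D_E, ← hE'.D_E, LinearMap.add_apply, LinearMap.add_apply, map_add]
    abel
  have hPsum : ∀ (s : Finset ℕ) (g : ℕ → Q), (∀ i ∈ s, P (g i)) → P (∑ i ∈ s, g i) :=
    fun s g hg => Finset.sum_induction g P hPadd hP0 hg
  have hPmul : ∀ p q : ℕ, p + q = d → ∀ a ∈ 𝒬 p, aug a = 0 → ∀ b ∈ 𝒬 q, (∀ m : M, b • m = 0) →
      P (a * b) := by
    rintro p q rfl a ha ha0 b hb hbM
    -- `barE b` is a homotopy for `b`, since `b` annihilates `M`; the factor `a ∈ Q₊` makes its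
    -- multiple vanish on `k ⊗ B`.
    refine ⟨a • barE bQ b, ⟨Submodule.smul_mem _ _ (barE_mem_shuffleSpan bQ b), fun x => ?_,
      fun c => ?_⟩, ?_⟩
    · rw [LinearMap.smul_apply, LinearMap.smul_apply, map_smul, ← smul_add,
        barD_barE bQ bM b hbM, mul_smul]
    · have := biPiece_smulGraded 𝒬 _ _ _ _ _ ha (barE_mem (degM := degM) hQ hb c)
      have h2 : barDeg degQ degM c + ((p + q : ℕ) : ℤ) = p + (barDeg degQ degM c + q) := by
        push_cast; ring
      rw [h2]
      exact this
    · rw [baseChangeMap_smul, RingHom.coe_coe, ha0, zero_smul]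
  -- A presentation of `f` by products `a b` need not be homogeneous. Its part of degree `d` is a
  -- sum of products of components, and the components of `b` still annihilate `M`.
  suffices H : ∀ x ∈ plusIdeal 𝒬 * Module.annihilator Q M, P (GradedRing.proj 𝒬 d x) by
    have := H f hf
    rwa [GradedRing.proj_apply, DirectSum.decompose_of_mem_same 𝒬 hfd] at this
  intro x hx
  induction hx using Submodule.mul_induction_on' with
  | add x _ y _ hx hy => rw [map_add]; exact hPadd _ _ hx hy
  | mem_mul_mem a ha b hb =>
    rw [← DirectSum.sum_support_decompose 𝒬 a, Finset.sum_mul, map_sum]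
    refine hPsum _ _ fun p _ => ?_
    rw [← DirectSum.sum_support_decompose 𝒬 b, Finset.mul_sum, map_sum]
    refine hPsum _ _ fun q _ => ?_
    have hpq : ((DirectSum.decompose 𝒬 a p : 𝒬 p) : Q) * (DirectSum.decompose 𝒬 b q : 𝒬 q) ∈
      𝒬 (p + q) := SetLike.GradedMul.mul_mem (SetLike.coe_mem _) (SetLike.coe_mem _)
    rw [GradedRing.proj_apply]
    by_cases h : p + q = d
    · rw [← h, DirectSum.decompose_of_mem_same 𝒬 hpq]
      refine hPmul p q h _ (SetLike.coe_mem _) ?_ _ (SetLike.coe_mem _)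
        (decompose_smul_eq_zero hM hsmul (Module.mem_annihilator.1 hb) q)
      rcases Nat.eq_zero_or_pos p with rfl | hp
      · have ha' : a ∈ HomogeneousIdeal.irrelevant 𝒬 := ha
        rw [HomogeneousIdeal.mem_irrelevant_iff, GradedRing.proj_apply] at ha'
        rw [ha', map_zero]
      · exact (haug _).2 (mem_plusIdeal_of_mem 𝒬 hp.ne' (SetLike.coe_mem _))
    · rw [DirectSum.decompose_of_mem_ne 𝒬 hpq h]
      exact hP0

end Homotopies

/-! ### Grading and augmentation of the quotient ring. -/

section Quotient

variable {K Q R : Type*} [Field K] [CommRing Q] [Algebra K Q] {𝒬 : ℕ → Submodule K Q}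
  [GradedAlgebra 𝒬] [CommRing R] [Algebra K R] {ℛ : ℕ → Submodule K R} [GradedAlgebra ℛ]
  [Algebra Q R] [IsScalarTower K Q R]

lemma proj_algebraMap (hgr : ∀ (n : ℕ) (q : Q), q ∈ 𝒬 n → algebraMap Q R q ∈ ℛ n) (n : ℕ) (q : Q) :
    GradedRing.proj ℛ n (algebraMap Q R q) = algebraMap Q R (GradedRing.proj 𝒬 n q) := by
  induction q using DirectSum.Decomposition.inductionOn 𝒬 with
  | zero => simp only [map_zero]
  | add q q' h h' => simp only [map_add, h, h']
  | @homogeneous i q =>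
    rw [GradedRing.proj_apply, GradedRing.proj_apply]
    rcases eq_or_ne i n with rfl | h
    · rw [DirectSum.decompose_of_mem_same 𝒬 q.2,
        DirectSum.decompose_of_mem_same ℛ (hgr i _ q.2)]
    · rw [DirectSum.decompose_of_mem_ne 𝒬 q.2 h, DirectSum.decompose_of_mem_ne ℛ (hgr i _ q.2) h,
        map_zero]

lemma algebraMap_mem_plusIdeal (hgr : ∀ (n : ℕ) (q : Q), q ∈ 𝒬 n → algebraMap Q R q ∈ ℛ n) {q : Q}
    (hq : q ∈ plusIdeal 𝒬) : algebraMap Q R q ∈ plusIdeal ℛ := by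
  change q ∈ HomogeneousIdeal.irrelevant 𝒬 at hq
  change _ ∈ HomogeneousIdeal.irrelevant ℛ
  rw [HomogeneousIdeal.mem_irrelevant_iff] at hq ⊢
  rw [proj_algebraMap hgr, hq, map_zero]

lemma piece_zero_eq_one_of_surjective (hQ₀ : 𝒬 0 = (1 : Submodule K Q))
    (hgr : ∀ (n : ℕ) (q : Q), q ∈ 𝒬 n → algebraMap Q R q ∈ ℛ n)
    (hsurj : Function.Surjective (algebraMap Q R)) : ℛ 0 = (1 : Submodule K R) := by
  refine le_antisymm (fun r hr => ?_) (fun r hr => ?_)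
  · obtain ⟨q, rfl⟩ := hsurj r
    have h1 := proj_algebraMap (𝒬 := 𝒬) hgr 0 q
    rw [GradedRing.proj_apply, DirectSum.decompose_of_mem_same ℛ hr] at h1
    have h2 : GradedRing.proj 𝒬 0 q ∈ 𝒬 0 := by
      rw [GradedRing.proj_apply]; exact SetLike.coe_mem _
    rw [hQ₀, Submodule.mem_one] at h2
    obtain ⟨c, hc⟩ := h2
    rw [h1, ← hc, Submodule.mem_one]
    exact ⟨c, IsScalarTower.algebraMap_apply K Q R c⟩
  · rw [Submodule.mem_one] at hr
    obtain ⟨c, rfl⟩ := hr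
    rw [Algebra.algebraMap_eq_smul_one]
    exact Submodule.smul_mem _ c SetLike.GradedOne.one_mem

lemma IsAug.comp_algebraMap {augQ : Q →ₐ[K] K} {augR : R →ₐ[K] K} (haugQ : IsAug 𝒬 augQ)
    (haugR : IsAug ℛ augR) (hgr : ∀ (n : ℕ) (q : Q), q ∈ 𝒬 n → algebraMap Q R q ∈ ℛ n) :
    (augR : R →+* K).comp (algebraMap Q R) = augQ := by
  ext q
  have h1 : q - algebraMap K Q (augQ q) ∈ plusIdeal 𝒬 := by rw [← haugQ]; simp
  have h2 := (haugR _).2 (algebraMap_mem_plusIdeal (ℛ := ℛ) hgr h1)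
  rw [map_sub, map_sub, ← IsScalarTower.algebraMap_apply K Q R, AlgHom.commutes, sub_eq_zero] at h2
  exact h2

end Quotient

/-! ### Comparison of `Tor` over `Q` with `Tor` over `R`. -/

section Comparison

universe w u u' v t t'

variable {K : Type w} [Field K] {Q : Type u} [CommRing Q] [Algebra K Q]
  {𝒬 : ℕ → Submodule K Q} [GradedAlgebra 𝒬] {R : Type u'} [CommRing R] [Algebra K R]
  {ℛ : ℕ → Submodule K R} [GradedAlgebra ℛ] [Algebra Q R]
  {M : Type v} [AddCommGroup M] [Module R M]
  [Module Q M] [IsScalarTower Q R M] [Module K M] [IsScalarTower K Q M] {ℳ : ℤ → AddSubgroup M}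
  {βQ : Type t} {βM : Type t'}
  {bQ : Module.Basis βQ K Q} {bM : Module.Basis βM K M} {degQ : βQ → ℕ} {degM : βM → ℤ}
  {augQ : Q →ₐ[K] K} {augR : R →ₐ[K] K} {f : Q} {d : ℕ}
  {E : (BarIndex βQ βM →₀ Q) →ₗ[Q] (BarIndex βQ βM →₀ Q)}

/-- `Tor` over `Q` is computed by the bar resolution. -/
lemma nontrivial_gradedTor_iff_bar (haugQ : IsAug 𝒬 augQ) (hQ : IsHomogeneousBasis 𝒬 bQ degQ)
    (hM : IsHomogeneousBasis ℳ bM degM) (hsmul : SMulGraded 𝒬 ℳ) (n : ℕ) (j : ℤ) :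
    Nontrivial (gradedTor 𝒬 ℳ n j) ↔ HomologyNonzero barHom (barDeg degQ degM)
      (baseChangeMap (augQ : Q →+* K) (barD bQ bM)) n j :=
  (nontrivial_gradedTor_iff ℳ haugQ n j).trans
    ⟨fun h => h.of_resolution _ (barResolution hQ hM hsmul) haugQ,
      fun h => FreeResolution.TorNonzero.of_resolution (barResolution hQ hM hsmul) _ haugQ h⟩

lemma baseChangeMap_cone (hcomp : (augR : R →+* K).comp (algebraMap Q R) = augQ) :
    baseChangeMap (augR : R →+* K) (baseChangeMap (algebraMap Q R) (coneD (barD bQ bM) E)) =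
      coneD (baseChangeMap (augQ : Q →+* K) (barD bQ bM)) (baseChangeMap (augQ : Q →+* K) E) := by
  rw [baseChangeMap_baseChangeMap, hcomp, baseChangeMap_coneD]

/-- `Tor` over `R = Q/(f)` is computed by the cone of the bar resolution over `Q`; the cone is a
bigraded complex. -/
lemma nontrivial_gradedTor_iff_cone (haugR : IsAug ℛ augR)
    (hcomp : (augR : R →+* K).comp (algebraMap Q R) = augQ) (hQ : IsHomogeneousBasis 𝒬 bQ degQ)
    (hM : IsHomogeneousBasis ℳ bM degM) (hsmul : SMulGraded 𝒬 ℳ) (hf : f ∈ nonZeroDivisors Q)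
    (hgr : ∀ (n : ℕ) (q : Q), q ∈ 𝒬 n → algebraMap Q R q ∈ ℛ n)
    (hsurj : Function.Surjective (algebraMap Q R))
    (hker : RingHom.ker (algebraMap Q R) = Ideal.span {f})
    (hE : IsShuffleHomotopy 𝒬 bQ bM degQ degM f d E) :
    IsBigraded (coneHom barHom) (coneDeg (barDeg degQ degM) d)
        (coneD (baseChangeMap (augQ : Q →+* K) (barD bQ bM)) (baseChangeMap (augQ : Q →+* K) E)) ∧
      ∀ n j, Nontrivial (gradedTor ℛ ℳ n j) ↔
        HomologyNonzero (coneHom barHom) (coneDeg (barDeg degQ degM) d)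
          (coneD (baseChangeMap (augQ : Q →+* K) (barD bQ bM)) (baseChangeMap (augQ : Q →+* K) E))
          n j := by
  let F : FreeResolution ℛ ℳ := coneResolution (barResolution hQ hM hsmul)
    (hE.toSquareZeroHomotopy hQ hM hsmul) hf hgr hsurj hker
  rw [← baseChangeMap_cone hcomp]
  exact ⟨F.isBigraded haugR, fun n j => (nontrivial_gradedTor_iff ℳ haugR n j).trans
    ⟨fun h => h.of_resolution _ F haugR,
      fun h => FreeResolution.TorNonzero.of_resolution F _ haugR h⟩⟩

lemma IsShuffleHomotopy.baseChange_D_E (hE : IsShuffleHomotopy 𝒬 bQ bM degQ degM f d E)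
    (hf : augQ f = 0) (x : BarIndex βQ βM →₀ K) :
    baseChangeMap (augQ : Q →+* K) (barD bQ bM) (baseChangeMap (augQ : Q →+* K) E x) +
      baseChangeMap (augQ : Q →+* K) E (baseChangeMap (augQ : Q →+* K) (barD bQ bM) x) = 0 := by
  have h : barD bQ bM ∘ₗ E + E ∘ₗ barD bQ bM = f • LinearMap.id := LinearMap.ext hE.D_E
  rw [baseChangeMap_comp, baseChangeMap_comp, ← LinearMap.add_apply, ← baseChangeMap_add, h,
    baseChangeMap_smul, RingHom.coe_coe, hf, zero_smul, LinearMap.zero_apply]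

lemma IsShuffleHomotopy.baseChange_E_E (hE : IsShuffleHomotopy 𝒬 bQ bM degQ degM f d E)
    (x : BarIndex βQ βM →₀ K) :
    baseChangeMap (augQ : Q →+* K) E (baseChangeMap (augQ : Q →+* K) E x) = 0 := by
  have h : E ∘ₗ E = 0 := LinearMap.ext (shuffleSpan_sq bQ bM hE.mem_span)
  rw [baseChangeMap_comp, h, baseChangeMap_zero, LinearMap.zero_apply]

lemma baseChangeMap_barD_barD (x : BarIndex βQ βM →₀ K) :
    baseChangeMap (augQ : Q →+* K) (barD bQ bM)
      (baseChangeMap (augQ : Q →+* K) (barD bQ bM) x) = 0 := by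
  have h : barD bQ bM ∘ₗ barD bQ bM = 0 := LinearMap.ext (barD_barD bQ bM)
  rw [baseChangeMap_comp, h, baseChangeMap_zero, LinearMap.zero_apply]

lemma coneD_coneD_eq_zero {β : Type*} {D E : (β →₀ K) →ₗ[K] (β →₀ K)} (hDD : ∀ x, D (D x) = 0)
    (hDE : ∀ x, D (E x) + E (D x) = 0) (hEE : ∀ x, E (E x) = 0) (z : ℕ × β →₀ K) :
    coneD D E (coneD D E z) = 0 := curry_ext fun i => by
  rw [curry_coneD_apply, curry_coneD_apply, curry_coneD_apply, D.map_add, E.map_add, hDD, hEE,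
    zero_add, add_zero, hDE, curry_zero_apply]

/-- The relations between `Tor` over `Q` and `Tor` over `R = Q/(f)`. -/
lemma nontrivial_gradedTor_relations (haugQ : IsAug 𝒬 augQ) (haugR : IsAug ℛ augR)
    (hcomp : (augR : R →+* K).comp (algebraMap Q R) = augQ) (hQ : IsHomogeneousBasis 𝒬 bQ degQ)
    (hM : IsHomogeneousBasis ℳ bM degM) (hMint : DirectSum.IsInternal ℳ) (hsmul : SMulGraded 𝒬 ℳ)
    (hfd : f ∈ 𝒬 d) (hfplus : f ∈ plusIdeal 𝒬) (hf : f ∈ nonZeroDivisors Q)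
    (hgr : ∀ (n : ℕ) (q : Q), q ∈ 𝒬 n → algebraMap Q R q ∈ ℛ n)
    (hsurj : Function.Surjective (algebraMap Q R))
    (hker : RingHom.ker (algebraMap Q R) = Ideal.span {f}) :
    (∀ n j, Nontrivial (gradedTor 𝒬 ℳ n j) → Nontrivial (gradedTor ℛ ℳ n j) ∨
      ∃ m, n = m + 1 ∧ Nontrivial (gradedTor ℛ ℳ m (j - d))) ∧
    (∀ n j, Nontrivial (gradedTor ℛ ℳ n j) → Nontrivial (gradedTor 𝒬 ℳ n j) ∨
      ∃ m, n = m + 2 ∧ Nontrivial (gradedTor ℛ ℳ m (j - d))) ∧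
    (f ∉ plusIdeal 𝒬 ^ 2 →
      (∀ n j, Nontrivial (gradedTor ℛ ℳ n j) → Nontrivial (gradedTor 𝒬 ℳ n j)) ∧
      ∀ j, Nontrivial (gradedTor 𝒬 ℳ 0 j) → Nontrivial (gradedTor 𝒬 ℳ 1 (j + d))) ∧
    (f ∈ plusIdeal 𝒬 * Module.annihilator Q M →
      (∀ n j, Nontrivial (gradedTor 𝒬 ℳ n j) → Nontrivial (gradedTor ℛ ℳ n j)) ∧
      ∀ j, Nontrivial (gradedTor 𝒬 ℳ 0 j) → Nontrivial (gradedTor ℛ ℳ 2 (j + d))) := by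
  have hfM : ∀ m : M, f • m = 0 := fun m => by
    have h : f ∈ RingHom.ker (algebraMap Q R) := hker ▸ Ideal.mem_span_singleton_self f
    rw [← algebraMap_smul R, (RingHom.mem_ker).1 h, zero_smul]
  have haugf : augQ f = 0 := (haugQ f).2 hfplus
  have hE : IsShuffleHomotopy 𝒬 bQ bM degQ degM f d (barE bQ f) :=
    isShuffleHomotopy_barE hQ hfd hfM
  have hDE := hE.baseChange_D_E haugf
  have hEE := hE.baseChange_E_E (augQ := augQ)
  have hVV := coneD_coneD_eq_zero (baseChangeMap_barD_barD (augQ := augQ)) hDE hEE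
  obtain ⟨hV, hTR⟩ :=
    nontrivial_gradedTor_iff_cone haugR hcomp hQ hM hsmul hf hgr hsurj hker hE
  have hTQ := nontrivial_gradedTor_iff_bar haugQ hQ hM hsmul
  refine ⟨fun n j h => ?_, fun n j h => ?_, fun hf2 => ?_, fun hfa => ?_⟩
  · simp only [hTR]
    exact ((hTQ n j).1 h).to_cone hV hDE hEE
  · simp only [hTQ, hTR] at h ⊢
    exact h.of_cone hV hVV
  · obtain ⟨φ, h1, hφ, hφf⟩ := exists_derivation haugQ hfplus hf2
    have hID := barContract_barD bQ (bM := bM) h1 hφ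
    have hIE := fun w => (barContract_barE (βM := βM) bQ h1 hφ haugf w).trans
      (by rw [hφf, one_smul])
    refine ⟨fun n j h => (hTQ n j).2 (((hTR n j).1 h).of_cone_of_contraction hV hVV hID hIE),
      fun j h => (hTQ 1 _).2 (((hTQ 0 j).1 h).one_of_contraction (fun p hp => ?_) hDE
        (fun p hp => ?_) hID hIE)⟩
    · have := mapCoeff_mem_biSupp haugQ (hE.E_mem p)
      rwa [hp, zero_add, ← baseChangeMap_single_one] at this
    · obtain ⟨l, m⟩ := p
      obtain rfl := List.length_eq_zero_iff.1 hp
      simp [barContract]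
  -- `Tor` over `R` may be computed with the cone of any shuffle homotopy. With this one the second
  -- part of the differential vanishes over `K`.
  · obtain ⟨E', hE', hE0⟩ :=
      exists_isShuffleHomotopy (bM := bM) (degM := degM) haugQ hQ hMint hsmul hfd hfa
    obtain ⟨-, hTR'⟩ :=
      nontrivial_gradedTor_iff_cone haugR hcomp hQ hM hsmul hf hgr hsurj hker hE'
    rw [hE0] at hTR'
    exact ⟨fun n j h => (hTR' n j).2 ((hTQ n j).1 h).to_cone_zero,
      fun j h => (hTR' 2 _).2 ((hTQ 0 j).1 h).to_cone_two⟩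

end Comparison

/-! ### Homogeneous bases of graded modules. -/

section Bases

universe v

variable {K Q : Type*} {M : Type v} [Field K] [CommRing Q] [Algebra K Q] {𝒬 : ℕ → Submodule K Q}
  [GradedAlgebra 𝒬] [AddCommGroup M] [Module Q M] [Module K M] [IsScalarTower K Q M]
  {ℳ : ℤ → AddSubgroup M}

/-- Scalars lie in degree zero of `Q`, so the graded pieces are `K`-subspaces although they are
given only as subgroups. -/
lemma exists_isHomogeneousBasis_of_smulGraded (hM : DirectSum.IsInternal ℳ)
    (hsmul : SMulGraded 𝒬 ℳ) : ∃ (β : Type v) (deg : β → ℤ) (b : Module.Basis β K M),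
      IsHomogeneousBasis ℳ b deg := by
  let ℳ' : ℤ → Submodule K M := fun j =>
    { ℳ j with
      smul_mem' := fun c x hx => by
        have h1 : algebraMap K Q c ∈ 𝒬 0 := by
          rw [Algebra.algebraMap_eq_smul_one]
          exact Submodule.smul_mem _ c SetLike.GradedOne.one_mem
        have h2 := hsmul 0 j _ x h1 hx
        rwa [algebraMap_smul, Nat.cast_zero, zero_add] at h2 }
  have hM' : DirectSum.IsInternal ℳ' := hM
  obtain ⟨β, deg, b, hb⟩ := exists_isHomogeneousBasis ℳ' hM'
  exact ⟨β, deg, b, hb.mem, hb.repr⟩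

end Bases

end SlopeOfModules

end

open SlopeOfModules in
theorem mainTheorem6 {K Q R M : Type*} [Field K]
    -- a commutative graded `K`-algebra `Q` with `Q₀ = K`
    [CommRing Q] [Nontrivial Q] [Algebra K Q] (𝒬 : ℕ → Submodule K Q) [GradedAlgebra 𝒬]
    (hQ₀ : 𝒬 0 = (1 : Submodule K Q))
    -- a homogeneous non-zero-divisor `f ∈ Q₊` of degree `d`
    (f : Q) (d : ℕ) (hfd : f ∈ 𝒬 d) (hfplus : f ∈ plusIdeal 𝒬) (hf : f ∈ nonZeroDivisors Q)
    -- the graded `K`-algebra `R = Q/(f)`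
    [CommRing R] [Algebra K R] (ℛ : ℕ → Submodule K R) [GradedAlgebra ℛ]
    [Algebra Q R] [IsScalarTower K Q R]
    (hgr : ∀ (n : ℕ) (q : Q), q ∈ 𝒬 n → algebraMap Q R q ∈ ℛ n)
    (hsurj : Function.Surjective (algebraMap Q R))
    (hker : RingHom.ker (algebraMap Q R) = Ideal.span {f})
    -- a graded `R`-module `M` with `M_j = 0` for `j ≪ 0`, viewed also as a `Q`-module
    [AddCommGroup M] [Module R M] [Module Q M] [IsScalarTower Q R M] (ℳ : ℤ → AddSubgroup M)
    (hM : IsGradedModule ℛ ℳ) (hbdd : ∃ j₀ : ℤ, ∀ j : ℤ, j < j₀ → ℳ j = ⊥) :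
    (slope 𝒬 ℳ ≤ max (slope ℛ ℳ) (d : EReal) ∧
      (Nontrivial M → f ∉ plusIdeal 𝒬 ^ 2 → slope 𝒬 ℳ = max (slope ℛ ℳ) (d : EReal))) ∧
    (slope ℛ ℳ ≤ max (slope 𝒬 ℳ) ((d : EReal) / 2) ∧
      (Nontrivial M → f ∈ plusIdeal 𝒬 * Module.annihilator Q M →
        slope ℛ ℳ = max (slope 𝒬 ℳ) ((d : EReal) / 2))) := by
  obtain ⟨augQ, haugQ⟩ := exists_isAug 𝒬 hQ₀
  -- Otherwise `1 ∈ (f) ⊆ Q₊`, which the augmentation excludes.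
  have : Nontrivial R := by
    by_contra h
    rw [not_nontrivial_iff_subsingleton] at h
    have h1 : (1 : Q) ∈ RingHom.ker (algebraMap Q R) := Subsingleton.elim _ _
    rw [hker] at h1
    have h2 := (haugQ 1).2 ((Ideal.span_singleton_le_iff_mem _).2 hfplus h1)
    rw [map_one] at h2
    exact one_ne_zero h2
  obtain ⟨augR, haugR⟩ := exists_isAug ℛ (piece_zero_eq_one_of_surjective hQ₀ hgr hsurj)
  rcases subsingleton_or_nontrivial M with hsub | hnt
  · have hQ : slope 𝒬 ℳ = ⊥ := slopeOf_eq_bot fun i j h =>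
      (stdResolution 𝒬 ℳ).not_torNonzero haugQ i j ((nontrivial_gradedTor_iff ℳ haugQ i j).1 h)
    have hR : slope ℛ ℳ = ⊥ := slopeOf_eq_bot fun i j h =>
      (stdResolution ℛ ℳ).not_torNonzero haugR i j ((nontrivial_gradedTor_iff ℳ haugR i j).1 h)
    exact ⟨⟨hQ ▸ bot_le, fun h => absurd hsub (not_subsingleton_iff_nontrivial.2 h)⟩,
      hR ▸ bot_le, fun h => absurd hsub (not_subsingleton_iff_nontrivial.2 h)⟩
  have hsmul : SMulGraded 𝒬 ℳ := fun n j q x hq hx => by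
    rw [← algebraMap_smul R]
    exact hM.smul_mem n j _ x (hgr n q hq) hx
  let _ : Module K M := Module.compHom M (algebraMap K Q)
  have : IsScalarTower K Q M := IsScalarTower.of_algebraMap_smul fun _ _ => rfl
  obtain ⟨βQ, degQ, bQ, hbQ⟩ :=
    exists_isHomogeneousBasis 𝒬 (DirectSum.Decomposition.isInternal 𝒬)
  obtain ⟨βM, degM, bM, hbM⟩ := exists_isHomogeneousBasis_of_smulGraded hM.isInternal hsmul
  obtain ⟨hA, hB, hC, hD⟩ := nontrivial_gradedTor_relations haugQ haugR
    (haugQ.comp_algebraMap haugR hgr) hbQ hbM hM.isInternal hsmul hfd hfplus hf hgr hsurj hker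
  -- In homological degree zero the correction terms, of degree `-1` and `-2`, do not exist.
  have h0 : ∀ j, Nontrivial (gradedTor 𝒬 ℳ 0 j) ↔ Nontrivial (gradedTor ℛ ℳ 0 j) := fun j =>
    ⟨fun h => (hA 0 j h).resolve_right (by rintro ⟨m, hm, -⟩; omega),
      fun h => (hB 0 j h).resolve_right (by rintro ⟨m, hm, -⟩; omega)⟩
  have hneQ : ∃ j, Nontrivial (gradedTor 𝒬 ℳ 0 j) := by
    obtain ⟨j, hj⟩ := (stdResolution 𝒬 ℳ).exists_torNonzero_zero haugQ hM.isInternal hsmul hbdd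
    exact ⟨j, (nontrivial_gradedTor_iff ℳ haugQ 0 j).2 hj⟩
  have hneR : ∃ j, Nontrivial (gradedTor ℛ ℳ 0 j) := hneQ.imp fun j => (h0 j).1
  have hle1 : slope 𝒬 ℳ ≤ max (slope ℛ ℳ) (d : EReal) := slopeOf_le_max_of_step_one hneQ h0 hA
  have hle2 : slope ℛ ℳ ≤ max (slope 𝒬 ℳ) ((d : EReal) / 2) :=
    slopeOf_le_max_of_step_two hneR (fun j => (h0 j).symm) hB
  refine ⟨⟨hle1, fun _ hf2 => le_antisymm hle1 ?_⟩, hle2, fun _ hfa => le_antisymm hle2 ?_⟩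
  -- The degrees of `Tor_0`, raised by `d`, occur in `Tor^Q_1`: this is the case `r = 1`. For the
  -- other equality they occur in `Tor^R_2`, whence `r = 2` and `d / 2`.
  · have h1 := max_le_slopeOf hneR (fun j => (h0 j).symm) (hC hf2).1 le_rfl
      (fun j h => (hC hf2).2 j ((h0 j).2 h))
    rw [Nat.cast_one, div_one] at h1
    exact h1
  · exact max_le_slopeOf hneQ h0 (hD hfa).1 one_le_two (hD hfa).2
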